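/- A digital search tree (DST) is built by inserting data one after the other into a binary tree: the first datum is placed in the root, and each later datum moves down from the root until it reaches an empty position, where it becomes a new node. In a random DST every decision whether to go left or right is made by an independent fair coin. A node is 2-protected if its distance to every leaf (node without children) is at least 2. Let $l_N$ be the average number of 2-protected nodes in a random DST of size $N$. Put $L=\log 2$, $Q_m=\prod_{k=1}^m(1-2^{-k})$, $Q_\infty=\prod_{k\ge1}(1-2^{-k})$, $Q(x)=\prod_{k\ge1}(1-x2^{-k})=\sum_{m\ge0}a_{m+1}x^m$ with $a_{m+1}=(-1)^m2^{-\binom{m+1}{2}}/Q_m$. For $m\ge0$ let $S_m(z)$ be the extension to complex $z$ of $$\sum_{n=1}^{z-2}\Big[1-(n+1)2^{-n}-\tfrac{n(n+1)}4\Big]2^{-nm}$$ given by the usual closed forms of the (differentiated) geometric sums $\sum_{n=1}^M w^n$, $\sum_{n=1}^M (n+1)w^n$, $\sum_{n=1}^M n(n+1)w^n$ (with $w^M=2^{-jM}$ for $w=2^{-j}$, and the polynomials in $M$ when $w=1$), and let $$\psi(z)=\frac{Q_\infty}{Q(2^{2-z})}\cdot\frac1{Q_\infty}\sum_{m\ge0}a_{m+1}S_m(z).$$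 Let $b_0=\frac{37}{12L}-4$ and, for $m\ge1$, $$b_m=\frac1{4L}\,\frac{B(2^{-m})}{(2^{-m}-1)^3(2^{-m}-2)^2},$$ where $B(x)=16L-48xL+48x^2L-16x^3L-20+60x-69x^2+36x^3-7x^4-8x\log x+12x^2\log x-10x^3\log x+4x^4\log x$. Then $b_m=\lim_{z\to1}\frac{Q_\infty/Q(2^{1-z})}{1-2^{1-z}}S_m(z)$ for all $m\ge0$, the series $\sum_{m\ge0}a_{m+1}b_m$ converges, and, as $N\to\infty$, $$l_N=N\cdot\frac1{Q_\infty}\sum_{m\ge0}a_{m+1}b_m+N\cdot\delta(\log_2N)+O(1),$$ where the constant $\frac1{Q_\infty}\sum_{m\ge0}a_{m+1}b_m$ equals $0.30707981393605921828549\dots$, and $\delta:\mathbb R\to\mathbb R$ is a function of period $1$ with the absolutely convergent, mean-zero Fourier expansion $\delta(x)=\sum_{k\ne0}c_ke^{2\pi ikx}$. Here, with $\chi_k=\frac{2\pi ik}{L}$, the coefficient $c_k=\lim_{z\to1+\chi_k}(z-1-\chi_k)\,\Gamma(-z)\psi(z)$ is the residue of $\Gamma(-z)\psi(z)$ at its (at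 most simple) pole $1+\chi_k$. The function $\delta$ is tiny: $|\delta(x)|<5\cdot10^{-5}$ for all $x$. -/

import Mathlib

open Filter Topology Asymptotics

noncomputable section

namespace DST

/-! ### Random digital search trees

Only the shape of a digital search tree matters for counting nodes, so it is a binary tree without
labels: `nil` is the empty tree and each `node` holds one datum. -/

/-- One fair coin toss. -/
def coin : PMF Bool := PMF.uniformOfFintype Bool

/-- Insertion of one further datum. It is placed at the root of an empty tree; at an occupied node
a fair coin (the next bit of the datum) decides whether it goes down to the left or to the right,
where the procedure is repeated. -/
def insertRandom : BinaryTree Unit → PMF (BinaryTree Unit)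
  | .nil => PMF.pure (.node () .nil .nil)
  | .node _ l r => coin.bind fun bit =>
      if bit then (insertRandom r).map fun r' => .node () l r'
      else (insertRandom l).map fun l' => .node () l' r

/-- The random digital search tree built from `n` data, inserted one after the other. -/
def randomTree : ℕ → PMF (BinaryTree Unit)
  | 0 => PMF.pure .nil
  | n + 1 => (randomTree n).bind insertRandom

/-- The distance from the root of a tree to the nearest leaf (a node without children);
it is `⊤` for the empty tree, which has no leaf. -/
def leafDist : BinaryTree Unit → ℕ∞
  | .nil => ⊤
  | .node _ l r => if l = .nil ∧ r = .nil then 0 else 1 + min (leafDist l) (leafDist r)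

/-- The number of 2-protected nodes: those at distance at least 2 from every leaf. (A neighbour of
a node that is a leaf is one of its children, so only leaves below the node matter.) -/
def protectedCount : BinaryTree Unit → ℕ
  | .nil => 0
  | .node v l r =>
      (if 2 ≤ leafDist (.node v l r) then 1 else 0) + protectedCount l + protectedCount r

/-- `l_N`, the average number of 2-protected nodes in a random digital search tree of size `N`. -/
def averageProtected (N : ℕ) : ℝ :=
  (∑' t : BinaryTree Unit, randomTree N t * (protectedCount t : ENNReal)).toReal

/-! ### The `q`-series quantities, for `q = 1/2` -/

/-- `Q_m = ∏_{k=1}^m (1 - 2^{-k})`. -/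
def Q (m : ℕ) : ℝ := ∏ k ∈ Finset.Icc 1 m, (1 - 1 / 2 ^ k)

/-- `Q_∞ = ∏_{k ≥ 1} (1 - 2^{-k})`. -/
def QInf : ℝ := ∏' k : ℕ, (1 - 1 / 2 ^ (k + 1))

/-- `Q(x) = ∏_{k ≥ 1} (1 - x 2^{-k})`. -/
def QFun (x : ℂ) : ℂ := ∏' k : ℕ, (1 - x / 2 ^ (k + 1))

/-- `eulerCoeff m` is `a_{m+1} = (-1)^m 2^{-binom(m+1,2)} / Q_m`, the coefficient of `x^m`
in `Q(x)`. -/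
def eulerCoeff (m : ℕ) : ℝ := (-1) ^ m / (2 ^ ((m + 1).choose 2) * Q m)

/-- The numerator `B(x)` of the numbers `b_m`. -/
def B (x : ℝ) : ℝ :=
  16 * Real.log 2 - 48 * x * Real.log 2 + 48 * x ^ 2 * Real.log 2 - 16 * x ^ 3 * Real.log 2
    - 20 + 60 * x - 69 * x ^ 2 + 36 * x ^ 3 - 7 * x ^ 4
    - 8 * x * Real.log x + 12 * x ^ 2 * Real.log x - 10 * x ^ 3 * Real.log x
    + 4 * x ^ 4 * Real.log x

/-- The numbers `b_m`. -/
def b (m : ℕ) : ℝ :=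
  if m = 0 then 37 / (12 * Real.log 2) - 4
  else 1 / (4 * Real.log 2) *
    (B ((1 / 2) ^ m) / (((1 / 2) ^ m - 1) ^ 3 * ((1 / 2) ^ m - 2) ^ 2))

/-- The constant `(1 / Q_∞) ∑_{m ≥ 0} a_{m+1} b_m`. -/
def leadingConstant : ℝ := 1 / QInf * ∑' m : ℕ, eulerCoeff m * b m

/-! ### The extension of the inner sums to complex arguments -/

/-- Closed form of `∑_{n=1}^M w^n` for `w = 2^{-j}`, with `M` complex. -/
def geom0 (j : ℕ) (M : ℂ) : ℂ :=
  if j = 0 then M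
  else
    let w : ℂ := (1 / 2) ^ j
    let r : ℂ := 2 ^ (-(j * M))
    w * (1 - r) / (1 - w)

/-- Closed form of `∑_{n=1}^M (n+1) w^n` for `w = 2^{-j}`, with `M` complex. -/
def geom1 (j : ℕ) (M : ℂ) : ℂ :=
  if j = 0 then M * (M + 3) / 2
  else
    let w : ℂ := (1 / 2) ^ j
    let r : ℂ := 2 ^ (-(j * M))
    (2 * w - (M + 2) * w * r) / (1 - w) + w ^ 2 * (1 - r) / (1 - w) ^ 2

/-- Closed form of `∑_{n=1}^M n(n+1) w^n` for `w = 2^{-j}`, with `M` complex. -/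
def geom2 (j : ℕ) (M : ℂ) : ℂ :=
  if j = 0 then M * (M + 1) * (M + 2) / 3
  else
    let w : ℂ := (1 / 2) ^ j
    let r : ℂ := 2 ^ (-(j * M))
    w * ((2 - (M + 2) * (M + 1) * r) / (1 - w) + 2 * (2 * w - (M + 2) * w * r) / (1 - w) ^ 2
      + 2 * w ^ 2 * (1 - r) / (1 - w) ^ 3)

/-- `S_m(z)`, the extension to complex `z` of
`∑_{n=1}^{z-2} (1 - (n+1) 2^{-n} - n(n+1)/4) 2^{-nm}`. -/
def innerSum (m : ℕ) (z : ℂ) : ℂ :=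
  geom0 m (z - 2) - geom1 (m + 1) (z - 2) - geom2 m (z - 2) / 4

/-- `ψ(z)`, the extension to complex `z` of
`Q_{z-2} ∑_{n=1}^{z-2} (1 - (n+1) 2^{-n} - n(n+1)/4) / Q_n`, obtained from
`Q_{z-2} = Q_∞ / Q(2^{2-z})` and `1 / Q_n = (1 / Q_∞) ∑_{m ≥ 0} a_{m+1} 2^{-nm}`. -/
def psi (z : ℂ) : ℂ :=
  (QInf : ℂ) / QFun (2 ^ (2 - z)) *
    (1 / (QInf : ℂ) * ∑' m : ℕ, (eulerCoeff m : ℂ) * innerSum m z)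

/-- The points `χ_k = 2πik / log 2`. -/
def chi (k : ℤ) : ℂ := 2 * Real.pi * Complex.I * k / Real.log 2

private lemma two_cpow_neg (j M : ℕ) : (2 : ℂ) ^ (-((j : ℂ) * (M : ℂ))) = ((1 / 2) ^ j) ^ M := by
  rw [Complex.cpow_neg, ← Nat.cast_mul, Complex.cpow_natCast, pow_mul]
  simp

private lemma one_sub_ne (j : ℕ) (hj : j ≠ 0) : (1 : ℂ) - (1 / 2) ^ j ≠ 0 := by
  intro h
  have h1 : ((1 / 2 : ℂ)) ^ j = 1 := (sub_eq_zero.mp h).symm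
  have h2 : ‖((1 / 2 : ℂ)) ^ j‖ = 1 := by rw [h1]; simp
  rw [norm_pow] at h2
  have h3 : ‖(1 / 2 : ℂ)‖ = 1 / 2 := by norm_num
  rw [h3] at h2
  have := pow_lt_one₀ (by norm_num : (0 : ℝ) ≤ 1 / 2) (by norm_num) hj
  linarith

private lemma geom0_natCast (j M : ℕ) :
    geom0 j M = ∑ n ∈ Finset.Icc 1 M, (((1 / 2 : ℂ)) ^ j) ^ n := by
  unfold geom0
  split_ifs with h
  · simp [h]
  · have hw := one_sub_ne j h
    simp only [two_cpow_neg]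
    generalize ((1 / 2 : ℂ)) ^ j = w at *
    induction M with
    | zero => simp
    | succ M ih =>
      rw [Finset.sum_Icc_succ_top (by omega), ← ih]
      field_simp
      ring

private lemma geom1_natCast (j M : ℕ) :
    geom1 j M = ∑ n ∈ Finset.Icc 1 M, ((n : ℂ) + 1) * (((1 / 2 : ℂ)) ^ j) ^ n := by
  unfold geom1
  split_ifs with h
  · subst h
    induction M with
    | zero => simp
    | succ M ih =>
      rw [Finset.sum_Icc_succ_top (by omega), ← ih]
      push_cast
      simp
      ring
  · have hw := one_sub_ne j h
    simp only [two_cpow_neg]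
    generalize ((1 / 2 : ℂ)) ^ j = w at *
    induction M with
    | zero => simp
    | succ M ih =>
      rw [Finset.sum_Icc_succ_top (by omega), ← ih]
      push_cast
      field_simp
      ring

private lemma geom2_natCast (j M : ℕ) :
    geom2 j M = ∑ n ∈ Finset.Icc 1 M, (n : ℂ) * (n + 1) * (((1 / 2 : ℂ)) ^ j) ^ n := by
  unfold geom2
  split_ifs with h
  · subst h
    induction M with
    | zero => simp
    | succ M ih =>
      rw [Finset.sum_Icc_succ_top (by omega), ← ih]
      push_cast
      simp
      ring
  · have hw := one_sub_ne j h
    simp only [two_cpow_neg]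
    generalize ((1 / 2 : ℂ)) ^ j = w at *
    induction M with
    | zero => simp
    | succ M ih =>
      rw [Finset.sum_Icc_succ_top (by omega), ← ih]
      push_cast
      field_simp
      ring

/-- `innerSum` does extend the finite sums. -/
theorem innerSum_natCast (m M : ℕ) :
    innerSum m ((M : ℂ) + 2) = ∑ n ∈ Finset.Icc 1 M,
      (1 - ((n : ℂ) + 1) * (1 / 2) ^ n - (n : ℂ) * (n + 1) / 4) * ((1 / 2) ^ m) ^ n := by
  unfold innerSum
  rw [add_sub_cancel_right, geom0_natCast, geom1_natCast, geom2_natCast, Finset.sum_div,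
    ← Finset.sum_sub_distrib, ← Finset.sum_sub_distrib]
  refine Finset.sum_congr rfl fun n _ => ?_
  rw [pow_succ, mul_pow]
  ring

end DST

end

/-!
Splitting the data of a random tree binomially between the two subtrees turns the recursion for
`l_N` into a first order recursion for its alternating binomial transform, which is solved by
products `Q_M` times sums of `1 / Q_n`. Euler's expansions rewrite the solution in terms of the
power series `∑ a_{m+1} S_m(z)` in `2^{1-z}`. Dividing by Euler's product expands the transform at
`k` in powers `2^{-nk}`, and inverting the transform gives `l_N` as a sum over the levels `n` of
`2^n` times a combination of the first binomial probabilities for `N` trials with success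
probability `2^{-n}`.

On level `n` these probabilities are close to Poisson probabilities with mean `N / 2^n`; the total
error is bounded, so that `l_N` is the sum of `2^n profile(N / 2^n)` up to `O(1)`. In the scale
`log₂ N` that sum is `N` times the periodization of a smooth rapidly decaying function. Poisson
summation and the Mellin transform of the profile yield its Fourier coefficients, which are values
of `Γ(1 - χ_k)` times a power series and agree with the residues of `Γ(-z) ψ(z)`.
-/

noncomputable section

namespace DST

open Finset.HasAntidiagonal (antidiagonal mem_antidiagonal)

/-! ### Expectations over random digital search trees -/

/-- The expectation of a nonnegative function of a random element; extended values make all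
manipulations of the series unconditional. -/
def expect {α : Type*} (p : PMF α) (F : α → ENNReal) : ENNReal := ∑' t, p t * F t

lemma expect_pure {α : Type*} (a : α) (F : α → ENNReal) : expect (PMF.pure a) F = F a := by
  classical
  rw [expect, tsum_eq_single a]
  · simp [PMF.pure_apply]
  · intro b hb
    simp [PMF.pure_apply, hb]

lemma expect_bind {α β : Type*} (p : PMF α) (f : α → PMF β) (F : β → ENNReal) :
    expect (p.bind f) F = expect p fun a => expect (f a) F := by
  simp only [expect, PMF.bind_apply, ← ENNReal.tsum_mul_right, ← ENNReal.tsum_mul_left]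
  rw [ENNReal.tsum_comm]
  simp only [mul_assoc]

lemma expect_map {α β : Type*} (p : PMF α) (f : α → β) (F : β → ENNReal) :
    expect (p.map f) F = expect p fun a => F (f a) := by
  rw [PMF.map, expect_bind]
  simp only [Function.comp, expect_pure]

lemma expect_add {α : Type*} (p : PMF α) (F G : α → ENNReal) :
    (expect p fun a => F a + G a) = expect p F + expect p G := by
  simp only [expect, mul_add, ENNReal.tsum_add]

lemma expect_const_mul {α : Type*} (p : PMF α) (c : ENNReal) (F : α → ENNReal) :
    (expect p fun a => c * F a) = c * expect p F := by
  simp only [expect, ← ENNReal.tsum_mul_left, mul_left_comm]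

lemma expect_const {α : Type*} (p : PMF α) (c : ENNReal) : (expect p fun _ => c) = c := by
  simp only [expect, ENNReal.tsum_mul_right, PMF.tsum_coe, one_mul]

lemma expect_comm {α β : Type*} (p : PMF α) (q : PMF β) (F : α → β → ENNReal) :
    (expect p fun a => expect q fun b => F a b) = expect q fun b => expect p fun a => F a b := by
  simp only [expect, ← ENNReal.tsum_mul_left]
  rw [ENNReal.tsum_comm]
  simp only [mul_left_comm]

lemma expect_congr {α : Type*} (p : PMF α) {F G : α → ENNReal}
    (h : ∀ a, p a ≠ 0 → F a = G a) : expect p F = expect p G := by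
  refine tsum_congr fun a => ?_
  by_cases ha : p a = 0
  · simp [ha]
  · rw [h a ha]

lemma expect_coin (F : Bool → ENNReal) : expect coin F = 2⁻¹ * (F true + F false) := by
  simp [expect, coin, mul_add]

/-- The expectation of a function of a tree whose two subtrees are independent random digital search
trees of sizes `i` and `j`. -/
def expectNode (i j : ℕ) (F : BinaryTree Unit → ENNReal) : ENNReal :=
  expect (randomTree i) fun l => expect (randomTree j) fun r => F (.node () l r)

lemma expect_insertRandom_node (l r : BinaryTree Unit) (F : BinaryTree Unit → ENNReal) :
    expect (insertRandom (.node () l r)) F =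
      2⁻¹ * ((expect (insertRandom r) fun r' => F (.node () l r')) +
        expect (insertRandom l) fun l' => F (.node () l' r)) := by
  rw [insertRandom, expect_bind, expect_coin]
  simp [expect_map]

lemma expect_randomTree_succ (n : ℕ) (F : BinaryTree Unit → ENNReal) :
    expect (randomTree (n + 1)) F =
      expect (randomTree n) fun t => expect (insertRandom t) F := by
  rw [randomTree, expect_bind]

lemma expectNode_insertRandom (i j : ℕ) (F : BinaryTree Unit → ENNReal) :
    (expectNode i j fun t => expect (insertRandom t) F) =
      2⁻¹ * (expectNode i (j + 1) F + expectNode (i + 1) j F) := by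
  simp only [expectNode, expect_insertRandom_node, expect_const_mul, expect_add]
  congr 2
  · simp only [expect_randomTree_succ j]
  · rw [expect_comm, expect_comm (randomTree (i + 1))]
    simp only [expect_randomTree_succ i]

-- The first subtree size is binomial, and given their sizes the subtrees are independent.
lemma expect_randomTree_succ_eq_sum (n : ℕ) (F : BinaryTree Unit → ENNReal) :
    expect (randomTree (n + 1)) F =
      2⁻¹ ^ n * ∑ ij ∈ antidiagonal n, (n.choose ij.1 : ENNReal) *
        expectNode ij.1 ij.2 F := by
  induction n generalizing F with
  | zero => simp [expectNode, randomTree, expect_pure, insertRandom]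
  | succ n ih =>
    rw [expect_randomTree_succ, ih, Finset.sum_antidiagonal_choose_succ_mul
      (fun i j => expectNode i j F), pow_succ, mul_assoc]
    congr 1
    rw [← Finset.sum_add_distrib, Finset.mul_sum]
    refine Finset.sum_congr rfl fun ij hij => ?_
    rw [expectNode_insertRandom,
      Nat.choose_symm_of_eq_add (mem_antidiagonal.mp hij).symm]
    ring

lemma numNodes_of_insertRandom_ne_zero (t s : BinaryTree Unit) (h : insertRandom t s ≠ 0) :
    s.numNodes = t.numNodes + 1 := by
  induction t generalizing s with
  | nil =>
    rw [insertRandom, ← PMF.mem_support_iff, PMF.mem_support_pure_iff] at h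
    simp [h, BinaryTree.numNodes]
  | node v l r ihl ihr =>
    rw [insertRandom, ← PMF.mem_support_iff, PMF.mem_support_bind_iff] at h
    obtain ⟨bit, -, h⟩ := h
    cases bit
    · simp only [Bool.false_eq_true, if_false, PMF.mem_support_map_iff] at h
      obtain ⟨l', hl, rfl⟩ := h
      simp only [BinaryTree.numNodes, ihl l' hl]
      omega
    · simp only [if_true, PMF.mem_support_map_iff] at h
      obtain ⟨r', hr, rfl⟩ := h
      simp only [BinaryTree.numNodes, ihr r' hr]
      omega

lemma numNodes_of_randomTree_ne_zero (n : ℕ) (t : BinaryTree Unit) (h : randomTree n t ≠ 0) :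
    t.numNodes = n := by
  induction n generalizing t with
  | zero =>
    rw [randomTree, ← PMF.mem_support_iff, PMF.mem_support_pure_iff] at h
    simp [h, BinaryTree.numNodes]
  | succ n ih =>
    rw [randomTree, ← PMF.mem_support_iff, PMF.mem_support_bind_iff] at h
    obtain ⟨s, hs, h⟩ := h
    rw [numNodes_of_insertRandom_ne_zero s t h, ih s hs]

lemma numNodes_eq_zero_iff (t : BinaryTree Unit) : t.numNodes = 0 ↔ t = .nil := by
  cases t <;> simp [BinaryTree.numNodes]

lemma leafDist_eq_zero_iff (t : BinaryTree Unit) : leafDist t = 0 ↔ t.numNodes = 1 := by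
  cases t with
  | nil => simp [leafDist, BinaryTree.numNodes]
  | node v l r =>
    simp only [leafDist, BinaryTree.numNodes, ← numNodes_eq_zero_iff]
    split_ifs with h
    · simp [h]
    · simpa using by omega

lemma two_le_one_add_min_iff (a b : ℕ∞) : 2 ≤ 1 + min a b ↔ a ≠ 0 ∧ b ≠ 0 := by
  rw [← one_add_one_eq_two, ENat.add_le_add_iff_left (by simp), le_min_iff,
    Order.one_le_iff_ne_zero, Order.one_le_iff_ne_zero]

/-- The contribution `0` or `1` of the root to the number of 2-protected nodes of a tree whose
subtrees have sizes `i` and `j`. -/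
def rootProtected (i j : ℕ) : ℕ := if (i = 0 ∧ j = 0) ∨ i = 1 ∨ j = 1 then 0 else 1

lemma protectedCount_node (l r : BinaryTree Unit) :
    protectedCount (.node () l r) =
      rootProtected l.numNodes r.numNodes + protectedCount l + protectedCount r := by
  rw [protectedCount]
  congr 2
  simp only [leafDist, rootProtected, ← leafDist_eq_zero_iff l, ← leafDist_eq_zero_iff r,
    numNodes_eq_zero_iff]
  split_ifs <;> simp_all [two_le_one_add_min_iff]

lemma protectedCount_le_numNodes (t : BinaryTree Unit) : protectedCount t ≤ t.numNodes := by
  induction t with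
  | nil => simp [protectedCount]
  | node v l r ihl ihr =>
    simp only [protectedCount, BinaryTree.numNodes]
    split_ifs <;> omega

/-- The expected number of 2-protected nodes, `averageProtected` before passing to real numbers. -/
def expectedProtected (n : ℕ) : ENNReal :=
  expect (randomTree n) fun t => (protectedCount t : ENNReal)

lemma averageProtected_eq (n : ℕ) : averageProtected n = (expectedProtected n).toReal := rfl

lemma expectedProtected_ne_top (n : ℕ) : expectedProtected n ≠ ⊤ := by
  have h_le : expectedProtected n ≤ n := by
    rw [← expect_const (randomTree n) (n : ENNReal)]
    refine ENNReal.tsum_le_tsum fun t => ?_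
    by_cases ht : randomTree n t = 0
    · simp [ht]
    · gcongr
      exact Nat.cast_le.mpr
        ((protectedCount_le_numNodes t).trans_eq (numNodes_of_randomTree_ne_zero n t ht))
  exact ne_top_of_le_ne_top (ENNReal.natCast_ne_top n) h_le

lemma expectNode_protectedCount (i j : ℕ) :
    (expectNode i j fun t => (protectedCount t : ENNReal)) =
      rootProtected i j + expectedProtected i + expectedProtected j := by
  have h : (expectNode i j fun t => (protectedCount t : ENNReal)) =
      expect (randomTree i) fun l => expect (randomTree j) fun r =>
        ((rootProtected i j : ENNReal) + protectedCount l + protectedCount r) := by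
    refine expect_congr _ fun l hl => expect_congr _ fun r hr => ?_
    beta_reduce
    rw [protectedCount_node, numNodes_of_randomTree_ne_zero i l hl,
      numNodes_of_randomTree_ne_zero j r hr]
    push_cast
    rfl
  rw [h]
  simp only [expect_add, expect_const]
  rfl

lemma averageProtected_zero : averageProtected 0 = 0 := by
  simp [averageProtected_eq, expectedProtected, randomTree, expect_pure, protectedCount]

lemma averageProtected_succ (n : ℕ) :
    averageProtected (n + 1) =
      (1 / 2) ^ n * ∑ ij ∈ antidiagonal n, (n.choose ij.1 : ℝ) *
      (rootProtected ij.1 ij.2 + averageProtected ij.1 + averageProtected ij.2) := by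
  rw [averageProtected_eq, expectedProtected, expect_randomTree_succ_eq_sum, ENNReal.toReal_mul,
    ENNReal.toReal_sum]
  · congr 1
    · simp
    · refine Finset.sum_congr rfl fun ij _ => ?_
      rw [expectNode_protectedCount, ENNReal.toReal_mul, ENNReal.toReal_add, ENNReal.toReal_add]
      · simp [averageProtected_eq]
      all_goals simp [expectedProtected_ne_top]
  · intro ij _
    rw [expectNode_protectedCount]
    simp [ENNReal.mul_eq_top, expectedProtected_ne_top]

/-! ### The alternating binomial transform -/

section BinomTransform

variable {R : Type*} [CommRing R]

/-- The alternating binomial transform `∑ k, (-1)^k binom(N, k) u k`, under which the binomial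
splitting of a tree becomes a scaling. It is given by its recursion in `N`, which makes its
properties immediate inductions. -/
def binomTransform : (ℕ → R) → ℕ → R
  | u, 0 => u 0
  | u, N + 1 => binomTransform u N - binomTransform (fun k => u (k + 1)) N

lemma binomTransform_add (u v : ℕ → R) (N : ℕ) :
    binomTransform (fun k => u k + v k) N = binomTransform u N + binomTransform v N := by
  induction N generalizing u v with
  | zero => rfl
  | succ N ih =>
    simp only [binomTransform, ih]
    ring

lemma binomTransform_const_mul (c : R) (u : ℕ → R) (N : ℕ) :
    binomTransform (fun k => c * u k) N = c * binomTransform u N := by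
  induction N generalizing u with
  | zero => rfl
  | succ N ih =>
    simp only [binomTransform, ih]
    ring

lemma binomTransform_sub (u v : ℕ → R) (N : ℕ) :
    binomTransform (fun k => u k - v k) N = binomTransform u N - binomTransform v N := by
  simpa [sub_eq_add_neg] using (binomTransform_add u (fun k => -1 * v k) N).trans
    (congrArg (_ + ·) (binomTransform_const_mul (-1) v N))

lemma hasSum_binomTransform [TopologicalSpace R] [IsTopologicalRing R] {v : ℕ → ℕ → R}
    {u : ℕ → R} (h : ∀ k, HasSum (fun n => v n k) (u k)) (N : ℕ) :
    HasSum (fun n => binomTransform (v n) N) (binomTransform u N) := by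
  induction N generalizing u v with
  | zero => exact h 0
  | succ N ih => exact (ih h).sub (ih fun k => h (k + 1))

lemma sum_choose_mul_binomTransform (c : R) (u : ℕ → R) (N : ℕ) :
    ∑ ij ∈ antidiagonal N,
      (N.choose ij.1 : R) * (c ^ ij.1 * (1 - c) ^ ij.2 * binomTransform u ij.1) =
        binomTransform (fun k => c ^ k * u k) N := by
  induction N generalizing u with
  | zero => simp [binomTransform]
  | succ N ih =>
    have h_succ : (fun k => c ^ (k + 1) * u (k + 1)) = fun k => c * (c ^ k * u (k + 1)) := by
      funext k
      ring
    rw [Finset.sum_antidiagonal_choose_succ_mul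
      (fun i j => c ^ i * (1 - c) ^ j * binomTransform u i), binomTransform, h_succ,
      binomTransform_const_mul, ← ih, ← ih fun k => u (k + 1), Finset.mul_sum,
      ← Finset.sum_sub_distrib, ← Finset.sum_add_distrib]
    refine Finset.sum_congr rfl fun ij hij => ?_
    rw [← Nat.choose_symm_of_eq_add (mem_antidiagonal.mp hij).symm, binomTransform]
    ring

lemma choose_succ_mul_pow_sub (y : R) (k r : ℕ) :
    (k.choose (r + 1) : R) * y ^ (k - r) = y * (k.choose (r + 1) * y ^ (k - (r + 1))) := by
  rcases lt_or_ge k (r + 1) with h | h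
  · simp [Nat.choose_eq_zero_of_lt h]
  · rw [show k - r = k - (r + 1) + 1 by omega, pow_succ]
    ring

lemma binomTransform_choose_mul_pow (y : R) (r N : ℕ) :
    binomTransform (fun k => (k.choose r : R) * y ^ (k - r)) N =
      (-1) ^ r * (N.choose r * (1 - y) ^ (N - r)) := by
  induction N generalizing r with
  | zero => cases r <;> simp [binomTransform]
  | succ N ih =>
    rw [binomTransform, ih]
    cases r with
    | zero =>
      have h_succ : (fun k : ℕ => ((k + 1).choose 0 : R) * y ^ (k + 1 - 0)) =
          fun k => y * (k.choose 0 * y ^ (k - 0)) := by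
        funext k
        simp [pow_succ']
      rw [h_succ, binomTransform_const_mul, ih]
      simp only [Nat.choose_zero_right, Nat.sub_zero, pow_succ]
      ring
    | succ r =>
      have h_succ : (fun k : ℕ => ((k + 1).choose (r + 1) : R) * y ^ (k + 1 - (r + 1))) =
          fun k => k.choose r * y ^ (k - r) + y * (k.choose (r + 1) * y ^ (k - (r + 1))) := by
        funext k
        rw [Nat.choose_succ_succ', Nat.add_sub_add_right, ← choose_succ_mul_pow_sub]
        push_cast
        ring
      rw [h_succ, binomTransform_add, binomTransform_const_mul, ih, ih, Nat.choose_succ_succ',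
        Nat.add_sub_add_right]
      have h_pow := choose_succ_mul_pow_sub (1 - y) N r
      push_cast
      linear_combination (-1) ^ r * h_pow

end BinomTransform

/-! ### The transform of the average number of 2-protected nodes -/

/-- The probability that the root of a random tree of size `n + 1` is 2-protected. -/
def rootProb (n : ℕ) : ℝ :=
  (1 / 2) ^ n * ∑ ij ∈ antidiagonal n, (n.choose ij.1 : ℝ) * rootProtected ij.1 ij.2

lemma averageProtected_succ_eq (n : ℕ) :
    averageProtected (n + 1) = 2 * ((1 / 2) ^ n *
      ∑ ij ∈ antidiagonal n, (n.choose ij.1 : ℝ) * averageProtected ij.1) + rootProb n := by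
  have h_swap : ∑ ij ∈ antidiagonal n, (n.choose ij.1 : ℝ) * averageProtected ij.2 =
      ∑ ij ∈ antidiagonal n, (n.choose ij.1 : ℝ) * averageProtected ij.1 := by
    rw [← Finset.Nat.sum_antidiagonal_swap]
    refine Finset.sum_congr rfl fun ij hij => ?_
    rw [Prod.fst_swap, Prod.snd_swap, Nat.choose_symm_of_eq_add (mem_antidiagonal.mp hij).symm]
  rw [averageProtected_succ, rootProb]
  simp only [mul_add, Finset.sum_add_distrib]
  rw [h_swap]
  ring

lemma choose_mul_rootProtected {n i j : ℕ} (hn : 3 ≤ n) (hij : i + j = n) :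
    (n.choose i : ℝ) * rootProtected i j =
      n.choose i - (if i = 1 then (n : ℝ) else 0) - if i = n - 1 then (n : ℝ) else 0 := by
  by_cases hi : i = 1
  · subst hi
    simp [rootProtected, show 1 ≠ n - 1 by omega]
  by_cases hj : j = 1
  · subst hj
    subst hij
    simp [rootProtected, hi]
  · have h_ne : i ≠ n - 1 := by omega
    have h_zero : ¬(i = 0 ∧ j = 0) := by omega
    simp [rootProtected, hi, hj, h_ne, h_zero]

lemma sum_choose_mul_rootProtected {n : ℕ} (hn : 3 ≤ n) :
    ∑ ij ∈ antidiagonal n, (n.choose ij.1 : ℝ) * rootProtected ij.1 ij.2 = 2 ^ n - 2 * n := by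
  have h_choose : ∑ k ∈ Finset.range n.succ, (n.choose k : ℝ) = 2 ^ n := by
    exact_mod_cast Nat.sum_range_choose n
  rw [Finset.sum_congr rfl fun ij hij => choose_mul_rootProtected hn (mem_antidiagonal.mp hij),
    Finset.Nat.sum_antidiagonal_eq_sum_range_succ_mk, Finset.sum_sub_distrib,
    Finset.sum_sub_distrib, h_choose, Finset.sum_ite_eq', Finset.sum_ite_eq',
    if_pos (Finset.mem_range.mpr (by omega)),
    if_pos (Finset.mem_range.mpr (by omega))]
  ring

/-- The inhomogeneity of the recursion for the transform. -/
def source (k : ℕ) : ℝ :=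
  1 - (if k = 0 then 1 else 0) - k * 2 * (1 / 2) ^ k - k * (k - 1) / 4

lemma source_eq_choose (k : ℕ) :
    source k = (k.choose 0 * 1 ^ (k - 0) - k.choose 0 * 0 ^ (k - 0)) -
      (k.choose 1 * (1 / 2) ^ (k - 1) + 1 / 2 * (k.choose 2 * 1 ^ (k - 2))) := by
  rw [source, Nat.cast_choose_two]
  rcases k with _ | k
  · simp
  · simp only [Nat.add_sub_cancel, Nat.choose_one_right, Nat.choose_zero_right]
    push_cast
    simp only [sub_zero, one_div, inv_pow, add_sub_cancel_right, one_pow, mul_one, ne_eq,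
      Nat.add_eq_zero_iff, one_ne_zero, and_false, not_false_eq_true, zero_pow, mul_zero]
    ring

lemma binomTransform_source (n : ℕ) : binomTransform source n = -rootProb n := by
  rw [funext source_eq_choose, binomTransform_sub, binomTransform_sub, binomTransform_add,
    binomTransform_const_mul]
  simp only [binomTransform_choose_mul_pow]
  rcases n with _ | _ | _ | n
  · simp [rootProb, rootProtected]
  · norm_num [rootProb, rootProtected, Finset.Nat.antidiagonal_succ]
  · norm_num [rootProb, rootProtected, Finset.Nat.antidiagonal_succ]
  · rw [rootProb, sum_choose_mul_rootProtected (by omega)]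
    have h_compl : (1 - 1 / 2 : ℝ) = 1 / 2 := by norm_num
    rw [h_compl, mul_sub, ← mul_pow, Nat.add_sub_cancel_right,
      show n + 1 + 1 + 1 - 2 = n + 1 by omega]
    norm_num [pow_succ]
    ring

/-- The alternating binomial transform of the average number of 2-protected nodes. -/
def transform : ℕ → ℝ
  | 0 => 0
  | k + 1 => (1 - 2 * (1 / 2) ^ k) * transform k + source k

theorem averageProtected_eq_binomTransform (N : ℕ) :
    averageProtected N = binomTransform transform N := by
  induction N using Nat.strong_induction_on with
  | _ N ih =>
    rcases N with _ | n
    · simp [averageProtected_zero, binomTransform, transform]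
    · have h_succ : (fun k => transform (k + 1)) = fun k =>
          (transform k - 2 * ((1 / 2) ^ k * transform k)) + source k := by
        funext k
        rw [transform]
        ring
      have h_split : binomTransform (fun k => (1 / 2) ^ k * transform k) n =
          (1 / 2) ^ n * ∑ ij ∈ antidiagonal n, (n.choose ij.1 : ℝ) * averageProtected ij.1 := by
        rw [← sum_choose_mul_binomTransform, Finset.mul_sum]
        refine Finset.sum_congr rfl fun ij hij => ?_
        have hn := mem_antidiagonal.mp hij
        rw [ih ij.1 (by omega), ← hn, pow_add]
        norm_num
        ring
      rw [averageProtected_succ_eq, binomTransform, h_succ, binomTransform_add,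
        binomTransform_sub, binomTransform_const_mul, h_split, binomTransform_source]
      ring

/-! ### Entire power series -/

/-- `W` is the coefficient sequence of an everywhere convergent power series. -/
def IsEntireCoeff (W : ℕ → ℝ) : Prop := ∀ r : ℝ, Summable fun n => W n * r ^ n

/-- The power series `∑ n, W n x^n` at a complex number. -/
def entireSum (W : ℕ → ℝ) (x : ℂ) : ℂ := ∑' n, (W n : ℂ) * x ^ n

/-- Prepending a zero to a sequence, which multiplies its power series by the variable. -/
def shift (W : ℕ → ℝ) : ℕ → ℝ
  | 0 => 0
  | n + 1 => W n

namespace IsEntireCoeff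

variable {V W : ℕ → ℝ}

lemma summable (h : IsEntireCoeff W) : Summable W := by simpa using h 1

lemma summable_abs (h : IsEntireCoeff W) (r : ℝ) : Summable fun n => |W n| * r ^ n := by
  refine Summable.of_norm ?_
  simpa [norm_mul] using (h r).norm

lemma add (hV : IsEntireCoeff V) (hW : IsEntireCoeff W) : IsEntireCoeff fun n => V n + W n := by
  intro r
  simpa [add_mul] using (hV r).add (hW r)

lemma sub (hV : IsEntireCoeff V) (hW : IsEntireCoeff W) : IsEntireCoeff fun n => V n - W n := by
  intro r
  simpa [sub_mul] using (hV r).sub (hW r)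

lemma mul_of_abs_le {c : ℕ → ℝ} {K : ℝ} (h : IsEntireCoeff W) (hc : ∀ n, |c n| ≤ K) :
    IsEntireCoeff fun n => W n * c n := by
  intro r
  refine Summable.of_norm_bounded ((h.summable_abs |r|).mul_left K) fun n => ?_
  calc ‖W n * c n * r ^ n‖ = |c n| * (|W n| * |r| ^ n) := by
        rw [norm_mul, norm_mul, norm_pow]
        simp only [Real.norm_eq_abs]
        ring
    _ ≤ K * (|W n| * |r| ^ n) := mul_le_mul_of_nonneg_right (hc n) (by positivity)

lemma natCast_mul (h : IsEntireCoeff W) : IsEntireCoeff fun n => n * W n := by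
  intro r
  refine Summable.of_norm_bounded (h.summable_abs (2 * |r|)) fun n => ?_
  have h_le : (n : ℝ) ≤ 2 ^ n := by exact_mod_cast Nat.lt_two_pow_self.le
  calc ‖n * W n * r ^ n‖ = n * (|W n| * |r| ^ n) := by
        rw [norm_mul, norm_mul, norm_pow]
        simp only [Real.norm_eq_abs, Nat.abs_cast]
        ring
    _ ≤ 2 ^ n * (|W n| * |r| ^ n) := mul_le_mul_of_nonneg_right h_le (by positivity)
    _ = |W n| * (2 * |r|) ^ n := by rw [mul_pow]; ring

lemma shift (h : IsEntireCoeff W) : IsEntireCoeff (shift W) := by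
  intro r
  rw [← summable_nat_add_iff 1]
  refine ((h r).mul_left r).congr fun n => ?_
  simp only [DST.shift]
  ring

lemma hasSum (h : IsEntireCoeff W) (x : ℂ) :
    HasSum (fun n => (W n : ℂ) * x ^ n) (entireSum W x) := by
  refine Summable.hasSum (Summable.of_norm ?_)
  simpa using h.summable_abs ‖x‖

lemma entireSum_add (hV : IsEntireCoeff V) (hW : IsEntireCoeff W) (x : ℂ) :
    entireSum (fun n => V n + W n) x = entireSum V x + entireSum W x := by
  rw [← ((hV.hasSum x).add (hW.hasSum x)).tsum_eq, entireSum]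
  simp only [Complex.ofReal_add, add_mul]

lemma entireSum_shift (h : IsEntireCoeff W) (x : ℂ) :
    entireSum (DST.shift W) x = x * entireSum W x := by
  have h_mul := (h.hasSum x).mul_left x
  have h_tail := (hasSum_nat_add_iff' 1).mpr (h.shift.hasSum x)
  simp only [DST.shift, Finset.range_one, Finset.sum_singleton, Complex.ofReal_zero, zero_mul,
    sub_zero] at h_tail
  refine h_tail.unique (h_mul.congr_fun fun n => ?_)
  ring

lemma continuous_entireSum (h : IsEntireCoeff W) : Continuous (entireSum W) := by
  refine continuous_iff_continuousAt.mpr fun x => ?_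
  have h_ball : ContinuousOn (entireSum W) (Metric.ball 0 (‖x‖ + 1)) := by
    refine continuousOn_tsum (u := fun m => |W m| * (‖x‖ + 1) ^ m)
      (fun m => by fun_prop) (h.summable_abs _) fun m y hy => ?_
    rw [mem_ball_zero_iff] at hy
    rw [norm_mul, norm_pow, Complex.norm_real, Real.norm_eq_abs]
    gcongr
  exact h_ball.continuousAt (Metric.isOpen_ball.mem_nhds (by simp))

end IsEntireCoeff

lemma isEntireCoeff_single (c : ℝ) : IsEntireCoeff fun n => if n = 0 then c else 0 := by
  intro r
  refine summable_of_ne_finset_zero (s := {0}) fun n hn => ?_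
  simp [show n ≠ 0 by simpa using hn]

lemma entireSum_single (c : ℝ) (x : ℂ) : entireSum (fun n => if n = 0 then c else 0) x = c := by
  rw [entireSum, tsum_eq_single 0 fun n hn => by simp [hn]]
  simp

lemma entireSum_zero (W : ℕ → ℝ) : entireSum W 0 = W 0 := by
  rw [entireSum, tsum_eq_single 0 fun n hn => by simp [hn]]
  simp

lemma entireSum_ofReal (W : ℕ → ℝ) (r : ℝ) : entireSum W r = ((∑' n, W n * r ^ n : ℝ) : ℂ) := by
  rw [entireSum, Complex.ofReal_tsum]
  simp

lemma entireSum_one (W : ℕ → ℝ) : entireSum W 1 = ((∑' n, W n : ℝ) : ℂ) := by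
  simpa using entireSum_ofReal W 1

/-! ### Euler's product -/

lemma half_pow_le_one (m : ℕ) : (1 / 2 : ℝ) ^ m ≤ 1 := pow_le_one₀ (by norm_num) (by norm_num)

lemma half_pow_le_half {m : ℕ} (hm : m ≠ 0) : (1 / 2 : ℝ) ^ m ≤ 1 / 2 :=
  pow_le_of_le_one (by norm_num) (by norm_num) hm

lemma half_pow_succ_lt_one (n : ℕ) : (1 / 2 : ℝ) ^ (n + 1) < 1 :=
  pow_lt_one₀ (by norm_num) (by norm_num) (by omega)

lemma two_pow_mul_half_pow (n : ℕ) : (2 : ℝ) ^ n * (1 / 2) ^ n = 1 := by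
  rw [← mul_pow]
  norm_num

lemma two_pow_succ_sub_one_pos (n : ℕ) : (0 : ℝ) < 2 ^ (n + 1) - 1 :=
  sub_pos.mpr (one_lt_pow₀ (by norm_num) (by omega))

lemma Q_eq_prod_range (n : ℕ) : Q n = ∏ k ∈ Finset.range n, (1 - 1 / 2 ^ (k + 1)) := by
  induction n with
  | zero => simp [Q]
  | succ n ih => rw [Finset.prod_range_succ, ← ih, Q, Q, Finset.prod_Icc_succ_top (by omega)]

lemma Q_zero : Q 0 = 1 := by simp [Q]

lemma Q_succ (n : ℕ) : Q (n + 1) = Q n * (1 - (1 / 2) ^ (n + 1)) := by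
  rw [Q_eq_prod_range, Finset.prod_range_succ, ← Q_eq_prod_range, one_div_pow]

lemma Q_pos (n : ℕ) : 0 < Q n := by
  induction n with
  | zero => simp [Q_zero]
  | succ n ih =>
    rw [Q_succ]
    exact mul_pos ih (sub_pos.mpr (half_pow_succ_lt_one n))

lemma Q_antitone : Antitone Q := by
  refine antitone_nat_of_succ_le fun n => ?_
  rw [Q_succ]
  exact mul_le_of_le_one_right (Q_pos n).le (sub_le_self _ (by positivity))

lemma eulerCoeff_zero : eulerCoeff 0 = 1 := by simp [eulerCoeff, Q_zero]

lemma eulerCoeff_succ (m : ℕ) : eulerCoeff (m + 1) = -eulerCoeff m / (2 ^ (m + 1) - 1) := by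
  have h_choose : (m + 1 + 1).choose 2 = (m + 1).choose 2 + (m + 1) := by
    rw [Nat.choose_succ_succ' (m + 1) 1, Nat.choose_one_right, add_comm]
  have h_two := (two_pow_succ_sub_one_pos m).ne'
  have h_Q := (Q_pos m).ne'
  have h_factor : (1 : ℝ) - (1 / 2) ^ (m + 1) = (2 ^ (m + 1) - 1) / 2 ^ (m + 1) := by
    rw [one_div_pow]
    field_simp
  rw [eulerCoeff, eulerCoeff, h_choose, Q_succ, h_factor, pow_add, pow_add]
  field_simp

lemma eulerCoeff_succ_mul (m : ℕ) :
    eulerCoeff (m + 1) * (1 - (1 / 2) ^ (m + 1)) = -eulerCoeff m * (1 / 2) ^ (m + 1) := by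
  have h_two := (two_pow_succ_sub_one_pos m).ne'
  rw [eulerCoeff_succ, one_div_pow]
  field_simp

lemma isEntireCoeff_eulerCoeff : IsEntireCoeff eulerCoeff := by
  intro r
  refine summable_of_ratio_norm_eventually_le (r := 1 / 2) (by norm_num) ?_
  have h_top : Tendsto (fun m : ℕ => (2 : ℝ) ^ (m + 1)) atTop atTop :=
    (tendsto_pow_atTop_atTop_of_one_lt (by norm_num)).comp (tendsto_add_atTop_nat 1)
  filter_upwards [h_top.eventually_ge_atTop (1 + 2 * |r|)] with m hm
  have h_pos := two_pow_succ_sub_one_pos m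
  have h_ratio : |r| / (2 ^ (m + 1) - 1) ≤ 1 / 2 := by
    rw [div_le_div_iff₀ h_pos (by norm_num)]
    linarith
  calc ‖eulerCoeff (m + 1) * r ^ (m + 1)‖
      = |r| / (2 ^ (m + 1) - 1) * ‖eulerCoeff m * r ^ m‖ := by
        rw [eulerCoeff_succ, norm_mul, norm_mul, norm_div, norm_neg, pow_succ r, norm_mul,
          Real.norm_of_nonneg h_pos.le, Real.norm_eq_abs r]
        ring
    _ ≤ 1 / 2 * ‖eulerCoeff m * r ^ m‖ := mul_le_mul_of_nonneg_right h_ratio (norm_nonneg _)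

lemma entireSum_eulerCoeff_eq_mul_half (x : ℂ) :
    entireSum eulerCoeff x = (1 - x / 2) * entireSum eulerCoeff (x / 2) := by
  have h_half := isEntireCoeff_eulerCoeff.hasSum (x / 2)
  have h_sub := (hasSum_nat_add_iff' 1).mpr ((isEntireCoeff_eulerCoeff.hasSum x).sub h_half)
  have h_term : ∀ m : ℕ, (eulerCoeff (m + 1) : ℂ) * x ^ (m + 1) -
      (eulerCoeff (m + 1) : ℂ) * (x / 2) ^ (m + 1) =
        -(x / 2) * ((eulerCoeff m : ℂ) * (x / 2) ^ m) := by
    intro m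
    have h_coeff := congrArg (fun t : ℝ => (t : ℂ)) (eulerCoeff_succ_mul m)
    push_cast at h_coeff
    rw [div_eq_mul_one_div x, mul_pow, mul_pow]
    linear_combination x ^ (m + 1) * h_coeff
  simp only [h_term] at h_sub
  have h_eq := h_sub.unique (h_half.mul_left _)
  simp only [Finset.range_one, Finset.sum_singleton, pow_zero, sub_self, sub_zero] at h_eq
  linear_combination h_eq

lemma entireSum_eulerCoeff_eq_prod_mul (x : ℂ) (n : ℕ) :
    entireSum eulerCoeff x =
      (∏ k ∈ Finset.range n, (1 - x / 2 ^ (k + 1))) * entireSum eulerCoeff (x / 2 ^ n) := by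
  induction n with
  | zero => simp
  | succ n ih =>
    rw [ih, Finset.prod_range_succ, mul_assoc, entireSum_eulerCoeff_eq_mul_half (x / 2 ^ n),
      div_div, ← pow_succ]

lemma tendsto_entireSum_eulerCoeff_div (x : ℂ) :
    Tendsto (fun n : ℕ => entireSum eulerCoeff (x / 2 ^ n)) atTop (𝓝 1) := by
  have h_zero : Tendsto (fun n : ℕ => x / 2 ^ n) atTop (𝓝 0) := by
    simpa [div_eq_mul_inv] using (tendsto_pow_atTop_nhds_zero_of_norm_lt_one
      (show ‖(2⁻¹ : ℂ)‖ < 1 by norm_num)).const_mul x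
  simpa [Function.comp_def, entireSum_zero, eulerCoeff_zero] using
    (isEntireCoeff_eulerCoeff.continuous_entireSum.tendsto 0).comp h_zero

lemma tendsto_prod_one_sub_div_two_pow (x : ℂ) :
    Tendsto (fun n => ∏ k ∈ Finset.range n, (1 - x / 2 ^ (k + 1))) atTop
      (𝓝 (entireSum eulerCoeff x)) := by
  have h_div := (tendsto_const_nhds (x := entireSum eulerCoeff x)).div
    (tendsto_entireSum_eulerCoeff_div x) one_ne_zero
  rw [div_one] at h_div
  refine h_div.congr' ?_
  filter_upwards [(tendsto_entireSum_eulerCoeff_div x).eventually_ne one_ne_zero] with n hn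
  rw [Pi.div_apply, div_eq_iff hn]
  exact entireSum_eulerCoeff_eq_prod_mul x n

lemma summable_norm_div_two_pow {𝕜 : Type*} [RCLike 𝕜] (x : 𝕜) :
    Summable fun k : ℕ => ‖-(x / 2 ^ (k + 1))‖ := by
  refine (summable_geometric_two.mul_left (‖x‖ / 2)).congr fun k => ?_
  rw [norm_neg, norm_div, norm_pow, RCLike.norm_two, one_div_pow, pow_succ]
  field_simp

theorem QFun_eq_entireSum (x : ℂ) : QFun x = entireSum eulerCoeff x := by
  have h_mult := multipliable_one_add_of_summable (summable_norm_div_two_pow x)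
  simp only [← sub_eq_add_neg] at h_mult
  exact tendsto_nhds_unique h_mult.tendsto_prod_tprod_nat (tendsto_prod_one_sub_div_two_pow x)

lemma tendsto_Q : Tendsto Q atTop (𝓝 QInf) := by
  have h_mult := multipliable_one_add_of_summable (summable_norm_div_two_pow (1 : ℝ))
  simp only [← sub_eq_add_neg] at h_mult
  rw [funext Q_eq_prod_range]
  exact h_mult.tendsto_prod_tprod_nat

lemma QInf_eq_entireSum : (QInf : ℂ) = entireSum eulerCoeff 1 := by
  refine tendsto_nhds_unique ((Complex.continuous_ofReal.tendsto _).comp tendsto_Q)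
    ((tendsto_prod_one_sub_div_two_pow 1).congr fun n => ?_)
  simp [Q_eq_prod_range]

lemma QInf_eq_Q_mul (n : ℕ) : (QInf : ℂ) = Q n * entireSum eulerCoeff (1 / 2 ^ n) := by
  rw [QInf_eq_entireSum, entireSum_eulerCoeff_eq_prod_mul 1 n, Q_eq_prod_range]
  simp

lemma QInf_le_Q (n : ℕ) : QInf ≤ Q n := Q_antitone.le_of_tendsto tendsto_Q n

lemma QInf_pos : 0 < QInf := by
  refine lt_of_le_of_ne (ge_of_tendsto' tendsto_Q fun n => (Q_pos n).le) fun h => ?_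
  obtain ⟨n, hn⟩ := ((tendsto_entireSum_eulerCoeff_div 1).eventually_ne one_ne_zero).exists
  have h_zero := QInf_eq_Q_mul n
  rw [← h, Complex.ofReal_zero, eq_comm, mul_eq_zero] at h_zero
  exact h_zero.elim (by exact_mod_cast (Q_pos n).ne') hn

lemma entireSum_eulerCoeff_two_pow_succ (k : ℕ) : entireSum eulerCoeff (2 ^ (k + 1)) = 0 := by
  rw [entireSum_eulerCoeff_eq_mul_half, pow_succ, mul_div_cancel_right₀ _ two_ne_zero]
  cases k with
  | zero => simp
  | succ k => rw [entireSum_eulerCoeff_two_pow_succ k, mul_zero]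

lemma hasSum_eulerCoeff_mul_pow (n : ℕ) :
    HasSum (fun m => eulerCoeff m * ((1 / 2) ^ n) ^ m) (QInf / Q n) := by
  have h_value : entireSum eulerCoeff (1 / 2 ^ n) = ((QInf / Q n : ℝ) : ℂ) := by
    have h_ne : (Q n : ℂ) ≠ 0 := by exact_mod_cast (Q_pos n).ne'
    rw [Complex.ofReal_div, QInf_eq_Q_mul n, mul_div_cancel_left₀ _ h_ne]
  have h_sum := isEntireCoeff_eulerCoeff.hasSum (1 / 2 ^ n)
  rw [h_value, ← one_div_pow] at h_sum
  rw [← Complex.hasSum_ofReal]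
  simpa using h_sum

lemma inv_Q_le (n : ℕ) : 1 / Q n ≤ 1 / QInf :=
  one_div_le_one_div_of_le QInf_pos (QInf_le_Q n)

/-- The power series `∑ x^j / Q_j`, Euler's expansion of `∏_{k ≥ 0} 1 / (1 - x 2^{-k})`. -/
def invQSeries (x : ℝ) : ℝ := ∑' j, x ^ j / Q j

lemma summable_invQSeries {x : ℝ} (h0 : 0 ≤ x) (h1 : x < 1) : Summable fun j => x ^ j / Q j := by
  refine Summable.of_nonneg_of_le (fun j => div_nonneg (pow_nonneg h0 j) (Q_pos j).le)
    (fun j => ?_) ((summable_geometric_of_lt_one h0 h1).mul_right (1 / QInf))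
  rw [div_eq_mul_one_div]
  exact mul_le_mul_of_nonneg_left (inv_Q_le j) (by positivity)

lemma invQSeries_half {x : ℝ} (h0 : 0 ≤ x) (h1 : x < 1) :
    invQSeries (x / 2) = (1 - x) * invQSeries x := by
  have h_sum := (summable_invQSeries h0 h1).hasSum
  have h_half := (summable_invQSeries (x := x / 2) (by linarith) (by linarith)).hasSum
  have h_sub := (hasSum_nat_add_iff' 1).mpr (h_sum.sub h_half)
  have h_term : ∀ j : ℕ, x ^ (j + 1) / Q (j + 1) - (x / 2) ^ (j + 1) / Q (j + 1) =
      x * (x ^ j / Q j) := by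
    intro j
    have h_factor := (sub_pos.mpr (half_pow_succ_lt_one j)).ne'
    have h_Q := (Q_pos j).ne'
    rw [Q_succ, div_eq_mul_one_div x 2, mul_pow]
    field_simp
    ring
  have h_eq := h_sub.unique ((h_sum.mul_left x).congr_fun h_term)
  simp only [Finset.range_one, Finset.sum_singleton, pow_zero, sub_self, sub_zero] at h_eq
  rw [invQSeries, invQSeries]
  linarith

lemma continuousOn_invQSeries : ContinuousOn invQSeries (Set.Icc 0 (1 / 2)) := by
  refine continuousOn_tsum (u := fun j => (1 / 2) ^ j / Q j) (fun j => by fun_prop)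
    (summable_invQSeries (by norm_num) (by norm_num)) fun j x hx => ?_
  have h_Q := Q_pos j
  rw [Real.norm_of_nonneg (div_nonneg (pow_nonneg hx.1 _) h_Q.le)]
  gcongr
  exacts [hx.1, hx.2]

lemma tendsto_invQSeries_half_pow :
    Tendsto (fun n : ℕ => invQSeries ((1 / 2) ^ (n + 1))) atTop (𝓝 1) := by
  have h_zero : invQSeries 0 = 1 := by
    rw [invQSeries, tsum_eq_single 0 fun j hj => by simp [hj]]
    simp [Q_zero]
  have h_within : Tendsto (fun n : ℕ => (1 / 2 : ℝ) ^ (n + 1)) atTop (𝓝[Set.Icc 0 (1 / 2)] 0) :=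
    tendsto_nhdsWithin_iff.mpr ⟨(tendsto_pow_atTop_nhds_zero_of_lt_one (by norm_num)
      (by norm_num)).comp (tendsto_add_atTop_nat 1),
      Eventually.of_forall fun n => ⟨by positivity, half_pow_le_half n.succ_ne_zero⟩⟩
  simpa [Function.comp_def, h_zero] using
    (continuousOn_invQSeries 0 ⟨le_rfl, by norm_num⟩).tendsto.comp h_within

lemma invQSeries_half_pow_eq_mul (n : ℕ) :
    invQSeries ((1 / 2) ^ (n + 1)) = Q n * invQSeries (1 / 2) := by
  induction n with
  | zero => simp [Q_zero]
  | succ n ih =>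
    rw [pow_succ, mul_one_div, invQSeries_half (by positivity) (half_pow_succ_lt_one n), ih, Q_succ]
    ring

lemma invQSeries_one_half : invQSeries (1 / 2) = 1 / QInf := by
  have h_lim : Tendsto (fun n => Q n * invQSeries (1 / 2)) atTop (𝓝 1) :=
    tendsto_invQSeries_half_pow.congr invQSeries_half_pow_eq_mul
  rw [eq_div_iff QInf_pos.ne', mul_comm]
  exact tendsto_nhds_unique (tendsto_Q.mul_const _) h_lim

lemma hasSum_pow_div_Q (M : ℕ) :
    HasSum (fun j => ((1 / 2) ^ (M + 1)) ^ j / Q j) (Q M / QInf) := by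
  have h_sum := (summable_invQSeries (by positivity) (half_pow_succ_lt_one M)).hasSum
  have h_value := invQSeries_half_pow_eq_mul M
  rw [invQSeries_one_half, mul_one_div] at h_value
  rwa [← h_value]

/-! ### Convolution with `1 / Q_j` -/

/-- The Cauchy product of `W` with the sequence `1 / Q_j`. -/
def convQ (W : ℕ → ℝ) (n : ℕ) : ℝ := ∑ m ∈ Finset.range (n + 1), W m * (1 / Q (n - m))

/-- The number `1 / Q_{n-m}`, read as zero for `m > n`. -/
def invQSub (n m : ℕ) : ℝ := if m ≤ n then 1 / Q (n - m) else 0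

lemma convQ_sub (V W : ℕ → ℝ) (n : ℕ) :
    convQ (fun m => V m - W m) n = convQ V n - convQ W n := by
  simp only [convQ, sub_mul, Finset.sum_sub_distrib]

lemma hasSum_mul_invQSub (W : ℕ → ℝ) (n : ℕ) :
    HasSum (fun m => W m * invQSub n m) (convQ W n) := by
  have h_eq : convQ W n = ∑ m ∈ Finset.range (n + 1), W m * invQSub n m :=
    Finset.sum_congr rfl fun m hm => by
      rw [invQSub, if_pos (Nat.lt_succ_iff.mp (Finset.mem_range.mp hm))]
  rw [h_eq]
  refine hasSum_sum_of_ne_finset_zero fun m hm => ?_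
  rw [invQSub, if_neg (by simpa [Nat.lt_succ_iff] using hm), mul_zero]

lemma IsEntireCoeff.hasSum_convQ_mul_pow {W : ℕ → ℝ} (h : IsEntireCoeff W) (M : ℕ) :
    HasSum (fun n => convQ W n * ((1 / 2) ^ (M + 1)) ^ n)
      ((∑' n, W n * ((1 / 2) ^ (M + 1)) ^ n) * (Q M / QInf)) := by
  have h_inv := hasSum_pow_div_Q M
  have h_prod := hasSum_sum_range_mul_of_summable_norm (h ((1 / 2) ^ (M + 1))).norm
    h_inv.summable.norm
  rw [h_inv.tsum_eq] at h_prod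
  refine h_prod.congr_fun fun n => ?_
  rw [convQ, Finset.sum_mul]
  refine Finset.sum_congr rfl fun m hm => ?_
  obtain ⟨j, rfl⟩ := Nat.exists_eq_add_of_le (Nat.lt_succ_iff.mp (Finset.mem_range.mp hm))
  rw [Nat.add_sub_cancel_left, pow_add _ m j]
  ring

-- Euler's series vanishes at the positive powers of two, so one formula covers `m ≤ n` and `n < m`.
lemma hasSum_eulerCoeff_mul_invQSub (n m : ℕ) :
    HasSum (fun i => eulerCoeff i * (2 ^ m * (1 / 2) ^ n) ^ i) (QInf * invQSub n m) := by
  rcases le_or_gt m n with h | h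
  · obtain ⟨j, rfl⟩ := Nat.exists_eq_add_of_le h
    rw [invQSub, if_pos h, Nat.add_sub_cancel_left, mul_one_div, pow_add, ← mul_assoc,
      two_pow_mul_half_pow, one_mul]
    exact hasSum_eulerCoeff_mul_pow j
  · obtain ⟨k, rfl⟩ := Nat.exists_eq_add_of_lt h
    have h_sum := isEntireCoeff_eulerCoeff.hasSum (2 ^ (k + 1))
    rw [entireSum_eulerCoeff_two_pow_succ] at h_sum
    rw [invQSub, if_neg (not_le.mpr h), mul_zero, add_assoc, pow_add, mul_right_comm,
      two_pow_mul_half_pow, one_mul]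
    rw [← Complex.hasSum_ofReal]
    simpa using h_sum

lemma abs_sub_sum_range_le_of_le_one {a : ℕ → ℝ} {s x : ℝ} (ha : Summable fun i => |a i|)
    (hs : HasSum (fun i => a i * x ^ i) s) (h0 : 0 ≤ x) (h1 : x ≤ 1) (p : ℕ) :
    |s - ∑ i ∈ Finset.range p, a i * x ^ i| ≤ (∑' i, |a i|) * x ^ p := by
  have h_tail := (hasSum_nat_add_iff' p).mpr hs
  have h_abs := (summable_nat_add_iff p).mpr ha
  have h_le : ∑' i, |a (i + p)| ≤ ∑' i, |a i| := by
    rw [← ha.sum_add_tsum_nat_add p]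
    exact le_add_of_nonneg_left (Finset.sum_nonneg fun i _ => abs_nonneg _)
  refine le_trans ?_ (mul_le_mul_of_nonneg_right h_le (pow_nonneg h0 p))
  rw [← h_tail.tsum_eq, ← Real.norm_eq_abs]
  refine tsum_of_norm_bounded (h_abs.hasSum.mul_right _) fun i => ?_
  rw [norm_mul, Real.norm_eq_abs, Real.norm_of_nonneg (pow_nonneg h0 _), pow_add]
  exact mul_le_mul_of_nonneg_left
    (mul_le_of_le_one_left (pow_nonneg h0 p) (pow_le_one₀ h0 h1)) (abs_nonneg _)

lemma abs_sum_range_le_of_one_le {a : ℕ → ℝ} {x : ℝ} (ha : Summable fun i => |a i|) (h1 : 1 ≤ x)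
    (p : ℕ) : |∑ i ∈ Finset.range p, a i * x ^ i| ≤ (∑' i, |a i|) * x ^ p := by
  have h0 : 0 ≤ x := zero_le_one.trans h1
  calc |∑ i ∈ Finset.range p, a i * x ^ i| ≤ ∑ i ∈ Finset.range p, |a i * x ^ i| :=
        Finset.abs_sum_le_sum_abs _ _
    _ ≤ ∑ i ∈ Finset.range p, |a i| * x ^ p := by
        refine Finset.sum_le_sum fun i hi => ?_
        rw [abs_mul, abs_of_nonneg (pow_nonneg h0 i)]
        exact mul_le_mul_of_nonneg_left (pow_le_pow_right₀ h1 (Finset.mem_range.mp hi).le)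
          (abs_nonneg _)
    _ ≤ (∑' i, |a i|) * x ^ p := by
        rw [← Finset.sum_mul]
        exact mul_le_mul_of_nonneg_right (ha.sum_le_tsum _ fun i _ => abs_nonneg _)
          (pow_nonneg h0 p)

lemma abs_invQSub_sub_le (p n m : ℕ) :
    |invQSub n m - (∑ i ∈ Finset.range p, eulerCoeff i * (2 ^ m * (1 / 2) ^ n) ^ i) / QInf| ≤
      (∑' i, |eulerCoeff i|) / QInf * (2 ^ m * (1 / 2) ^ n) ^ p := by
  have h_abs : Summable fun i => |eulerCoeff i| := isEntireCoeff_eulerCoeff.summable.abs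
  suffices h : |QInf * invQSub n m -
      ∑ i ∈ Finset.range p, eulerCoeff i * (2 ^ m * (1 / 2) ^ n) ^ i| ≤
        (∑' i, |eulerCoeff i|) * (2 ^ m * (1 / 2) ^ n) ^ p by
    rw [div_mul_eq_mul_div, le_div_iff₀' QInf_pos, ← abs_of_pos QInf_pos, ← abs_mul,
      abs_of_pos QInf_pos, mul_sub, mul_div_cancel₀ _ QInf_pos.ne']
    exact h
  rcases le_or_gt m n with h | h
  · refine abs_sub_sum_range_le_of_le_one h_abs (hasSum_eulerCoeff_mul_invQSub n m)
      (by positivity) ?_ p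
    calc (2 : ℝ) ^ m * (1 / 2) ^ n ≤ 2 ^ n * (1 / 2) ^ n := by gcongr; norm_num
      _ = 1 := two_pow_mul_half_pow n
  · rw [invQSub, if_neg (not_le.mpr h), mul_zero, zero_sub, abs_neg]
    refine abs_sum_range_le_of_one_le h_abs ?_ p
    calc (1 : ℝ) = 2 ^ n * (1 / 2) ^ n := (two_pow_mul_half_pow n).symm
      _ ≤ 2 ^ m * (1 / 2) ^ n := by gcongr; norm_num

namespace IsEntireCoeff

variable {W : ℕ → ℝ}

lemma hasSum_mul_invQSub_sub (h : IsEntireCoeff W) (p n : ℕ) :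
    HasSum (fun m => W m * (invQSub n m -
        (∑ i ∈ Finset.range p, eulerCoeff i * (2 ^ m * (1 / 2) ^ n) ^ i) / QInf))
      (convQ W n -
        (∑ i ∈ Finset.range p, eulerCoeff i * ((1 / 2) ^ n) ^ i * ∑' m, W m * (2 ^ i) ^ m) /
          QInf) := by
  have h_main := hasSum_sum (s := Finset.range p) fun i _ =>
    (h (2 ^ i)).hasSum.mul_left (eulerCoeff i * ((1 / 2) ^ n) ^ i)
  refine ((hasSum_mul_invQSub W n).sub (h_main.div_const QInf)).congr_fun fun m => ?_
  rw [mul_sub, mul_div_assoc', Finset.mul_sum]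
  congr 2
  refine Finset.sum_congr rfl fun i _ => ?_
  rw [mul_pow, pow_right_comm 2 m i]
  ring

theorem abs_convQ_sub_le (h : IsEntireCoeff W) (p n : ℕ) :
    |convQ W n -
        (∑ i ∈ Finset.range p, eulerCoeff i * ((1 / 2) ^ n) ^ i * ∑' m, W m * (2 ^ i) ^ m) /
          QInf| ≤
      (∑' i, |eulerCoeff i|) / QInf * (∑' m, |W m| * (2 ^ p) ^ m) * ((1 / 2) ^ n) ^ p := by
  rw [← (h.hasSum_mul_invQSub_sub p n).tsum_eq, ← Real.norm_eq_abs]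
  refine tsum_of_norm_bounded
    (((h.summable_abs (2 ^ p)).hasSum.mul_left _).mul_right _) fun m => ?_
  rw [norm_mul, Real.norm_eq_abs, Real.norm_eq_abs]
  refine (mul_le_mul_of_nonneg_left (abs_invQSub_sub_le p n m) (abs_nonneg _)).trans_eq ?_
  rw [mul_pow, pow_right_comm 2 m p]
  ring

lemma exists_abs_convQ_sub_le_half_pow (h : IsEntireCoeff W) :
    ∃ K : ℝ, ∀ n, |convQ W n - (∑' m, W m) / QInf| ≤ K * (1 / 2) ^ n :=
  ⟨_, fun n => by simpa [eulerCoeff_zero] using h.abs_convQ_sub_le 1 n⟩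

lemma exists_abs_convQ_sub_le_half_pow_sq (h : IsEntireCoeff W) (h_two : ∑' m, W m * 2 ^ m = 0) :
    ∃ K : ℝ, ∀ n, |convQ W n - (∑' m, W m) / QInf| ≤ K * ((1 / 2) ^ n) ^ 2 :=
  ⟨_, fun n => by
    simpa [Finset.sum_range_succ, eulerCoeff_zero, h_two] using h.abs_convQ_sub_le 2 n⟩

end IsEntireCoeff

lemma abs_invQSub_sub_inv_le (n m : ℕ) :
    |invQSub n m - 1 / QInf| ≤ (∑' i, |eulerCoeff i|) / QInf * (2 ^ m * (1 / 2) ^ n) := by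
  simpa [eulerCoeff_zero] using abs_invQSub_sub_le 1 n m

lemma hasSum_invQSub_sub_inv (m : ℕ) :
    HasSum (fun n => invQSub n m - 1 / QInf) (∑' n, (1 / Q n - 1 / QInf) - m / QInf) := by
  have h_zero : Summable fun n => 1 / Q n - 1 / QInf := by
    refine Summable.of_norm_bounded ((summable_geometric_two.mul_left (2 ^ 0)).mul_left
      ((∑' i, |eulerCoeff i|) / QInf)) fun n => ?_
    simpa only [invQSub, Nat.zero_le, if_true, Nat.sub_zero, Real.norm_eq_abs] using
      abs_invQSub_sub_inv_le n 0
  have h_head : ∑ i ∈ Finset.range m, (invQSub i m - 1 / QInf) = -(m / QInf) := by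
    rw [Finset.sum_congr rfl fun i hi => by
      rw [invQSub, if_neg (not_le.mpr (Finset.mem_range.mp hi)), zero_sub]]
    rw [Finset.sum_const, Finset.card_range, nsmul_eq_mul]
    ring
  rw [← hasSum_nat_add_iff' m, h_head, sub_neg_eq_add, sub_add_cancel]
  refine h_zero.hasSum.congr_fun fun n => ?_
  rw [invQSub, if_pos (Nat.le_add_left m n), Nat.add_sub_cancel]

namespace IsEntireCoeff

variable {W : ℕ → ℝ}

lemma summable_mul_invQSub_sub_inv (h : IsEntireCoeff W) :
    Summable fun p : ℕ × ℕ => W p.1 * (invQSub p.2 p.1 - 1 / QInf) := by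
  have h_prod := (h.summable_abs 2).mul_of_nonneg
    (summable_geometric_two.mul_left ((∑' i, |eulerCoeff i|) / QInf))
    (fun m => by positivity)
    (fun n => mul_nonneg (div_nonneg (tsum_nonneg fun i => abs_nonneg _) QInf_pos.le)
      (by positivity))
  refine Summable.of_norm_bounded h_prod fun p => ?_
  rw [norm_mul, Real.norm_eq_abs, Real.norm_eq_abs]
  refine (mul_le_mul_of_nonneg_left (abs_invQSub_sub_inv_le p.2 p.1) (abs_nonneg _)).trans_eq ?_
  ring

-- The double series of `W m * (1 / Q_{n-m} - 1 / Q_∞)` is summed once over `m` first and once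
-- over `n` first.
lemma hasSum_convQ_of_tsum_eq_zero (h : IsEntireCoeff W) (h_zero : ∑' m, W m = 0) :
    HasSum (convQ W) (-(∑' m, m * W m) / QInf) := by
  have h_sum := h.summable_mul_invQSub_sub_inv.hasSum
  have h_left := h_sum.prod_fiberwise fun m => (hasSum_invQSub_sub_inv m).mul_left (W m)
  have h_right := ((Equiv.prodComm ℕ ℕ).hasSum_iff.mpr h_sum).prod_fiberwise
    (g := convQ W) fun n => by
      simpa [eulerCoeff_zero, h_zero] using h.hasSum_mul_invQSub_sub 1 n
  have h_value := (h.summable.hasSum.mul_right (∑' n, (1 / Q n - 1 / QInf))).sub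
    (h.natCast_mul.summable.hasSum.div_const QInf)
  rw [h_zero, zero_mul, zero_sub, ← neg_div] at h_value
  have h_eq := h_left.unique (h_value.congr_fun fun m => by ring)
  rwa [h_eq] at h_right

end IsEntireCoeff

/-! ### The inner sums as power series in `2^{1-z}` -/

/-- The coefficient of `ρ^m - 1` in `innerPoly`. -/
def constCoeff (m : ℕ) : ℝ :=
  if m = 0 then 0 else -1 / (1 - (1 / 2) ^ m) + (1 / 2) ^ m / (2 * (1 - (1 / 2) ^ m) ^ 3)

/-- The coefficient of `ρ^(m+1) - 1` in `innerPoly`. -/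
def constCoeffSucc (m : ℕ) : ℝ := 1 / (1 - (1 / 2) ^ m / 2) ^ 2

/-- The coefficient of `κ ρ^m` in `innerPoly`. -/
def linCoeff (m : ℕ) : ℝ :=
  if m = 0 then 1 else (1 / 2) ^ m / (2 * (1 - (1 / 2) ^ m) ^ 2)

/-- The coefficient of `κ ρ^(m+1)` in `innerPoly`. -/
def linCoeffSucc (m : ℕ) : ℝ := 1 / (1 - (1 / 2) ^ m / 2)

/-- The coefficient of `κ (κ + 1) ρ^m` in `innerPoly`. -/
def quadCoeff (m : ℕ) : ℝ := if m = 0 then 0 else 1 / (4 * (1 - (1 / 2) ^ m))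

/-- The coefficient of `(κ^3 - κ) ρ^m` in `innerPoly`. -/
def cubCoeff (m : ℕ) : ℝ := if m = 0 then -1 / 12 else 0

/-- The inner sum `S_m(z)` as a polynomial in `κ = z - 1` and `ρ = 2^{-κ}`. -/
def innerPoly (m : ℕ) (ρ κ : ℂ) : ℂ :=
  constCoeff m * (ρ ^ m - 1) + constCoeffSucc m * (ρ ^ (m + 1) - 1) +
    κ * (linCoeff m * ρ ^ m + linCoeffSucc m * ρ ^ (m + 1)) +
    κ * (κ + 1) * (quadCoeff m * ρ ^ m) + (κ ^ 3 - κ) * (cubCoeff m * ρ ^ m)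

lemma two_cpow_neg_mul_sub_one (j : ℕ) (κ : ℂ) :
    (2 : ℂ) ^ (-((j : ℂ) * (κ - 1))) = (2 ^ (-κ)) ^ j * 2 ^ j := by
  rw [← Complex.cpow_nat_mul, ← Complex.cpow_natCast, ← Complex.cpow_add _ _ two_ne_zero]
  congr 1
  ring

lemma two_sub_half_pow_ne_zero (m : ℕ) : (2 : ℂ) - (1 / 2) ^ m ≠ 0 := by
  intro h
  have h_norm := congrArg norm (sub_eq_zero.mp h)
  rw [norm_pow, norm_div, norm_one, Complex.norm_two] at h_norm
  linarith [half_pow_le_one m]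

theorem innerSum_eq_innerPoly (m : ℕ) (κ : ℂ) :
    innerSum m (1 + κ) = innerPoly m (2 ^ (-κ)) κ := by
  have h_sub : 1 + κ - 2 = κ - 1 := by ring
  simp only [innerSum, geom0, geom1, geom2, h_sub, two_cpow_neg_mul_sub_one, innerPoly, constCoeff,
    constCoeffSucc, linCoeff, linCoeffSucc, quadCoeff, cubCoeff]
  rcases eq_or_ne m 0 with rfl | hm
  · norm_num
    ring
  · have h_one := one_sub_ne m hm
    have h_two := two_sub_half_pow_ne_zero m
    have h_inv : (2 : ℂ) ^ m = ((1 / 2) ^ m)⁻¹ := by simp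
    have h_ne : (1 / 2 : ℂ) ^ m ≠ 0 := pow_ne_zero _ (by norm_num)
    simp only [hm, if_false, Nat.succ_ne_zero, pow_succ]
    push_cast
    simp only [h_inv]
    generalize (2 : ℂ) ^ (-κ) = ρ at *
    generalize ρ ^ m = r at *
    generalize (1 / 2 : ℂ) ^ m = w at *
    rw [show (1 : ℂ) - w * (1 / 2) = (2 - w) / 2 by ring,
      show (1 : ℂ) - w / 2 = (2 - w) / 2 by ring]
    field_simp
    ring

lemma abs_constCoeff_le (m : ℕ) : |constCoeff m| ≤ 4 := by
  unfold constCoeff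
  split_ifs with h
  · norm_num
  · have h_le := half_pow_le_half h
    have h_pos : (0 : ℝ) < (1 / 2) ^ m := by positivity
    generalize (1 / 2 : ℝ) ^ m = w at *
    have h_cube : (1 / 2) ^ 3 ≤ (1 - w) ^ 3 := by
      gcongr
      linarith
    have h_fst : |(-1 : ℝ) / (1 - w)| ≤ 2 := by
      rw [abs_div, abs_neg, abs_one, abs_of_pos (by linarith), div_le_iff₀ (by linarith)]
      linarith
    have h_snd : |w / (2 * (1 - w) ^ 3)| ≤ 2 := by
      have : 0 < (1 - w) ^ 3 := lt_of_lt_of_le (by norm_num) h_cube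
      rw [abs_of_pos (by positivity), div_le_iff₀ (by positivity)]
      linarith
    exact (abs_add_le _ _).trans (by linarith)

lemma abs_constCoeffSucc_le (m : ℕ) : |constCoeffSucc m| ≤ 4 := by
  unfold constCoeffSucc
  have h_le := half_pow_le_one m
  generalize (1 / 2 : ℝ) ^ m = w at *
  have h_sq : (1 / 2) ^ 2 ≤ (1 - w / 2) ^ 2 := by
    gcongr
    linarith
  have h_sq_pos : 0 < (1 - w / 2) ^ 2 := lt_of_lt_of_le (by norm_num) h_sq
  rw [abs_of_pos (by positivity), div_le_iff₀ h_sq_pos]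
  linarith

lemma abs_linCoeff_le (m : ℕ) : |linCoeff m| ≤ 1 := by
  unfold linCoeff
  split_ifs with h
  · norm_num
  · have h_le := half_pow_le_half h
    have h_pos : (0 : ℝ) < (1 / 2) ^ m := by positivity
    generalize (1 / 2 : ℝ) ^ m = w at *
    have h_sq : (1 / 2) ^ 2 ≤ (1 - w) ^ 2 := by
      gcongr
      linarith
    have : 0 < (1 - w) ^ 2 := lt_of_lt_of_le (by norm_num) h_sq
    rw [abs_of_pos (by positivity), div_le_iff₀ (by positivity)]
    linarith

lemma abs_linCoeffSucc_le (m : ℕ) : |linCoeffSucc m| ≤ 2 := by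
  unfold linCoeffSucc
  have h_le := half_pow_le_one m
  generalize (1 / 2 : ℝ) ^ m = w at *
  rw [abs_of_pos (by apply one_div_pos.mpr; linarith), div_le_iff₀ (by linarith)]
  linarith

lemma abs_quadCoeff_le (m : ℕ) : |quadCoeff m| ≤ 1 / 2 := by
  unfold quadCoeff
  split_ifs with h
  · norm_num
  · have h_le := half_pow_le_half h
    generalize (1 / 2 : ℝ) ^ m = w at *
    rw [abs_of_pos (by apply one_div_pos.mpr; linarith), div_le_iff₀ (by linarith)]
    linarith

lemma abs_cubCoeff_le (m : ℕ) : |cubCoeff m| ≤ 1 / 12 := by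
  unfold cubCoeff
  split_ifs <;> norm_num

lemma isEntireCoeff_constCoeff : IsEntireCoeff fun m => eulerCoeff m * constCoeff m :=
  isEntireCoeff_eulerCoeff.mul_of_abs_le abs_constCoeff_le

lemma isEntireCoeff_constCoeffSucc : IsEntireCoeff fun m => eulerCoeff m * constCoeffSucc m :=
  isEntireCoeff_eulerCoeff.mul_of_abs_le abs_constCoeffSucc_le

lemma isEntireCoeff_linCoeff : IsEntireCoeff fun m => eulerCoeff m * linCoeff m :=
  isEntireCoeff_eulerCoeff.mul_of_abs_le abs_linCoeff_le

lemma isEntireCoeff_linCoeffSucc : IsEntireCoeff fun m => eulerCoeff m * linCoeffSucc m :=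
  isEntireCoeff_eulerCoeff.mul_of_abs_le abs_linCoeffSucc_le

/-- The value at `ρ = 1` of the part of `∑ a_{m+1} innerPoly m ρ κ` that is free of `κ`, before
the constant is subtracted. -/
def constValue : ℝ := ∑' m, eulerCoeff m * constCoeff m + ∑' m, eulerCoeff m * constCoeffSucc m

/-- The coefficient of `ρ^n` in `∑ a_{m+1} innerPoly m ρ κ`, in the part free of `κ`. -/
def seriesConst (n : ℕ) : ℝ :=
  eulerCoeff n * constCoeff n + shift (fun m => eulerCoeff m * constCoeffSucc m) n +
    if n = 0 then -constValue else 0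

/-- The coefficient of `κ ρ^n` in `∑ a_{m+1} innerPoly m ρ κ`. -/
def seriesLin (n : ℕ) : ℝ :=
  eulerCoeff n * linCoeff n + shift (fun m => eulerCoeff m * linCoeffSucc m) n

/-- The coefficient of `κ (κ + 1) ρ^n` in `∑ a_{m+1} innerPoly m ρ κ`. -/
def seriesQuad (n : ℕ) : ℝ := eulerCoeff n * quadCoeff n

/-- The coefficient of `(κ^3 - κ) ρ^n` in `∑ a_{m+1} innerPoly m ρ κ`. -/
def seriesCub (n : ℕ) : ℝ := eulerCoeff n * cubCoeff n

lemma isEntireCoeff_seriesConst : IsEntireCoeff seriesConst :=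
  (isEntireCoeff_constCoeff.add isEntireCoeff_constCoeffSucc.shift).add (isEntireCoeff_single _)

lemma isEntireCoeff_seriesLin : IsEntireCoeff seriesLin :=
  isEntireCoeff_linCoeff.add isEntireCoeff_linCoeffSucc.shift

lemma isEntireCoeff_seriesQuad : IsEntireCoeff seriesQuad :=
  isEntireCoeff_eulerCoeff.mul_of_abs_le abs_quadCoeff_le

lemma isEntireCoeff_seriesCub : IsEntireCoeff seriesCub :=
  isEntireCoeff_eulerCoeff.mul_of_abs_le abs_cubCoeff_le

lemma entireSum_seriesConst (ρ : ℂ) :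
    entireSum seriesConst ρ = entireSum (fun m => eulerCoeff m * constCoeff m) ρ +
      ρ * entireSum (fun m => eulerCoeff m * constCoeffSucc m) ρ - constValue := by
  have h_add := (isEntireCoeff_constCoeff.add isEntireCoeff_constCoeffSucc.shift).entireSum_add
    (isEntireCoeff_single (-constValue)) ρ
  rw [isEntireCoeff_constCoeff.entireSum_add isEntireCoeff_constCoeffSucc.shift,
    isEntireCoeff_constCoeffSucc.entireSum_shift, entireSum_single, Complex.ofReal_neg,
    ← sub_eq_add_neg] at h_add
  exact h_add

lemma entireSum_seriesLin (ρ : ℂ) :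
    entireSum seriesLin ρ = entireSum (fun m => eulerCoeff m * linCoeff m) ρ +
      ρ * entireSum (fun m => eulerCoeff m * linCoeffSucc m) ρ := by
  rw [← isEntireCoeff_linCoeffSucc.entireSum_shift]
  exact isEntireCoeff_linCoeff.entireSum_add isEntireCoeff_linCoeffSucc.shift ρ

/-- The value of `∑ a_{m+1} S_m(z)` in terms of `κ = z - 1` and `ρ = 2^{-κ}`. -/
def innerTotal (ρ κ : ℂ) : ℂ :=
  entireSum seriesConst ρ + κ * entireSum seriesLin ρ + κ * (κ + 1) * entireSum seriesQuad ρ +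
    (κ ^ 3 - κ) * entireSum seriesCub ρ

lemma hasSum_innerPoly (ρ κ : ℂ) :
    HasSum (fun m => (eulerCoeff m : ℂ) * innerPoly m ρ κ) (innerTotal ρ κ) := by
  have h_const := (isEntireCoeff_constCoeff.hasSum ρ).sub (isEntireCoeff_constCoeff.hasSum 1)
  have h_constSucc := ((isEntireCoeff_constCoeffSucc.hasSum ρ).mul_left ρ).sub
    (isEntireCoeff_constCoeffSucc.hasSum 1)
  have h_lin := ((isEntireCoeff_linCoeff.hasSum ρ).add
    ((isEntireCoeff_linCoeffSucc.hasSum ρ).mul_left ρ)).mul_left κ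
  have h_quad := (isEntireCoeff_seriesQuad.hasSum ρ).mul_left (κ * (κ + 1))
  have h_cub := (isEntireCoeff_seriesCub.hasSum ρ).mul_left (κ ^ 3 - κ)
  have h_value : entireSum (fun m => eulerCoeff m * constCoeff m) 1 +
      entireSum (fun m => eulerCoeff m * constCoeffSucc m) 1 = constValue := by
    rw [entireSum_one, entireSum_one, ← Complex.ofReal_add, constValue]
  have h_sum := (((h_const.add h_constSucc).add h_lin).add h_quad).add h_cub
  rw [innerTotal, entireSum_seriesConst, entireSum_seriesLin, ← h_value, ← sub_sub,
    add_sub_right_comm, add_sub_assoc]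
  refine h_sum.congr_fun fun m => ?_
  simp only [innerPoly, seriesQuad, seriesCub]
  push_cast
  ring

theorem hasSum_innerSum (κ : ℂ) :
    HasSum (fun m => (eulerCoeff m : ℂ) * innerSum m (1 + κ)) (innerTotal (2 ^ (-κ)) κ) := by
  simp only [innerSum_eq_innerPoly]
  exact hasSum_innerPoly _ _

lemma tsum_seriesConst : ∑' n, seriesConst n = 0 := by
  have h_sum := hasSum_innerPoly 1 0
  simp only [innerPoly, one_pow, sub_self, mul_zero, zero_mul, add_zero, ne_eq, OfNat.ofNat_ne_zero,
    not_false_eq_true, zero_pow] at h_sum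
  have h_total := h_sum.unique hasSum_zero
  simpa [innerTotal, entireSum_one, zero_pow] using h_total

lemma innerPoly_two_neg_one (m : ℕ) : innerPoly m 2 (-1) = -2 ^ m := by
  simp only [innerPoly, constCoeff, constCoeffSucc, linCoeff, linCoeffSucc, quadCoeff, cubCoeff]
  rcases eq_or_ne m 0 with rfl | hm
  · norm_num
  · have h_one := one_sub_ne m hm
    have h_two := two_sub_half_pow_ne_zero m
    have h_inv : (2 : ℂ) ^ m = ((1 / 2) ^ m)⁻¹ := by simp
    have h_ne : (1 / 2 : ℂ) ^ m ≠ 0 := pow_ne_zero _ (by norm_num)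
    simp only [hm, if_false, pow_succ]
    push_cast
    simp only [h_inv]
    generalize (1 / 2 : ℂ) ^ m = w at *
    rw [show (1 : ℂ) - w / 2 = (2 - w) / 2 by ring]
    field_simp
    ring

-- Euler's series vanishes at `2`, and so does `∑ a_{m+1} innerPoly m 2 (-1)`.
lemma tsum_seriesLin_sub_seriesConst_mul_two_pow :
    ∑' n, (seriesLin n - seriesConst n) * 2 ^ n = 0 := by
  have h_euler := (isEntireCoeff_eulerCoeff.hasSum 2).neg
  have h_zero : entireSum eulerCoeff 2 = 0 := by simpa using entireSum_eulerCoeff_two_pow_succ 0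
  have h_total := (hasSum_innerPoly 2 (-1)).unique
    (h_euler.congr_fun fun m => by rw [innerPoly_two_neg_one, mul_neg])
  rw [h_zero, neg_zero, innerTotal] at h_total
  have h_eq : entireSum (fun n => seriesLin n - seriesConst n) 2 = 0 := by
    have h_sub := (isEntireCoeff_seriesLin.hasSum 2).sub (isEntireCoeff_seriesConst.hasSum 2)
    rw [entireSum]
    simp only [Complex.ofReal_sub, sub_mul, h_sub.tsum_eq]
    linear_combination -h_total
  have h_real := entireSum_ofReal (fun n => seriesLin n - seriesConst n) 2
  rw [Complex.ofReal_ofNat, h_eq] at h_real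
  exact_mod_cast h_real.symm

lemma tsum_seriesCub : ∑' n, seriesCub n = -1 / 12 := by
  rw [tsum_eq_single 0 fun n hn => by simp [seriesCub, cubCoeff, hn]]
  simp [seriesCub, cubCoeff, eulerCoeff_zero]

lemma tsum_seriesLin :
    ∑' n, seriesLin n = ∑' m, eulerCoeff m * (linCoeff m + linCoeffSucc m) := by
  have h_one := entireSum_seriesLin 1
  simp only [entireSum_one, one_mul] at h_one
  simp only [mul_add]
  rw [isEntireCoeff_linCoeff.summable.tsum_add isEntireCoeff_linCoeffSucc.summable]
  exact_mod_cast h_one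

/-! ### Expansion of the transform in powers of `2^{-k}` -/

/-- The factor of `2^{-nm}` in the inner sums. -/
def weight (n : ℕ) : ℝ := 1 - (n + 1) * (1 / 2) ^ n - n * (n + 1) / 4

lemma transform_eq_sum (M : ℕ) :
    transform (M + 2) = Q M * ∑ n ∈ Finset.Icc 1 M, weight n / Q n := by
  induction M with
  | zero => simp [transform, source]
  | succ M ih =>
    have h_source : source (M + 2) = weight (M + 1) := by
      rw [source, weight, if_neg (by omega)]
      push_cast
      ring
    rw [transform, ih, Finset.sum_Icc_succ_top (by omega), mul_add,
      mul_div_cancel₀ _ (Q_pos (M + 1)).ne', Q_succ, h_source]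
    ring

lemma hasSum_innerSum_natCast (M : ℕ) :
    HasSum (fun m => (eulerCoeff m : ℂ) * innerSum m (1 + ((M + 1 : ℕ) : ℂ)))
      ((QInf * ∑ n ∈ Finset.Icc 1 M, weight n / Q n : ℝ) : ℂ) := by
  have h_sum : HasSum
      (fun m => ∑ n ∈ Finset.Icc 1 M, weight n * (eulerCoeff m * ((1 / 2) ^ n) ^ m))
      (∑ n ∈ Finset.Icc 1 M, weight n * (QInf / Q n)) :=
    hasSum_sum fun n _ => (hasSum_eulerCoeff_mul_pow n).mul_left _
  have h_value : ∑ n ∈ Finset.Icc 1 M, weight n * (QInf / Q n) =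
      QInf * ∑ n ∈ Finset.Icc 1 M, weight n / Q n := by
    rw [Finset.mul_sum]
    exact Finset.sum_congr rfl fun n _ => by ring
  rw [h_value, ← Complex.hasSum_ofReal] at h_sum
  refine h_sum.congr_fun fun m => ?_
  rw [show 1 + ((M + 1 : ℕ) : ℂ) = (M : ℂ) + 2 by push_cast; ring, innerSum_natCast,
    Complex.ofReal_sum, Finset.mul_sum]
  refine Finset.sum_congr rfl fun n _ => ?_
  rw [weight, ← pow_mul, ← pow_mul, mul_comm m n]
  push_cast
  ring

lemma transform_eq_tsum (M : ℕ) {ρ : ℝ} (hρ : ρ = (1 / 2) ^ (M + 1)) :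
    transform (M + 2) =
      (∑' n, seriesConst n * ρ ^ n + (M + 1) * ∑' n, seriesLin n * ρ ^ n +
        (M + 1) * (M + 2) * ∑' n, seriesQuad n * ρ ^ n +
        (M + 2) * (M + 1) * M * ∑' n, seriesCub n * ρ ^ n) * (Q M / QInf) := by
  have h_total := (hasSum_innerSum ((M + 1 : ℕ) : ℂ)).unique (hasSum_innerSum_natCast M)
  have h_rho : (2 : ℂ) ^ (-((M + 1 : ℕ) : ℂ)) = (ρ : ℂ) := by
    rw [Complex.cpow_neg, Complex.cpow_natCast, hρ]
    simp
  simp only [h_rho, innerTotal, entireSum_ofReal] at h_total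
  have h_sum : ∑' n, seriesConst n * ρ ^ n + (M + 1) * ∑' n, seriesLin n * ρ ^ n +
      (M + 1) * (M + 2) * ∑' n, seriesQuad n * ρ ^ n +
      (M + 2) * (M + 1) * M * ∑' n, seriesCub n * ρ ^ n =
      QInf * ∑ n ∈ Finset.Icc 1 M, weight n / Q n := by
    rw [← Complex.ofReal_inj, ← h_total]
    simp only [Complex.ofReal_add, Complex.ofReal_mul, Complex.ofReal_natCast, Complex.ofReal_one,
      Complex.ofReal_ofNat, Nat.cast_add, Nat.cast_one]
    ring
  have h_ne := QInf_pos.ne'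
  rw [h_sum, transform_eq_sum]
  field_simp

theorem hasSum_transform (M : ℕ) :
    HasSum (fun n => ((1 / 2 : ℝ) ^ (M + 1)) ^ n *
      (convQ seriesConst n + (M + 1) * convQ seriesLin n +
        (M + 1) * (M + 2) * convQ seriesQuad n +
        (M + 2) * (M + 1) * M * convQ seriesCub n)) (transform (M + 2)) := by
  have h_sum := (((isEntireCoeff_seriesConst.hasSum_convQ_mul_pow M).add
    ((isEntireCoeff_seriesLin.hasSum_convQ_mul_pow M).mul_left ((M : ℝ) + 1))).add
    ((isEntireCoeff_seriesQuad.hasSum_convQ_mul_pow M).mul_left (((M : ℝ) + 1) * (M + 2)))).add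
    ((isEntireCoeff_seriesCub.hasSum_convQ_mul_pow M).mul_left (((M : ℝ) + 2) * (M + 1) * M))
  rw [transform_eq_tsum M rfl]
  convert! h_sum using 1
  · funext n
    ring
  · ring

/-! ### The average as a dyadic sum -/

/-- The limit of `convQ seriesLin`. -/
def limLin : ℝ := (∑' n, seriesLin n) / QInf

/-- The limit of `convQ seriesQuad`. -/
def limQuad : ℝ := (∑' n, seriesQuad n) / QInf

/-- The limit of `convQ seriesCub`. -/
def limCub : ℝ := (∑' n, seriesCub n) / QInf

/-- The part of the leading constant that is contributed by the sum of `convQ seriesConst`. -/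
def baseConst : ℝ := -(∑' m : ℕ, m * seriesConst m) / QInf

/-- The binomial probability of `r` successes in `N` trials of success probability `y`, times `r!`;
its limit for `N y = u` is `u^r exp (-u)`. -/
def binomWeight (r N : ℕ) (y : ℝ) : ℝ := N.descFactorial r * y ^ r * (1 - y) ^ (N - r)

lemma binomTransform_descFactorial_mul_pow (y : ℝ) (r N : ℕ) :
    binomTransform (fun k => (k.descFactorial r : ℝ) * y ^ k) N =
      (-1) ^ r * binomWeight r N y := by
  have h_choose : (fun k => (k.descFactorial r : ℝ) * y ^ k) =
      fun k => (r.factorial * y ^ r) * (k.choose r * y ^ (k - r)) := by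
    funext k
    rw [Nat.descFactorial_eq_factorial_mul_choose]
    rcases lt_or_ge k r with h | h
    · simp [Nat.choose_eq_zero_of_lt h]
    · obtain ⟨j, rfl⟩ := Nat.exists_eq_add_of_le h
      rw [Nat.add_sub_cancel_left, pow_add]
      push_cast
      ring
  rw [h_choose, binomTransform_const_mul, binomTransform_choose_mul_pow, binomWeight,
    Nat.descFactorial_eq_factorial_mul_choose]
  push_cast
  ring

lemma binomTransform_ite_eq (r N : ℕ) :
    binomTransform (fun k => if k = r then (1 : ℝ) else 0) N = (-1) ^ r * N.choose r := by
  have h_choose : (fun k => if k = r then (1 : ℝ) else 0) =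
      fun k => (k.choose r : ℝ) * 0 ^ (k - r) := by
    funext k
    rcases lt_trichotomy k r with h | rfl | h
    · simp [h.ne, Nat.choose_eq_zero_of_lt h]
    · simp
    · simp [h.ne', (Nat.sub_pos_of_lt h).ne']
  rw [h_choose, binomTransform_choose_mul_pow]
  simp

/-- The contribution of level `n` to the average, divided by `2^n`. -/
def levelTerm (N n : ℕ) : ℝ :=
  (convQ seriesLin n - convQ seriesConst n) *
      (1 - binomWeight 0 N ((1 / 2) ^ n) - binomWeight 1 N ((1 / 2) ^ n)) -
    convQ seriesConst n * binomWeight 1 N ((1 / 2) ^ n) +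
    convQ seriesQuad n * binomWeight 2 N ((1 / 2) ^ n) -
    convQ seriesCub n * binomWeight 3 N ((1 / 2) ^ n)

/-- The contribution of `2^{-nk}` to the transform. The two indicators make it vanish at `k = 0`
and `k = 1`, where `hasSum_transform` says nothing. -/
def levelTransform (n k : ℕ) : ℝ :=
  2 ^ n * ((convQ seriesConst n - convQ seriesLin n) * (k.descFactorial 0 * ((1 / 2) ^ n) ^ k) +
    convQ seriesLin n * (k.descFactorial 1 * ((1 / 2) ^ n) ^ k) +
    convQ seriesQuad n * (k.descFactorial 2 * ((1 / 2) ^ n) ^ k) +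
    convQ seriesCub n * (k.descFactorial 3 * ((1 / 2) ^ n) ^ k) -
    (convQ seriesConst n - convQ seriesLin n) * (if k = 0 then 1 else 0)) -
  convQ seriesConst n * (if k = 1 then 1 else 0)

lemma levelTransform_zero (n : ℕ) : levelTransform n 0 = 0 := by simp [levelTransform]

lemma levelTransform_one (n : ℕ) : levelTransform n 1 = 0 := by
  simp only [levelTransform, Nat.descFactorial_zero, Nat.descFactorial_one, Nat.cast_one, pow_one,
    Nat.descFactorial_of_lt one_lt_two, Nat.descFactorial_of_lt (show 1 < 3 by norm_num),
    Nat.cast_zero, one_ne_zero, if_false, if_true]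
  linear_combination convQ seriesConst n * two_pow_mul_half_pow n

lemma levelTransform_add_two (n M : ℕ) :
    levelTransform n (M + 2) = ((1 / 2 : ℝ) ^ (M + 1)) ^ n *
      (convQ seriesConst n + (M + 1) * convQ seriesLin n +
        (M + 1) * (M + 2) * convQ seriesQuad n + (M + 2) * (M + 1) * M * convQ seriesCub n) := by
  have h_two := two_pow_mul_half_pow n
  rw [levelTransform, pow_right_comm _ (M + 1) n, if_neg (by omega), if_neg (by omega),
    Nat.succ_descFactorial_succ, Nat.succ_descFactorial_succ, Nat.succ_descFactorial_succ,
    Nat.succ_descFactorial_succ, Nat.succ_descFactorial_succ, Nat.descFactorial_one]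
  generalize (1 / 2 : ℝ) ^ n = y at *
  rw [pow_succ y (M + 1)]
  simp only [Nat.descFactorial_zero]
  push_cast
  linear_combination (y ^ (M + 1) * (convQ seriesConst n + (M + 1) * convQ seriesLin n +
    (M + 1) * (M + 2) * convQ seriesQuad n + (M + 2) * (M + 1) * M * convQ seriesCub n)) * h_two

lemma hasSum_levelTransform (k : ℕ) : HasSum (fun n => levelTransform n k) (transform k) := by
  rcases k with _ | _ | M
  · simpa only [levelTransform_zero, transform] using hasSum_zero
  · have h_zero : transform 1 = 0 := by simp [transform, source]
    simpa only [zero_add, levelTransform_one, h_zero] using hasSum_zero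
  · exact (hasSum_transform M).congr_fun fun n => levelTransform_add_two n M

lemma binomTransform_levelTransform (N n : ℕ) :
    binomTransform (levelTransform n) N = 2 ^ n * levelTerm N n + N * convQ seriesConst n := by
  change binomTransform (fun k => levelTransform n k) N = _
  simp only [levelTransform]
  rw [binomTransform_sub, binomTransform_const_mul, binomTransform_sub, binomTransform_add,
    binomTransform_add, binomTransform_add]
  simp only [binomTransform_const_mul, binomTransform_descFactorial_mul_pow,
    binomTransform_ite_eq, Nat.choose_zero_right, Nat.choose_one_right, levelTerm]
  push_cast
  ring

theorem hasSum_levelTerm (N : ℕ) :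
    HasSum (fun n => 2 ^ n * levelTerm N n) (averageProtected N - N * baseConst) := by
  have h_level := hasSum_binomTransform hasSum_levelTransform N
  rw [← averageProtected_eq_binomTransform] at h_level
  have h_const :=
    (isEntireCoeff_seriesConst.hasSum_convQ_of_tsum_eq_zero tsum_seriesConst).mul_left (N : ℝ)
  refine (h_level.sub h_const).congr_fun fun n => ?_
  rw [binomTransform_levelTransform]
  ring

/-! ### Comparison of a level with its limiting profile -/

/-- The limit of `levelTerm N n` as `N` and `n` grow with `N / 2^n = u` fixed. -/
def profile (u : ℝ) : ℝ :=
  limLin * (1 - (1 + u) * Real.exp (-u)) + limQuad * (u ^ 2 * Real.exp (-u)) -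
    limCub * (u ^ 3 * Real.exp (-u))

/-- A majorant of `u^k exp (-u)` for `k ≥ 1` (up to constants) whose sums over the points
`x / 2^n` telescope, hence are bounded uniformly in `x`. -/
def bump (u : ℝ) : ℝ := u / ((1 + u) * (2 + u))

lemma bump_nonneg {u : ℝ} (hu : 0 ≤ u) : 0 ≤ bump u := by
  unfold bump
  positivity

lemma bump_le_one {u : ℝ} (hu : 0 ≤ u) : bump u ≤ 1 := by
  rw [bump, div_le_one (by positivity)]
  nlinarith

lemma bump_eq_sub {u : ℝ} (hu : 0 ≤ u) : bump u = u / (1 + u) - (u / 2) / (1 + u / 2) := by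
  have h_one : 1 + u ≠ 0 := by positivity
  have h_two : 2 + u ≠ 0 := by positivity
  rw [bump, show 1 + u / 2 = (2 + u) / 2 by ring]
  field_simp
  ring

lemma sum_bump_le_one {x : ℝ} (hx : 0 ≤ x) (n : ℕ) :
    ∑ i ∈ Finset.range n, bump (x * (1 / 2) ^ i) ≤ 1 := by
  have h_telescope : ∑ i ∈ Finset.range n, bump (x * (1 / 2) ^ i) =
      x / (1 + x) - (x * (1 / 2) ^ n) / (1 + x * (1 / 2) ^ n) := by
    induction n with
    | zero => simp
    | succ n ih =>
      rw [Finset.sum_range_succ, ih, bump_eq_sub (by positivity), pow_succ]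
      ring_nf
  have h_first : x / (1 + x) ≤ 1 := (div_le_one (by positivity)).mpr (by linarith)
  have h_last : 0 ≤ (x * (1 / 2) ^ n) / (1 + x * (1 / 2) ^ n) := by positivity
  linarith

lemma summable_bump {x : ℝ} (hx : 0 ≤ x) : Summable fun i : ℕ => bump (x * (1 / 2) ^ i) :=
  summable_of_sum_range_le (fun _ => bump_nonneg (by positivity)) (sum_bump_le_one hx)

lemma tsum_bump_le_one {x : ℝ} (hx : 0 ≤ x) : ∑' i : ℕ, bump (x * (1 / 2) ^ i) ≤ 1 :=
  Real.tsum_le_of_sum_range_le (fun _ => bump_nonneg (by positivity)) (sum_bump_le_one hx)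

lemma pow_mul_exp_neg_le_factorial {u : ℝ} (hu : 0 ≤ u) (n : ℕ) :
    u ^ n * Real.exp (-u) ≤ n.factorial := by
  rw [Real.exp_neg, ← div_eq_mul_inv, div_le_iff₀ (Real.exp_pos u), ← div_le_iff₀' (by positivity)]
  exact Real.pow_div_factorial_le_exp u hu n

lemma exists_pow_succ_mul_exp_neg_le_bump (k : ℕ) :
    ∃ C : ℝ, ∀ u, 0 ≤ u → u ^ (k + 1) * Real.exp (-u) ≤ C * bump u := by
  refine ⟨2 * k.factorial + 3 * (k + 1).factorial + (k + 2).factorial, fun u hu => ?_⟩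
  rw [bump, mul_div_assoc', le_div_iff₀ (by positivity)]
  calc u ^ (k + 1) * Real.exp (-u) * ((1 + u) * (2 + u))
      = (2 * (u ^ k * Real.exp (-u)) + 3 * (u ^ (k + 1) * Real.exp (-u)) +
          u ^ (k + 2) * Real.exp (-u)) * u := by ring
    _ ≤ _ := by gcongr <;> exact pow_mul_exp_neg_le_factorial hu _

lemma abs_one_sub_pow_sub_exp_le {y : ℝ} (h0 : 0 ≤ y) (h1 : y ≤ 1) (M : ℕ) :
    |(1 - y) ^ M - Real.exp (-(M * y))| ≤
      Real.exp 1 * y * (M * y * Real.exp (-(M * y))) := by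
  have h_base : |1 - y - Real.exp (-y)| ≤ y ^ 2 := by
    have h := Real.abs_exp_sub_one_sub_id_le (x := -y) (by rwa [abs_neg, abs_of_nonneg h0])
    rwa [neg_sq, show Real.exp (-y) - 1 - -y = -(1 - y - Real.exp (-y)) by ring, abs_neg] at h
  have h_max : max |1 - y| |Real.exp (-y)| = Real.exp (-y) := by
    rw [abs_of_nonneg (sub_nonneg.mpr h1), Real.abs_exp, max_eq_right (Real.one_sub_le_exp_neg y)]
  have h_pow : Real.exp (-y) ^ (M - 1) ≤ Real.exp 1 * Real.exp (-(M * y)) := by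
    rw [← Real.exp_nat_mul, ← Real.exp_add, Real.exp_le_exp]
    have h_pred : (M : ℝ) ≤ (M - 1 : ℕ) + 1 := by exact_mod_cast le_tsub_add
    nlinarith
  rw [show Real.exp (-(M * y)) = Real.exp (-y) ^ M by rw [← Real.exp_nat_mul, mul_neg]] at *
  calc |(1 - y) ^ M - Real.exp (-y) ^ M|
      ≤ |1 - y - Real.exp (-y)| * M * Real.exp (-y) ^ (M - 1) := by
        simpa only [h_max] using abs_pow_sub_pow_le (1 - y) (Real.exp (-y)) M
    _ ≤ y ^ 2 * M * (Real.exp 1 * Real.exp (-y) ^ M) := by gcongr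
    _ = _ := by ring

lemma pow_sub_descFactorial_le (N r : ℕ) :
    (N : ℝ) ^ r - N.descFactorial r ≤ r * (r - 1) * N ^ (r - 1) := by
  induction r with
  | zero => simp
  | succ r ih =>
    have h_le : (N.descFactorial r : ℝ) ≤ N ^ r := by exact_mod_cast N.descFactorial_le_pow r
    have h_succ : (N - r : ℝ) * N.descFactorial r ≤ N.descFactorial (r + 1) := by
      rw [Nat.descFactorial_succ, Nat.cast_mul]
      gcongr
      rw [sub_le_iff_le_add]
      exact_mod_cast le_tsub_add
    have h_pow : (r : ℝ) * N ^ (r - 1) * N = r * N ^ r := by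
      rcases r with _ | r
      · simp
      · rw [Nat.add_sub_cancel, pow_succ, mul_assoc]
    have h_ih := mul_le_mul_of_nonneg_right ih (Nat.cast_nonneg (α := ℝ) N)
    have h_nonneg : (0 : ℝ) ≤ r * N ^ r := by positivity
    rw [Nat.add_sub_cancel, pow_succ]
    push_cast
    nlinarith

lemma abs_one_sub_pow_tsub_sub_exp_le {y : ℝ} (h0 : 0 ≤ y) (h1 : y ≤ 1) {r N : ℕ} (hr : r ≤ N) :
    |(1 - y) ^ (N - r) - Real.exp (-(N * y))| ≤
      y * ((Real.exp (r + 1) * (N * y) + r * Real.exp r) * Real.exp (-(N * y))) := by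
  have h_split : -((N - r : ℕ) * y) = r * y + -(N * y) := by
    rw [Nat.cast_sub hr]
    ring
  have h_exp : Real.exp (-((N - r : ℕ) * y)) ≤ Real.exp r * Real.exp (-(N * y)) := by
    rw [h_split, ← Real.exp_add]
    gcongr
    exact mul_le_of_le_one_right (Nat.cast_nonneg r) h1
  have h_base : |(1 - y) ^ (N - r) - Real.exp (-((N - r : ℕ) * y))| ≤
      Real.exp 1 * y * (N * y * (Real.exp r * Real.exp (-(N * y)))) := by
    refine (abs_one_sub_pow_sub_exp_le h0 h1 (N - r)).trans ?_
    gcongr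
    exact Nat.sub_le N r
  have h_exponent : |Real.exp (-((N - r : ℕ) * y)) - Real.exp (-(N * y))| ≤
      r * y * (Real.exp r * Real.exp (-(N * y))) := by
    have h_ry : 0 ≤ r * y := by positivity
    have h_factor : Real.exp (-((N - r : ℕ) * y)) - Real.exp (-(N * y)) =
        (1 - Real.exp (-(r * y))) * Real.exp (-((N - r : ℕ) * y)) := by
      rw [one_sub_mul, ← Real.exp_add, h_split, neg_add_cancel_left]
    rw [h_factor, abs_of_nonneg (mul_nonneg (by simpa using h_ry) (Real.exp_pos _).le)]
    gcongr
    linarith [Real.one_sub_le_exp_neg (r * y)]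
  calc |(1 - y) ^ (N - r) - Real.exp (-(N * y))|
      ≤ |(1 - y) ^ (N - r) - Real.exp (-((N - r : ℕ) * y))| +
        |Real.exp (-((N - r : ℕ) * y)) - Real.exp (-(N * y))| := abs_sub_le _ _ _
    _ ≤ _ := add_le_add h_base h_exponent
    _ = _ := by
      rw [Real.exp_add]
      ring

lemma abs_binomWeight_sub_le {y : ℝ} (h0 : 0 ≤ y) (h1 : y ≤ 1) {r N : ℕ} (hr : r ≤ N) :
    |binomWeight r N y - (N * y) ^ r * Real.exp (-(N * y))| ≤
      y * ((Real.exp (r + 1) * (N * y) ^ (r + 1) + r * Real.exp r * (N * y) ^ r +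
        r * (r - 1) * (N * y) ^ (r - 1)) * Real.exp (-(N * y))) := by
  have h_le : (N.descFactorial r : ℝ) ≤ N ^ r := by exact_mod_cast N.descFactorial_le_pow r
  have h_power : |N.descFactorial r * y ^ r| ≤ (N * y) ^ r := by
    rw [abs_of_nonneg (by positivity), mul_pow]
    gcongr
  have h_falling : |N.descFactorial r * y ^ r - (N * y) ^ r| ≤
      y * (r * (r - 1) * (N * y) ^ (r - 1)) := by
    rw [abs_sub_comm, mul_pow, ← sub_mul,
      abs_of_nonneg (mul_nonneg (sub_nonneg.mpr h_le) (by positivity))]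
    refine (mul_le_mul_of_nonneg_right (pow_sub_descFactorial_le N r) (by positivity)).trans_eq ?_
    rcases r with _ | r
    · simp
    · rw [Nat.add_sub_cancel]
      ring
  calc |binomWeight r N y - (N * y) ^ r * Real.exp (-(N * y))|
      = |N.descFactorial r * y ^ r * ((1 - y) ^ (N - r) - Real.exp (-(N * y))) +
          (N.descFactorial r * y ^ r - (N * y) ^ r) * Real.exp (-(N * y))| := by
        rw [binomWeight]
        ring_nf
    _ ≤ (N * y) ^ r *
          (y * ((Real.exp (r + 1) * (N * y) + r * Real.exp r) * Real.exp (-(N * y)))) +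
        y * (r * (r - 1) * (N * y) ^ (r - 1)) * Real.exp (-(N * y)) := by
      refine (abs_add_le _ _).trans ?_
      rw [abs_mul (_ * _), abs_mul (_ - _), Real.abs_exp]
      gcongr
      exact abs_one_sub_pow_tsub_sub_exp_le h0 h1 hr
    _ = _ := by ring

/-- The range of sizes and levels over which the error terms below are uniform. -/
def levels : Filter (ℕ × ℕ) := 𝓟 {p | 3 ≤ p.1}

/-- For a size `N` and a level `n`, the expected number `N / 2^n` of data that are directed to a
given node of level `n`. -/
def levelMean (p : ℕ × ℕ) : ℝ := p.1 * (1 / 2) ^ p.2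

lemma levelMean_nonneg (p : ℕ × ℕ) : 0 ≤ levelMean p := by
  unfold levelMean
  positivity

lemma isBigO_pow_succ_mul_exp_neg_levelMean (k : ℕ) :
    (fun p => levelMean p ^ (k + 1) * Real.exp (-levelMean p)) =O[levels]
      fun p => bump (levelMean p) := by
  obtain ⟨C, hC⟩ := exists_pow_succ_mul_exp_neg_le_bump k
  refine isBigO_principal.mpr ⟨C, fun p _ => ?_⟩
  have h_mean := levelMean_nonneg p
  rw [Real.norm_of_nonneg (by positivity), Real.norm_of_nonneg (bump_nonneg h_mean)]
  exact hC _ h_mean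

lemma isBigO_binomWeight_sub {r : ℕ} (hr : r ≤ 3) :
    (fun p => binomWeight r p.1 ((1 / 2) ^ p.2) - levelMean p ^ r * Real.exp (-levelMean p))
      =O[levels] fun p => (1 / 2) ^ p.2 * bump (levelMean p) := by
  have h_poly : (fun p => (Real.exp (r + 1) * levelMean p ^ (r + 1) +
      r * Real.exp r * levelMean p ^ r + r * (r - 1) * levelMean p ^ (r - 1)) *
        Real.exp (-levelMean p)) =O[levels] fun p => bump (levelMean p) := by
    have h_pow := isBigO_pow_succ_mul_exp_neg_levelMean
    simp only [add_mul, mul_assoc]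
    refine (((h_pow r).const_mul_left _).add ?_).add ?_
    · rcases r with _ | r
      · simpa using isBigO_zero _ _
      · exact ((h_pow r).const_mul_left _).const_mul_left _
    · rcases r with _ | _ | r
      · simpa using isBigO_zero _ _
      · simpa using isBigO_zero _ _
      · exact ((h_pow r).const_mul_left _).const_mul_left _
  refine IsBigO.trans (isBigO_principal.mpr ⟨1, fun p hp => ?_⟩)
    ((isBigO_refl (fun p : ℕ × ℕ => (1 / 2 : ℝ) ^ p.2) levels).mul h_poly)
  rw [one_mul]
  exact (abs_binomWeight_sub_le (by positivity) (half_pow_le_one p.2) (hr.trans hp)).trans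
    (le_abs_self _)

lemma isBigO_half_pow_one : (fun p : ℕ × ℕ => (1 / 2 : ℝ) ^ p.2) =O[levels] fun _ => (1 : ℝ) :=
  isBigO_principal.mpr ⟨1, fun p _ => by
    simpa [abs_of_nonneg] using half_pow_le_one p.2⟩

lemma isBigO_bump_levelMean_one :
    (fun p => bump (levelMean p)) =O[levels] fun _ => (1 : ℝ) := by
  refine isBigO_principal.mpr ⟨1, fun p _ => ?_⟩
  rw [Real.norm_of_nonneg (bump_nonneg (levelMean_nonneg p)), norm_one, mul_one]
  exact bump_le_one (levelMean_nonneg p)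

lemma isBigO_binomWeight_succ {r : ℕ} (hr : r + 1 ≤ 3) :
    (fun p => binomWeight (r + 1) p.1 ((1 / 2) ^ p.2)) =O[levels]
      fun p => bump (levelMean p) := by
  have h_sub : (fun p => binomWeight (r + 1) p.1 ((1 / 2) ^ p.2) -
      levelMean p ^ (r + 1) * Real.exp (-levelMean p)) =O[levels] fun p => bump (levelMean p) :=
    (isBigO_binomWeight_sub hr).trans <| by
      simpa only [one_mul] using isBigO_half_pow_one.mul (isBigO_refl _ levels)
  simpa only [sub_add_cancel] using h_sub.add (isBigO_pow_succ_mul_exp_neg_levelMean r)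

lemma isBigO_levels_of_abs_le {f g : ℕ → ℝ} (h : ∃ K, ∀ n, |f n| ≤ K * g n) :
    (fun p : ℕ × ℕ => f p.2) =O[levels] fun p => g p.2 := by
  obtain ⟨K, hK⟩ := h
  refine IsBigO.of_bound |K| (Eventually.of_forall fun p => (hK p.2).trans ?_)
  rw [Real.norm_eq_abs, ← abs_mul]
  exact le_abs_self _

lemma isBigO_mul_binomWeight_sub {f : ℕ → ℝ} {limit : ℝ} {r : ℕ} (hr : r + 1 ≤ 3)
    (hf : ∃ K, ∀ n, |f n - limit| ≤ K * (1 / 2) ^ n) :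
    (fun p => f p.2 * binomWeight (r + 1) p.1 ((1 / 2) ^ p.2) -
      limit * (levelMean p ^ (r + 1) * Real.exp (-levelMean p))) =O[levels]
        fun p => (1 / 2) ^ p.2 * bump (levelMean p) := by
  refine (((isBigO_levels_of_abs_le hf).mul (isBigO_binomWeight_succ hr)).add
    ((isBigO_binomWeight_sub hr).const_mul_left limit)).congr_left fun p => ?_
  ring

lemma isBigO_half_pow_mul_bump :
    (fun p => (1 / 2) ^ p.2 * bump (levelMean p)) =O[levels]
      fun p => (1 / 2) ^ p.2 * (bump (levelMean p) + (1 / 2) ^ p.2) := by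
  refine IsBigO.of_norm_le fun p => ?_
  have h_bump := bump_nonneg (levelMean_nonneg p)
  rw [Real.norm_of_nonneg (by positivity)]
  gcongr
  exact le_add_of_nonneg_right (by positivity)

lemma isBigO_half_pow_mul_half_pow :
    (fun p => (1 / 2 : ℝ) ^ p.2 * (1 / 2) ^ p.2) =O[levels]
      fun p => (1 / 2) ^ p.2 * (bump (levelMean p) + (1 / 2) ^ p.2) := by
  refine IsBigO.of_norm_le fun p => ?_
  rw [Real.norm_of_nonneg (by positivity)]
  gcongr
  exact le_add_of_nonneg_left (bump_nonneg (levelMean_nonneg p))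

/-- The factor `1 - binomWeight 0 - binomWeight 1` is not small for large `N`, which is why its
coefficient has to converge at the faster rate `4^{-n}`. -/
lemma isBigO_mul_one_sub_binomWeight_sub {f : ℕ → ℝ} {limit : ℝ}
    (hf : ∃ K, ∀ n, |f n - limit| ≤ K * ((1 / 2) ^ n) ^ 2) :
    (fun p => f p.2 * (1 - binomWeight 0 p.1 ((1 / 2) ^ p.2) - binomWeight 1 p.1 ((1 / 2) ^ p.2)) -
      limit * (1 - (1 + levelMean p) * Real.exp (-levelMean p))) =O[levels]
        fun p => (1 / 2) ^ p.2 * (bump (levelMean p) + (1 / 2) ^ p.2) := by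
  set y := fun p : ℕ × ℕ => (1 / 2 : ℝ) ^ p.2
  set φ := fun p => bump (levelMean p)
  have h_diff (r : ℕ) (hr : r ≤ 3) :
      (fun p => binomWeight r p.1 (y p) - levelMean p ^ r * Real.exp (-levelMean p)) =O[levels]
        fun p => y p * φ p := isBigO_binomWeight_sub hr
  have h_zero : (fun p => binomWeight 0 p.1 (y p)) =O[levels] fun _ => (1 : ℝ) := by
    refine isBigO_principal.mpr ⟨1, fun p _ => ?_⟩
    have h_base : 0 ≤ 1 - y p := sub_nonneg.mpr (half_pow_le_one p.2)
    have h_base_le : 1 - y p ≤ 1 := sub_le_self 1 (by positivity)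
    simpa [binomWeight, abs_of_nonneg h_base] using pow_le_one₀ h_base h_base_le
  have h_factor : (fun p => 1 - binomWeight 0 p.1 (y p) - binomWeight 1 p.1 (y p))
      =O[levels] fun _ => (1 : ℝ) :=
    ((isBigO_refl _ _).sub h_zero).sub
      ((isBigO_binomWeight_succ (by norm_num)).trans isBigO_bump_levelMean_one)
  have h_coeff : (fun p => (f p.2 - limit) *
      (1 - binomWeight 0 p.1 (y p) - binomWeight 1 p.1 (y p))) =O[levels] fun p => y p * y p :=
    ((isBigO_levels_of_abs_le hf).mul h_factor).congr_right fun p => by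
      rw [mul_one, sq]
  have h_weight : (fun p => limit * (-(binomWeight 0 p.1 (y p) - levelMean p ^ 0 *
      Real.exp (-levelMean p)) - (binomWeight 1 p.1 (y p) - levelMean p ^ 1 *
        Real.exp (-levelMean p)))) =O[levels] fun p => y p * φ p :=
    ((h_diff 0 (by norm_num)).neg_left.sub (h_diff 1 (by norm_num))).const_mul_left limit
  refine ((h_coeff.trans isBigO_half_pow_mul_half_pow).add
    (h_weight.trans isBigO_half_pow_mul_bump)).congr_left fun p => ?_
  ring

lemma isBigO_levelTerm_sub_profile :
    (fun p => levelTerm p.1 p.2 - profile (levelMean p)) =O[levels]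
      fun p => (1 / 2) ^ p.2 * (bump (levelMean p) + (1 / 2) ^ p.2) := by
  have h_const : ∃ K, ∀ n, |convQ seriesConst n - 0| ≤ K * (1 / 2) ^ n := by
    simpa only [tsum_seriesConst, zero_div] using
      isEntireCoeff_seriesConst.exists_abs_convQ_sub_le_half_pow
  have h_lin : ∃ K, ∀ n, |convQ seriesLin n - convQ seriesConst n - limLin| ≤
      K * ((1 / 2) ^ n) ^ 2 := by
    simpa only [convQ_sub, isEntireCoeff_seriesLin.summable.tsum_sub
      isEntireCoeff_seriesConst.summable, tsum_seriesConst, sub_zero, limLin] using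
      (isEntireCoeff_seriesLin.sub isEntireCoeff_seriesConst).exists_abs_convQ_sub_le_half_pow_sq
        tsum_seriesLin_sub_seriesConst_mul_two_pow
  have h_quad := isEntireCoeff_seriesQuad.exists_abs_convQ_sub_le_half_pow
  have h_cub := isEntireCoeff_seriesCub.exists_abs_convQ_sub_le_half_pow
  have h_one := isBigO_mul_binomWeight_sub (r := 0) (by norm_num) h_const
  have h_two := isBigO_mul_binomWeight_sub (r := 1) (by norm_num) h_quad
  have h_three := isBigO_mul_binomWeight_sub (r := 2) (by norm_num) h_cub
  refine ((((isBigO_mul_one_sub_binomWeight_sub h_lin).sub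
    (h_one.trans isBigO_half_pow_mul_bump)).add (h_two.trans isBigO_half_pow_mul_bump)).sub
      (h_three.trans isBigO_half_pow_mul_bump)).congr_left fun p => ?_
  simp only [levelTerm, profile, limQuad, limCub]
  ring

theorem exists_abs_averageProtected_sub_le :
    ∃ C : ℝ, ∀ N : ℕ, 3 ≤ N →
      |averageProtected N - N * baseConst - ∑' n : ℕ, 2 ^ n * profile (N * (1 / 2) ^ n)| ≤ C := by
  obtain ⟨C, hC⟩ := isBigO_principal.mp isBigO_levelTerm_sub_profile
  refine ⟨|C| * 3, fun N hN => ?_⟩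
  have h_bump := summable_bump (x := N) (by positivity)
  have h_major := (h_bump.add summable_geometric_two).mul_left |C|
  have h_le (n : ℕ) : ‖2 ^ n * levelTerm N n - 2 ^ n * profile (N * (1 / 2) ^ n)‖ ≤
      |C| * (bump (N * (1 / 2) ^ n) + (1 / 2) ^ n) := by
    have h_error : 0 ≤ bump (N * (1 / 2) ^ n) + (1 / 2) ^ n :=
      add_nonneg (bump_nonneg (by positivity)) (by positivity)
    rw [← mul_sub, norm_mul, Real.norm_of_nonneg (by positivity)]
    calc 2 ^ n * ‖levelTerm N n - profile (N * (1 / 2) ^ n)‖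
        ≤ 2 ^ n * (C * ‖(1 / 2) ^ n * (bump (N * (1 / 2) ^ n) + (1 / 2) ^ n)‖) := by
          gcongr
          exact hC (N, n) hN
      _ = C * (bump (N * (1 / 2) ^ n) + (1 / 2) ^ n) := by
          rw [Real.norm_of_nonneg (by positivity)]
          linear_combination
            C * (bump (N * (1 / 2) ^ n) + (1 / 2) ^ n) * two_pow_mul_half_pow n
      _ ≤ _ := by gcongr; exact le_abs_self C
  have h_diff := Summable.of_norm_bounded h_major h_le
  have h_profile := (hasSum_levelTerm N).sub h_diff.hasSum
  simp only [sub_sub_cancel] at h_profile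
  rw [h_profile.tsum_eq, sub_sub_cancel]
  refine (tsum_of_norm_bounded h_major.hasSum h_le).trans ?_
  rw [tsum_mul_left, h_bump.tsum_add summable_geometric_two, tsum_geometric_two]
  gcongr
  linarith [tsum_bump_le_one (x := N) (by positivity)]

open MeasureTheory Set
open scoped FourierTransform

/-! ### The Mellin transform of the profile -/

lemma hasMellin_pow_mul_exp (r : ℕ) {s : ℂ} (hs : 0 < (s + r).re) :
    HasMellin (fun u : ℝ => ((u ^ r * Real.exp (-u) : ℝ) : ℂ)) s (Complex.Gamma (s + r)) := by
  have h_integrand : ∀ u ∈ Ioi (0 : ℝ), (Real.exp (-u) : ℂ) * (u : ℂ) ^ (s + r - 1) =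
      (u : ℂ) ^ (s - 1) • ((u ^ r * Real.exp (-u) : ℝ) : ℂ) := by
    intro u hu
    have hu_ne : (u : ℂ) ≠ 0 := by exact_mod_cast (mem_Ioi.mp hu).ne'
    rw [add_sub_right_comm, Complex.cpow_add _ _ hu_ne, Complex.cpow_natCast, smul_eq_mul]
    push_cast
    ring
  constructor
  · exact (Complex.GammaIntegral_convergent hs).congr_fun h_integrand measurableSet_Ioi
  · rw [Complex.Gamma_eq_integral hs, Complex.GammaIntegral, mellin]
    exact (setIntegral_congr_fun measurableSet_Ioi h_integrand).symm

lemma hasMellin_of_hasDerivAt {f f' : ℝ → ℂ} {s m : ℂ} (hs : s ≠ 0)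
    (hf : ∀ u ∈ Ioi (0 : ℝ), HasDerivAt f (f' u) u) (h_conv : MellinConvergent f s)
    (h_deriv : HasMellin f' (s + 1) m)
    (h_zero : Tendsto (fun u : ℝ => f u * (u : ℂ) ^ s) (𝓝[>] 0) (𝓝 0))
    (h_top : Tendsto (fun u : ℝ => f u * (u : ℂ) ^ s) atTop (𝓝 0)) :
    HasMellin f s (-m / s) := by
  have h_cpow : ∀ u ∈ Ioi (0 : ℝ),
      HasDerivAt (fun u : ℝ => (u : ℂ) ^ s / s) ((u : ℂ) ^ (s - 1)) u := by
    intro u hu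
    simpa using hasDerivAt_ofReal_cpow_const' (x := u) (r := s - 1) (mem_Ioi.mp hu).ne'
      (by simpa [sub_eq_iff_eq_add] using hs)
  have h_integrand : ∀ u : ℝ, (u : ℂ) ^ (s + 1 - 1) • f' u * s⁻¹ = f' u * ((u : ℂ) ^ s / s) := by
    intro u
    rw [add_sub_cancel_right, smul_eq_mul]
    ring
  have h_parts := integral_Ioi_mul_deriv_eq_deriv_mul (a := 0) (a' := (0 : ℂ)) (b' := (0 : ℂ))
    hf h_cpow
    (h_conv.congr_fun (fun u _ => by simp only [smul_eq_mul, Pi.mul_apply, mul_comm])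
      measurableSet_Ioi)
    (IntegrableOn.congr_fun (h_deriv.1.mul_const s⁻¹) (fun u _ => h_integrand u)
      measurableSet_Ioi)
    (by simpa only [zero_div, mul_div_assoc, Pi.mul_def] using h_zero.div_const s)
    (by simpa only [zero_div, mul_div_assoc, Pi.mul_def] using h_top.div_const s)
  have h_mellin : ∫ u in Ioi (0 : ℝ), f' u * ((u : ℂ) ^ s / s) = m * s⁻¹ := by
    rw [← h_deriv.2, mellin, ← integral_mul_const]
    exact integral_congr_ae (Eventually.of_forall fun u => (h_integrand u).symm)
  refine ⟨h_conv, ?_⟩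
  rw [h_mellin, sub_zero, zero_sub] at h_parts
  rw [neg_div, div_eq_mul_inv, ← h_parts, mellin]
  simp only [smul_eq_mul, mul_comm]

lemma one_sub_one_add_mul_exp_nonneg (u : ℝ) : 0 ≤ 1 - (1 + u) * Real.exp (-u) := by
  rw [sub_nonneg, Real.exp_neg, ← div_eq_mul_inv, div_le_one (Real.exp_pos u), add_comm]
  exact Real.add_one_le_exp u

lemma one_sub_one_add_mul_exp_le_one {u : ℝ} (hu : 0 ≤ u) : 1 - (1 + u) * Real.exp (-u) ≤ 1 :=
  sub_le_self 1 (by positivity)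

lemma one_sub_one_add_mul_exp_le_sq {u : ℝ} (hu : 0 ≤ u) :
    1 - (1 + u) * Real.exp (-u) ≤ u ^ 2 := by
  nlinarith [Real.one_sub_le_exp_neg u]

lemma norm_one_sub_one_add_mul_exp (u : ℝ) :
    ‖((1 - (1 + u) * Real.exp (-u) : ℝ) : ℂ)‖ = 1 - (1 + u) * Real.exp (-u) := by
  rw [Complex.norm_real, Real.norm_of_nonneg (one_sub_one_add_mul_exp_nonneg u)]

lemma hasDerivAt_one_sub_one_add_mul_exp (u : ℝ) :
    HasDerivAt (fun u : ℝ => 1 - (1 + u) * Real.exp (-u)) (u * Real.exp (-u)) u := by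
  have h_exp : HasDerivAt (fun u : ℝ => Real.exp (-u)) (Real.exp (-u) * -1) u :=
    (hasDerivAt_neg u).exp
  convert! (((hasDerivAt_id u).const_add 1).mul h_exp).const_sub 1 using 1
  simp only [id_eq]
  ring

section BoundaryTerms

variable {s : ℂ}

lemma mellinConvergent_one_sub_one_add_mul_exp (hs : -2 < s.re) (hs' : s.re < 0) :
    MellinConvergent (fun u : ℝ => ((1 - (1 + u) * Real.exp (-u) : ℝ) : ℂ)) s := by
  refine mellinConvergent_of_isBigO_rpow (a := 0) (b := -2) ?_ ?_ hs' ?_ hs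
  · exact (Continuous.continuousOn (by fun_prop)).locallyIntegrableOn measurableSet_Ioi
  · refine IsBigO.of_bound 1 ?_
    filter_upwards [eventually_ge_atTop 0] with u hu
    rw [norm_one_sub_one_add_mul_exp]
    simpa using one_sub_one_add_mul_exp_le_one hu
  · refine IsBigO.of_bound 1 ?_
    filter_upwards [self_mem_nhdsWithin] with u hu
    rw [norm_one_sub_one_add_mul_exp]
    simpa using one_sub_one_add_mul_exp_le_sq (mem_Ioi.mp hu).le

lemma tendsto_one_sub_one_add_mul_exp_mul_cpow_zero (hs : -2 < s.re) :
    Tendsto (fun u : ℝ => ((1 - (1 + u) * Real.exp (-u) : ℝ) : ℂ) * (u : ℂ) ^ s)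
      (𝓝[>] 0) (𝓝 0) := by
  have h_rpow : Tendsto (fun u : ℝ => u ^ (s.re + 2)) (𝓝[>] 0) (𝓝 0) := by
    have h := Real.continuousAt_rpow_const 0 (s.re + 2) (Or.inr (by linarith))
    rw [ContinuousAt, Real.zero_rpow (by linarith)] at h
    exact h.mono_left nhdsWithin_le_nhds
  refine squeeze_zero_norm' ?_ h_rpow
  filter_upwards [self_mem_nhdsWithin] with u hu
  rw [norm_mul, norm_one_sub_one_add_mul_exp, Complex.norm_cpow_eq_rpow_re_of_pos hu,
    Real.rpow_add hu, mul_comm (u ^ s.re), Real.rpow_two]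
  gcongr
  · exact Real.rpow_nonneg (mem_Ioi.mp hu).le _
  · exact one_sub_one_add_mul_exp_le_sq (mem_Ioi.mp hu).le

lemma tendsto_one_sub_one_add_mul_exp_mul_cpow_atTop (hs : s.re < 0) :
    Tendsto (fun u : ℝ => ((1 - (1 + u) * Real.exp (-u) : ℝ) : ℂ) * (u : ℂ) ^ s)
      atTop (𝓝 0) := by
  have h_rpow := tendsto_rpow_neg_atTop (neg_pos.mpr hs)
  rw [neg_neg] at h_rpow
  refine squeeze_zero_norm' ?_ h_rpow
  filter_upwards [eventually_gt_atTop 0] with u hu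
  rw [norm_mul, norm_one_sub_one_add_mul_exp, Complex.norm_cpow_eq_rpow_re_of_pos hu]
  exact mul_le_of_le_one_left (by positivity) (one_sub_one_add_mul_exp_le_one hu.le)

lemma hasMellin_one_sub_one_add_mul_exp (hs : -2 < s.re) (hs' : s.re < 0) :
    HasMellin (fun u : ℝ => ((1 - (1 + u) * Real.exp (-u) : ℝ) : ℂ)) s
      (-Complex.Gamma (s + 2) / s) := by
  have h_ne : s ≠ 0 := by
    rintro rfl
    exact hs'.ne Complex.zero_re
  have h_deriv : HasMellin (fun u : ℝ => ((u * Real.exp (-u) : ℝ) : ℂ)) (s + 1)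
      (Complex.Gamma (s + 2)) := by
    have h := hasMellin_pow_mul_exp 1 (s := s + 1) (by norm_num; linarith)
    rw [Nat.cast_one, add_assoc, one_add_one_eq_two] at h
    simpa only [pow_one] using h
  exact hasMellin_of_hasDerivAt h_ne
    (fun u _ => (hasDerivAt_one_sub_one_add_mul_exp u).ofReal_comp)
    (mellinConvergent_one_sub_one_add_mul_exp hs hs') h_deriv
    (tendsto_one_sub_one_add_mul_exp_mul_cpow_zero hs)
    (tendsto_one_sub_one_add_mul_exp_mul_cpow_atTop hs')

end BoundaryTerms

/-- The Fourier coefficients of the fluctuation are `Γ(1 - χ) fourierFactor χ / log 2` with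
`χ = 2πik / log 2`. -/
def fourierFactor (χ : ℂ) : ℂ := limLin / (1 + χ) + limQuad - limCub * (1 - χ)

lemma hasMellin_profile {s : ℂ} (hs : -2 < s.re) (hs' : s.re < 0) :
    HasMellin (fun u : ℝ => (profile u : ℂ)) s
      (limLin * (-Complex.Gamma (s + 2) / s) + limQuad * Complex.Gamma (s + 2) -
        limCub * Complex.Gamma (s + 3)) := by
  have h_zero := hasMellin_one_sub_one_add_mul_exp hs hs'
  have h_two := hasMellin_pow_mul_exp 2 (s := s) (by norm_num; linarith)
  have h_three := hasMellin_pow_mul_exp 3 (s := s) (by norm_num; linarith)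
  have h_lin := hasMellin_const_smul h_zero.1 (limLin : ℂ)
  have h_quad := hasMellin_const_smul h_two.1 (limQuad : ℂ)
  have h_cub := hasMellin_const_smul h_three.1 (limCub : ℂ)
  have h_add := hasMellin_add h_lin.1 h_quad.1
  have h_profile := hasMellin_sub h_add.1 h_cub.1
  rw [h_add.2, h_lin.2, h_quad.2, h_cub.2, h_zero.2, h_two.2, h_three.2] at h_profile
  convert! h_profile using 1
  funext u
  simp only [profile, smul_eq_mul]
  push_cast
  ring

lemma mellin_profile {χ : ℂ} (hχ : χ.re = 0) :
    mellin (fun u : ℝ => (profile u : ℂ)) (-1 - χ) = Complex.Gamma (1 - χ) * fourierFactor χ := by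
  have h_sub : (1 : ℂ) - χ ≠ 0 := fun h => by simpa [hχ] using congrArg Complex.re h
  rw [(hasMellin_profile (s := -1 - χ) (by simp [hχ]) (by simp [hχ])).2, fourierFactor,
    show (-1 - χ + 2 : ℂ) = 1 - χ by ring, show (-1 - χ + 3 : ℂ) = (1 - χ) + 1 by ring,
    Complex.Gamma_add_one _ h_sub, show (-1 - χ : ℂ) = -(1 + χ) by ring, neg_div_neg_eq]
  ring

/-! ### The profile in logarithmic scale -/

/-- The profile in logarithmic scale, normalized by `profile u / u`, so that the dyadic sum of
profiles becomes a sum over integer translates. -/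
def wave (x : ℝ) : ℝ := Real.exp (-(x * Real.log 2)) * profile (Real.exp (x * Real.log 2))

lemma continuous_profile : Continuous profile := by
  unfold profile
  fun_prop

lemma continuous_wave : Continuous wave :=
  (by fun_prop : Continuous fun x : ℝ => Real.exp (-(x * Real.log 2))).mul
    (continuous_profile.comp (by fun_prop))

/-- A constant with `|profile u| ≤ profileBound * min 1 (u^2)`. -/
def profileBound : ℝ := |limLin| + 2 * |limQuad| + 6 * |limCub|

lemma profileBound_nonneg : 0 ≤ profileBound := by
  unfold profileBound
  positivity

lemma abs_profile_le_of_le {u a : ℝ} (hu : 0 ≤ u) (h_lin : 1 - (1 + u) * Real.exp (-u) ≤ a)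
    (h_quad : u ^ 2 * Real.exp (-u) ≤ 2 * a) (h_cub : u ^ 3 * Real.exp (-u) ≤ 6 * a) :
    |profile u| ≤ profileBound * a := by
  calc |profile u|
      ≤ |limLin| * (1 - (1 + u) * Real.exp (-u)) + |limQuad| * (u ^ 2 * Real.exp (-u)) +
          |limCub| * (u ^ 3 * Real.exp (-u)) := by
        refine (abs_sub _ _).trans ((add_le_add_left (abs_add_le _ _) _).trans_eq ?_)
        rw [abs_mul limLin, abs_mul limQuad, abs_mul limCub,
          abs_of_nonneg (one_sub_one_add_mul_exp_nonneg u),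
          abs_of_nonneg (show 0 ≤ u ^ 2 * Real.exp (-u) by positivity),
          abs_of_nonneg (show 0 ≤ u ^ 3 * Real.exp (-u) by positivity)]
    _ ≤ |limLin| * a + |limQuad| * (2 * a) + |limCub| * (6 * a) := by gcongr
    _ = profileBound * a := by
      rw [profileBound]
      ring

lemma abs_profile_le {u : ℝ} (hu : 0 ≤ u) : |profile u| ≤ profileBound := by
  simpa only [mul_one] using abs_profile_le_of_le hu (one_sub_one_add_mul_exp_le_one hu)
    (by simpa [Nat.factorial] using pow_mul_exp_neg_le_factorial hu 2)
    (by simpa [Nat.factorial] using pow_mul_exp_neg_le_factorial hu 3)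

lemma abs_profile_le_sq {u : ℝ} (hu : 0 ≤ u) : |profile u| ≤ profileBound * u ^ 2 := by
  have h_exp : Real.exp (-u) ≤ 1 := Real.exp_le_one_iff.mpr (neg_nonpos.mpr hu)
  have h_mul_exp : u * Real.exp (-u) ≤ 1 := by
    simpa using pow_mul_exp_neg_le_factorial hu 1
  refine abs_profile_le_of_le hu (one_sub_one_add_mul_exp_le_sq hu) ?_ ?_
  · nlinarith [sq_nonneg u]
  · nlinarith [sq_nonneg u]

lemma abs_wave_le (x : ℝ) : |wave x| ≤ profileBound * Real.exp (-(|x| * Real.log 2)) := by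
  rw [wave, abs_mul, Real.abs_exp]
  rcases abs_cases x with ⟨h_abs, _⟩ | ⟨h_abs, _⟩
  · rw [h_abs, mul_comm]
    gcongr
    exact abs_profile_le (Real.exp_pos _).le
  · calc Real.exp (-(x * Real.log 2)) * |profile (Real.exp (x * Real.log 2))|
        ≤ Real.exp (-(x * Real.log 2)) * (profileBound * Real.exp (x * Real.log 2) ^ 2) := by
          gcongr
          exact abs_profile_le_sq (Real.exp_pos _).le
      _ = profileBound * Real.exp (-(|x| * Real.log 2)) := by
          rw [h_abs, mul_left_comm, ← Real.exp_nat_mul, ← Real.exp_add]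
          congr 2
          push_cast
          ring

lemma wave_isBigO :
    (fun x => (wave x : ℂ)) =O[cocompact ℝ] fun x : ℝ => |x| ^ (-2 : ℝ) := by
  refine IsBigO.of_bound (profileBound * (2 / Real.log 2 ^ 2)) ?_
  filter_upwards [(Filter.hasBasis_cocompact (X := ℝ)).mem_of_mem (i := {0}) isCompact_singleton]
    with x hx
  have hx_pos : 0 < |x| := abs_pos.mpr hx
  have h_exp := pow_mul_exp_neg_le_factorial (u := |x| * Real.log 2) (by positivity) 2
  rw [Nat.factorial_two, Nat.cast_ofNat] at h_exp
  rw [Complex.norm_real, Real.norm_eq_abs, mul_assoc]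
  refine (abs_wave_le x).trans (mul_le_mul_of_nonneg_left ?_ profileBound_nonneg)
  rw [Real.norm_of_nonneg (by positivity), Real.rpow_neg hx_pos.le, Real.rpow_two,
    ← div_eq_mul_inv, div_div, le_div_iff₀ (by positivity)]
  linarith

lemma chi_eq (k : ℤ) : chi k = ((2 * Real.pi * k / Real.log 2 : ℝ) : ℂ) * Complex.I := by
  rw [chi]
  push_cast
  ring

lemma chi_re (k : ℤ) : (chi k).re = 0 := by
  rw [chi_eq, Complex.re_ofReal_mul, Complex.I_re, mul_zero]

lemma chi_im (k : ℤ) : (chi k).im = 2 * Real.pi * k / Real.log 2 := by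
  rw [chi_eq, Complex.im_ofReal_mul, Complex.I_im, mul_one]

/-- The Fourier coefficients of the sum of the integer translates of `wave`. -/
def waveCoeff (k : ℤ) : ℂ :=
  1 / (Real.log 2 : ℂ) * (Complex.Gamma (1 - chi k) * fourierFactor (chi k))

lemma log_two_pos : 0 < Real.log 2 := Real.log_pos one_lt_two

lemma fourier_wave (k : ℤ) : 𝓕 (fun x => (wave x : ℂ)) (k : ℝ) = waveCoeff k := by
  have h_re : (-1 - chi k).re = -1 := by simp [chi_re]
  have h_im : (-1 - chi k).im = -(2 * Real.pi * k / Real.log 2) := by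
    rw [Complex.sub_im, chi_im, Complex.neg_im, Complex.one_im, neg_zero, zero_sub]
  rw [waveCoeff, ← mellin_profile (chi_re k), mellin_eq_fourier, h_re, h_im,
    Real.fourier_real_eq_integral_exp_smul, Real.fourier_real_eq_integral_exp_smul]
  have h_scale := Measure.integral_comp_mul_left (fun v : ℝ =>
    Complex.exp (↑(-2 * Real.pi * v * (-(2 * Real.pi * k / Real.log 2) / (2 * Real.pi))) *
      Complex.I) • (Real.exp (- -1 * v) • ((profile (Real.exp (-v)) : ℝ) : ℂ))) (-Real.log 2)
  rw [inv_neg, abs_neg, abs_of_pos (inv_pos.mpr log_two_pos)] at h_scale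
  rw [one_div, ← Complex.ofReal_inv, ← Complex.real_smul, ← h_scale]
  congr 1
  funext x
  have h_phase : -2 * Real.pi * (-Real.log 2 * x) *
      (-(2 * Real.pi * k / Real.log 2) / (2 * Real.pi)) = -2 * Real.pi * x * k := by
    have h_log := log_two_pos.ne'
    field_simp
  rw [h_phase, show - -1 * (-Real.log 2 * x) = -(x * Real.log 2) by ring,
    show -(-Real.log 2 * x) = x * Real.log 2 by ring, wave, Complex.real_smul]
  push_cast
  rfl

/-! ### The leading constant -/

lemma b_eq (m : ℕ) : b m = -(m * constCoeff m + (m + 1) * constCoeffSucc m) +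
    (linCoeff m + linCoeffSucc m + quadCoeff m - cubCoeff m) / Real.log 2 := by
  have h_log := log_two_pos.ne'
  rcases eq_or_ne m 0 with rfl | hm
  · norm_num [b, constCoeff, constCoeffSucc, linCoeff, linCoeffSucc, quadCoeff, cubCoeff]
    field_simp
    ring
  · have h_le := half_pow_le_half hm
    have h_log_pow : Real.log ((1 / 2) ^ m) = -(m * Real.log 2) := by
      rw [Real.log_pow, one_div, Real.log_inv, mul_neg]
    simp only [b, constCoeff, constCoeffSucc, linCoeff, linCoeffSucc, quadCoeff, cubCoeff, hm,
      if_false, B, h_log_pow]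
    generalize (1 / 2 : ℝ) ^ m = w at *
    have h_one : w - 1 ≠ 0 := by linarith
    have h_two : w - 2 ≠ 0 := by linarith
    rw [show (1 : ℝ) - w = -(w - 1) by ring, show (1 : ℝ) - w / 2 = -(w - 2) / 2 by ring]
    field_simp
    ring

lemma abs_b_le (m : ℕ) : |b m| ≤ 16 * (m + 1) := by
  have h_const := abs_le.mp (abs_constCoeff_le m)
  have h_constSucc := abs_le.mp (abs_constCoeffSucc_le m)
  have h_lin := abs_le.mp (abs_linCoeff_le m)
  have h_linSucc := abs_le.mp (abs_linCoeffSucc_le m)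
  have h_quad := abs_le.mp (abs_quadCoeff_le m)
  have h_cub := abs_le.mp (abs_cubCoeff_le m)
  have h_quot :
      |(linCoeff m + linCoeffSucc m + quadCoeff m - cubCoeff m) / Real.log 2| ≤ 8 := by
    rw [abs_div, abs_of_pos log_two_pos, div_le_iff₀ log_two_pos, abs_le]
    constructor <;> linarith [Real.log_two_gt_d9]
  have h_quot_le := abs_le.mp h_quot
  have : (0 : ℝ) ≤ m := m.cast_nonneg
  rw [b_eq, abs_le]
  constructor <;> nlinarith

lemma summable_eulerCoeff_mul_constCoeff :
    Summable fun m : ℕ => eulerCoeff m * (m * constCoeff m + (m + 1) * constCoeffSucc m) := by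
  refine ((isEntireCoeff_constCoeff.natCast_mul.add
    isEntireCoeff_constCoeffSucc.natCast_mul).add isEntireCoeff_constCoeffSucc).summable.congr
    fun m => ?_
  ring

lemma summable_eulerCoeff_mul_linCoeff :
    Summable fun m => eulerCoeff m * (linCoeff m + linCoeffSucc m) :=
  (isEntireCoeff_linCoeff.add isEntireCoeff_linCoeffSucc).summable.congr fun m => by ring

lemma hasSum_eulerCoeff_mul_linCoeff :
    HasSum (fun m => eulerCoeff m * (linCoeff m + linCoeffSucc m + quadCoeff m - cubCoeff m))
      (QInf * (limLin + limQuad - limCub)) := by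
  have h_value : QInf * (limLin + limQuad - limCub) =
      ∑' n, seriesLin n + ∑' n, seriesQuad n - ∑' n, seriesCub n := by
    have h_ne := QInf_pos.ne'
    rw [limLin, limQuad, limCub]
    field_simp
  rw [h_value, tsum_seriesLin]
  refine ((summable_eulerCoeff_mul_linCoeff.hasSum.add
    isEntireCoeff_seriesQuad.summable.hasSum).sub
    isEntireCoeff_seriesCub.summable.hasSum).congr_fun fun m => ?_
  rw [seriesQuad, seriesCub]
  ring

lemma tsum_natCast_mul_shift {W : ℕ → ℝ} (hW : IsEntireCoeff W) :
    ∑' n : ℕ, n * shift W n = ∑' n : ℕ, (n + 1) * W n := by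
  rw [hW.shift.natCast_mul.summable.tsum_eq_zero_add]
  simp [shift]

lemma tsum_natCast_mul_seriesConst :
    ∑' n : ℕ, n * seriesConst n =
      ∑' m : ℕ, eulerCoeff m * (m * constCoeff m + (m + 1) * constCoeffSucc m) := by
  have h_succ : Summable fun m : ℕ => ((m : ℝ) + 1) * (eulerCoeff m * constCoeffSucc m) :=
    (isEntireCoeff_constCoeffSucc.natCast_mul.add isEntireCoeff_constCoeffSucc).summable.congr
      fun m => by ring
  have h_split : ∀ n : ℕ, n * seriesConst n = n * (eulerCoeff n * constCoeff n) +
      n * shift (fun m => eulerCoeff m * constCoeffSucc m) n := by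
    intro n
    rw [seriesConst]
    split_ifs with h
    · simp [h]
    · ring
  rw [tsum_congr h_split, isEntireCoeff_constCoeff.natCast_mul.summable.tsum_add
    isEntireCoeff_constCoeffSucc.shift.natCast_mul.summable,
    tsum_natCast_mul_shift isEntireCoeff_constCoeffSucc,
    ← isEntireCoeff_constCoeff.natCast_mul.summable.tsum_add h_succ]
  exact tsum_congr fun m => by ring

lemma hasSum_eulerCoeff_mul_b :
    HasSum (fun m => eulerCoeff m * b m)
      (QInf * (baseConst + (limLin + limQuad - limCub) / Real.log 2)) := by
  have h_value : QInf * (baseConst + (limLin + limQuad - limCub) / Real.log 2) =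
      -∑' m : ℕ, m * seriesConst m + QInf * (limLin + limQuad - limCub) / Real.log 2 := by
    have h_ne := QInf_pos.ne'
    rw [baseConst]
    field_simp
  rw [h_value, tsum_natCast_mul_seriesConst]
  refine (summable_eulerCoeff_mul_constCoeff.hasSum.neg.add
    (hasSum_eulerCoeff_mul_linCoeff.div_const _)).congr_fun fun m => ?_
  rw [b_eq]
  ring

theorem leadingConstant_eq :
    leadingConstant = baseConst + (limLin + limQuad - limCub) / Real.log 2 := by
  have h_ne := QInf_pos.ne'
  rw [leadingConstant, hasSum_eulerCoeff_mul_b.tsum_eq]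
  field_simp

/-! ### Numerical evaluation -/

lemma abs_sub_sum_range_le {f g : ℕ → ℝ} {s : ℝ} (hf : HasSum f s) (M : ℕ)
    (hfg : ∀ m, |f m| ≤ g m) (hg : ∀ m, M ≤ m → g (m + 1) ≤ g m / 2) :
    |s - ∑ m ∈ Finset.range M, f m| ≤ 2 * g M := by
  have h_decay : ∀ i, g (i + M) ≤ g M * (1 / 2) ^ i := by
    intro i
    induction i with
    | zero => simp
    | succ i ih =>
      have h_step := hg (i + M) (by omega)
      rw [add_right_comm, pow_succ]
      linarith
  rw [← ((hasSum_nat_add_iff' M).mpr hf).tsum_eq, mul_comm 2]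
  exact tsum_of_norm_bounded (f := fun i => f (i + M)) (hasSum_geometric_two.mul_left (g M))
    fun i => (hfg _).trans (h_decay i)

lemma abs_eulerCoeff_succ_le {m : ℕ} (hm : 1 ≤ m) :
    |eulerCoeff (m + 1)| ≤ |eulerCoeff m| / 3 := by
  have h_four : (2 : ℝ) ^ 2 ≤ 2 ^ (m + 1) := pow_le_pow_right₀ one_le_two (by omega)
  rw [eulerCoeff_succ, abs_div, abs_neg, abs_of_pos (two_pow_succ_sub_one_pos m)]
  gcongr
  linarith

lemma abs_tsum_eulerCoeff_mul_sub_sum_le {c : ℕ → ℝ} {K : ℝ} (hc : ∀ m, |c m| ≤ K * (m + 1))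
    (h_sum : Summable fun m => eulerCoeff m * c m) {M : ℕ} (hM : 1 ≤ M) :
    |∑' m, eulerCoeff m * c m - ∑ m ∈ Finset.range M, eulerCoeff m * c m| ≤
      2 * (|eulerCoeff M| * (K * (M + 1))) := by
  have hK : 0 ≤ K := by simpa using (abs_nonneg _).trans (hc 0)
  refine abs_sub_sum_range_le (g := fun m => |eulerCoeff m| * (K * (m + 1))) h_sum.hasSum M
    (fun m => ?_) fun m hm => ?_
  · rw [abs_mul]
    exact mul_le_mul_of_nonneg_left (hc m) (abs_nonneg _)
  · have h_succ := abs_eulerCoeff_succ_le (hM.trans hm)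
    have h_one : (1 : ℝ) ≤ m := by exact_mod_cast hM.trans hm
    have h_nonneg : 0 ≤ |eulerCoeff m| * K := by positivity
    push_cast
    calc |eulerCoeff (m + 1)| * (K * (m + 1 + 1))
        ≤ |eulerCoeff m| / 3 * (K * (m + 1 + 1)) := by gcongr
      _ ≤ |eulerCoeff m| * (K * (m + 1)) / 2 := by nlinarith

lemma hasSum_log_two :
    HasSum (fun k : ℕ => 2 * (1 / (2 * (k : ℝ) + 1)) * (1 / 3) ^ (2 * k + 1)) (Real.log 2) := by
  have h_sum := Real.hasSum_log_sub_log_of_abs_lt_one (x := 1 / 3) (by norm_num [abs_lt])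
  rwa [← Real.log_div (by norm_num) (by norm_num),
    show ((1 : ℝ) + 1 / 3) / (1 - 1 / 3) = 2 by norm_num] at h_sum

lemma log_two_bounds : 0.693147180559945309417232121458 < Real.log 2 ∧
    Real.log 2 < 0.693147180559945309417232121459 := by
  have h_tail := abs_le.mp (abs_sub_sum_range_le hasSum_log_two 31
    (fun m => (abs_of_pos (by positivity)).le) fun m _ => ?_)
  · norm_num [Finset.sum_range_succ] at h_tail
    constructor <;> linarith [h_tail.1, h_tail.2]
  · have h_inv : 1 / (2 * ((m + 1 : ℕ) : ℝ) + 1) ≤ 1 / (2 * (m : ℝ) + 1) := by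
      push_cast
      gcongr
      linarith
    have h_pow : (1 / 3 : ℝ) ^ (2 * (m + 1) + 1) = (1 / 3) ^ (2 * m + 1) / 9 := by ring
    have h_pow_pos : (0 : ℝ) < (1 / 3) ^ (2 * m + 1) := by positivity
    have h_inv_pos : (0 : ℝ) < 1 / (2 * (m : ℝ) + 1) := by positivity
    rw [h_pow]
    nlinarith

lemma eulerCoeff_eq_div_prod (m : ℕ) :
    eulerCoeff m = (-1) ^ m / ∏ k ∈ Finset.range m, (2 ^ (k + 1) - 1) := by
  induction m with
  | zero => simp [eulerCoeff_zero]
  | succ m ih =>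
    rw [eulerCoeff_succ, ih, Finset.prod_range_succ, pow_succ (-1 : ℝ), mul_neg_one, ← neg_div,
      div_div]

lemma abs_eulerCoeff_fourteen_le : |eulerCoeff 14| ≤ 1 / 10 ^ 31 := by
  norm_num [eulerCoeff_eq_div_prod, Finset.prod_range_succ]

lemma QInf_bounds : 0.28878809508660242127889972192 < QInf ∧
    QInf < 0.28878809508660242127889972194 := by
  have h_sum : HasSum (fun m => eulerCoeff m * 1) QInf := by
    simpa [Q_zero] using hasSum_eulerCoeff_mul_pow 0
  have h_tail := abs_le.mp (abs_tsum_eulerCoeff_mul_sub_sum_le (c := fun _ => 1) (K := 1)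
    (fun m => by simp) h_sum.summable (M := 14) (by norm_num))
  have h_fourteen := abs_eulerCoeff_fourteen_le
  rw [h_sum.tsum_eq] at h_tail
  norm_num [Finset.sum_range_succ, Finset.prod_range_succ, eulerCoeff_eq_div_prod] at h_tail
  constructor <;> linarith [h_tail.1, h_tail.2]

lemma sum_eulerCoeff_mul_b_eq :
    ∃ r s : ℝ, ∑ m ∈ Finset.range 14, eulerCoeff m * b m = r + s / Real.log 2 ∧
      -0.99616440923236437572382715664 < r ∧ r < -0.99616440923236437572382715663 ∧
      0.75195753294476183540208293026 < s ∧ s < 0.75195753294476183540208293027 := by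
  refine ⟨∑ m ∈ Finset.range 14, eulerCoeff m * -(m * constCoeff m + (m + 1) * constCoeffSucc m),
    ∑ m ∈ Finset.range 14,
      eulerCoeff m * (linCoeff m + linCoeffSucc m + quadCoeff m - cubCoeff m), ?_, ?_⟩
  · rw [Finset.sum_div, ← Finset.sum_add_distrib]
    refine Finset.sum_congr rfl fun m _ => ?_
    rw [b_eq]
    ring
  · norm_num [Finset.sum_range_succ, Finset.prod_range_succ, eulerCoeff_eq_div_prod, constCoeff,
      constCoeffSucc, linCoeff, linCoeffSucc, quadCoeff, cubCoeff]

theorem leadingConstant_bounds : (0.30707981393605921828549 : ℝ) ≤ leadingConstant ∧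
    leadingConstant < (0.30707981393605921828550 : ℝ) := by
  obtain ⟨r, s, h_sum, hr_gt, hr_lt, hs_gt, hs_lt⟩ := sum_eulerCoeff_mul_b_eq
  obtain ⟨hQ_gt, hQ_lt⟩ := QInf_bounds
  obtain ⟨h_log_gt, h_log_lt⟩ := log_two_bounds
  have h_quot_lt : s / Real.log 2 < 1.084845403738507224592419749 := by
    rw [div_lt_iff₀ log_two_pos]
    linarith
  have h_quot_gt : 1.084845403738507224592419748 < s / Real.log 2 := by
    rw [lt_div_iff₀ log_two_pos]
    linarith
  have h_tail := abs_le.mp (abs_tsum_eulerCoeff_mul_sub_sum_le abs_b_le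
    hasSum_eulerCoeff_mul_b.summable (M := 14) (by norm_num))
  have h_fourteen := abs_eulerCoeff_fourteen_le
  rw [h_sum] at h_tail
  norm_num at h_tail h_fourteen
  rw [leadingConstant, one_div_mul_eq_div, le_div_iff₀ QInf_pos, div_lt_iff₀ QInf_pos]
  constructor <;> linarith [h_tail.1, h_tail.2]

/-! ### Size of the Fourier coefficients -/

lemma norm_Gamma_one_sub_mul_I_sq {y : ℝ} (hy : y ≠ 0) :
    ‖Complex.Gamma (1 - y * Complex.I)‖ ^ 2 = Real.pi * y / Real.sinh (Real.pi * y) := by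
  have h_ne : (y * Complex.I : ℂ) ≠ 0 := by simp [hy]
  have h_conj : (starRingEnd ℂ) (1 - y * Complex.I) = y * Complex.I + 1 := by
    rw [map_sub, map_mul, map_one, Complex.conj_ofReal, Complex.conj_I]
    ring
  have h_sin : Complex.sin (Real.pi * (y * Complex.I)) =
      ((Real.sinh (Real.pi * y) : ℝ) : ℂ) * Complex.I := by
    rw [← mul_assoc, Complex.sin_mul_I, ← Complex.ofReal_mul, Complex.ofReal_sinh]
  have : ((Real.sinh (Real.pi * y) : ℝ) : ℂ) ≠ 0 := by
    rw [Complex.ofReal_ne_zero, Ne, Real.sinh_eq_zero]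
    exact mul_ne_zero Real.pi_ne_zero hy
  have h_mul_conj : Complex.Gamma (1 - y * Complex.I) *
      (starRingEnd ℂ) (Complex.Gamma (1 - y * Complex.I)) =
      ((Real.pi * y / Real.sinh (Real.pi * y) : ℝ) : ℂ) := by
    rw [← Complex.Gamma_conj, h_conj, Complex.Gamma_add_one _ h_ne, mul_left_comm,
      mul_comm (Complex.Gamma _), Complex.Gamma_mul_Gamma_one_sub, h_sin]
    push_cast
    field_simp
  rw [Complex.mul_conj, Complex.normSq_eq_norm_sq] at h_mul_conj
  exact_mod_cast h_mul_conj

/-- `π |Im χ_k|`, which governs the decay of the Fourier coefficients. -/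
def freq (k : ℤ) : ℝ := 2 * Real.pi ^ 2 / Real.log 2 * |(k : ℝ)|

lemma pi_mul_abs_chi_im (k : ℤ) : Real.pi * |(chi k).im| = freq k := by
  rw [chi_im, freq, abs_div, abs_mul, abs_of_pos log_two_pos, abs_of_pos Real.two_pi_pos]
  ring

lemma chi_eq_im_mul_I (k : ℤ) : chi k = ((chi k).im : ℂ) * Complex.I := by
  rw [chi_im, chi_eq]

lemma chi_im_ne_zero {k : ℤ} (hk : k ≠ 0) : (chi k).im ≠ 0 := by
  rw [chi_im]
  exact div_ne_zero (mul_ne_zero Real.two_pi_pos.ne' (Int.cast_ne_zero.mpr hk)) log_two_pos.ne'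

lemma norm_Gamma_one_sub_chi_sq {k : ℤ} (hk : k ≠ 0) :
    ‖Complex.Gamma (1 - chi k)‖ ^ 2 = freq k / Real.sinh (freq k) := by
  rw [chi_eq_im_mul_I, norm_Gamma_one_sub_mul_I_sq (chi_im_ne_zero hk), ← pi_mul_abs_chi_im]
  rcases abs_choice (chi k).im with h | h
  · rw [h]
  · rw [h, mul_neg, Real.sinh_neg, neg_div_neg_eq]

lemma two_pi_sq_div_log_two_bounds :
    28.47 ≤ 2 * Real.pi ^ 2 / Real.log 2 ∧ 2 * Real.pi ^ 2 / Real.log 2 ≤ 28.48 := by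
  have h_pi_gt := Real.pi_gt_d6
  have h_pi_lt := Real.pi_lt_d6
  rw [le_div_iff₀ log_two_pos, div_le_iff₀ log_two_pos]
  constructor <;> nlinarith [Real.log_two_gt_d9, Real.log_two_lt_d9]

lemma le_freq (k : ℤ) : 28.47 * |(k : ℝ)| ≤ freq k :=
  mul_le_mul_of_nonneg_right two_pi_sq_div_log_two_bounds.1 (abs_nonneg _)

lemma le_freq_of_ne_zero {k : ℤ} (hk : k ≠ 0) : 28.47 ≤ freq k := by
  have h_one : (1 : ℝ) ≤ |(k : ℝ)| := by exact_mod_cast Int.one_le_abs hk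
  linarith [le_freq k]

lemma limLin_bounds : 3.70 ≤ limLin ∧ limLin ≤ 3.71 := by
  have h_le : ∀ m : ℕ, |linCoeff m + linCoeffSucc m| ≤ 3 * (m + 1) := fun m => by
    have h_add := abs_add_le (linCoeff m) (linCoeffSucc m)
    linarith [abs_linCoeff_le m, abs_linCoeffSucc_le m, m.cast_nonneg (α := ℝ)]
  have h_tail := abs_le.mp (abs_tsum_eulerCoeff_mul_sub_sum_le h_le
    summable_eulerCoeff_mul_linCoeff (M := 6) (by norm_num))
  rw [← tsum_seriesLin] at h_tail
  norm_num [Finset.sum_range_succ, Finset.prod_range_succ, eulerCoeff_eq_div_prod, linCoeff,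
    linCoeffSucc] at h_tail
  obtain ⟨hQ_gt, hQ_lt⟩ := QInf_bounds
  rw [limLin, le_div_iff₀ QInf_pos, div_le_iff₀ QInf_pos]
  constructor <;> linarith [h_tail.1, h_tail.2]

lemma limQuad_bounds : -1.392 ≤ limQuad ∧ limQuad ≤ -1.389 := by
  have h_le : ∀ m : ℕ, |quadCoeff m| ≤ 1 / 2 * (m + 1) := fun m => by
    linarith [abs_quadCoeff_le m, m.cast_nonneg (α := ℝ)]
  have h_tail := abs_le.mp (abs_tsum_eulerCoeff_mul_sub_sum_le h_le
    isEntireCoeff_seriesQuad.summable (M := 6) (by norm_num))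
  rw [show ∑' m, eulerCoeff m * quadCoeff m = ∑' m, seriesQuad m from rfl] at h_tail
  norm_num [Finset.sum_range_succ, Finset.prod_range_succ, eulerCoeff_eq_div_prod, quadCoeff]
    at h_tail
  obtain ⟨hQ_gt, hQ_lt⟩ := QInf_bounds
  rw [limQuad, le_div_iff₀ QInf_pos, div_le_iff₀ QInf_pos]
  constructor <;> linarith [h_tail.1, h_tail.2]

lemma limCub_bounds : -0.2886 ≤ limCub ∧ limCub ≤ -0.2885 := by
  obtain ⟨hQ_gt, hQ_lt⟩ := QInf_bounds
  rw [limCub, tsum_seriesCub, le_div_iff₀ QInf_pos, div_le_iff₀ QInf_pos]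
  constructor <;> linarith

lemma fourierFactor_mul_I (y : ℝ) :
    fourierFactor (y * Complex.I) =
      ((limLin / (1 + y ^ 2) + limQuad - limCub : ℝ) : ℂ) +
        (((limCub - limLin / (1 + y ^ 2)) * y : ℝ) : ℂ) * Complex.I := by
  have h_ne : (1 : ℂ) + y * Complex.I ≠ 0 := fun h => by simpa using congrArg Complex.re h
  have h_sq_ne : (1 : ℂ) + y ^ 2 ≠ 0 := by
    exact_mod_cast (by positivity : (1 : ℝ) + y ^ 2 ≠ 0)
  have h_inv : (1 : ℂ) / (1 + y * Complex.I) = (1 - y * Complex.I) / (1 + y ^ 2) := by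
    rw [div_eq_div_iff h_ne h_sq_ne]
    linear_combination (y : ℂ) ^ 2 * Complex.I_sq
  rw [fourierFactor, div_eq_mul_one_div, h_inv]
  push_cast
  ring

lemma norm_fourierFactor_mul_I_le (y : ℝ) :
    ‖fourierFactor (y * Complex.I)‖ ≤ 5.4 + 0.3 * |y| := by
  obtain ⟨hLin_ge, hLin_le⟩ := limLin_bounds
  obtain ⟨hQuad_ge, hQuad_le⟩ := limQuad_bounds
  obtain ⟨hCub_ge, hCub_le⟩ := limCub_bounds
  have h_one_le : 1 ≤ ‖(1 : ℂ) + y * Complex.I‖ := by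
    simpa using Complex.abs_re_le_norm ((1 : ℂ) + y * Complex.I)
  have h_sub_le : ‖(1 : ℂ) - y * Complex.I‖ ≤ 1 + |y| :=
    (norm_sub_le _ _).trans_eq (by simp)
  have h_lin : ‖(limLin : ℂ) / (1 + y * Complex.I)‖ ≤ 3.71 := by
    rw [norm_div, Complex.norm_real, Real.norm_eq_abs, abs_of_pos (by linarith),
      div_le_iff₀ (by linarith)]
    linarith
  have h_quad : ‖(limQuad : ℂ)‖ ≤ 1.392 := by
    rw [Complex.norm_real, Real.norm_eq_abs, abs_of_neg (by linarith)]
    linarith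
  have h_cub : ‖(limCub : ℂ) * (1 - y * Complex.I)‖ ≤ 0.2886 * (1 + |y|) := by
    rw [norm_mul, Complex.norm_real, Real.norm_eq_abs, abs_of_neg (by linarith)]
    gcongr
    linarith
  rw [fourierFactor]
  refine (norm_sub_le _ _).trans ((add_le_add_left (norm_add_le _ _) _).trans ?_)
  linarith [abs_nonneg y]

lemma norm_waveCoeff (k : ℤ) :
    ‖waveCoeff k‖ = ‖Complex.Gamma (1 - chi k)‖ * ‖fourierFactor (chi k)‖ / Real.log 2 := by
  rw [waveCoeff, norm_mul, norm_mul, norm_div, norm_one, Complex.norm_real, Real.norm_eq_abs,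
    abs_of_pos log_two_pos]
  ring

lemma exp_div_four_le_sinh {t : ℝ} (ht : 1 ≤ t) : Real.exp t / 4 ≤ Real.sinh t := by
  have h_neg : Real.exp (-t) ≤ 1 := Real.exp_le_one_iff.mpr (by linarith)
  rw [Real.sinh_eq]
  linarith [Real.add_one_le_exp t]

lemma norm_Gamma_one_sub_chi_le {k : ℤ} (hk : k ≠ 0) :
    ‖Complex.Gamma (1 - chi k)‖ ≤ 6 * Real.exp (-(7 * freq k / 16)) := by
  have h_freq := le_freq_of_ne_zero hk
  have h_exp : Real.exp (((2 : ℕ) : ℝ) * -(7 * freq k / 16)) =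
      Real.exp (freq k / 8) / Real.exp (freq k) := by
    rw [← Real.exp_sub]
    congr 1
    push_cast
    ring
  refine le_of_sq_le_sq ?_ (by positivity)
  rw [norm_Gamma_one_sub_chi_sq hk, mul_pow, ← Real.exp_nat_mul, h_exp]
  calc freq k / Real.sinh (freq k) ≤ freq k / (Real.exp (freq k) / 4) :=
        div_le_div_of_nonneg_left (by linarith) (by positivity)
          (exp_div_four_le_sinh (by linarith))
    _ = 4 * freq k / Real.exp (freq k) := by rw [div_div_eq_mul_div, mul_comm]
    _ ≤ 6 ^ 2 * Real.exp (freq k / 8) / Real.exp (freq k) :=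
        div_le_div_of_nonneg_right (by linarith [Real.add_one_le_exp (freq k / 8)])
          (Real.exp_pos _).le
    _ = 6 ^ 2 * (Real.exp (freq k / 8) / Real.exp (freq k)) := mul_div_assoc _ _ _

lemma norm_fourierFactor_chi_le {k : ℤ} (hk : k ≠ 0) :
    ‖fourierFactor (chi k)‖ ≤ 7 * Real.exp (freq k / 16) := by
  have h_freq := le_freq_of_ne_zero hk
  have h_le := norm_fourierFactor_mul_I_le (chi k).im
  rw [← chi_eq_im_mul_I] at h_le
  have h_im : 3 * |(chi k).im| ≤ freq k := by
    rw [← pi_mul_abs_chi_im]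
    gcongr
    exact Real.pi_gt_three.le
  linarith [Real.add_one_le_exp (freq k / 16)]

lemma exp_neg_ten_le : Real.exp (-10) ≤ 1 / 20000 := by
  have h_one : (2.718 : ℝ) ≤ Real.exp 1 := by linarith [Real.exp_one_gt_d9]
  have h_ten : Real.exp 10 = Real.exp 1 ^ 10 := by rw [← Real.exp_nat_mul]; norm_num
  rw [Real.exp_neg, inv_le_comm₀ (Real.exp_pos _) (by norm_num), h_ten]
  calc ((1 / 20000 : ℝ))⁻¹ ≤ 2.718 ^ 10 := by norm_num
    _ ≤ Real.exp 1 ^ 10 := by gcongr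

lemma exp_neg_freq_le (k : ℤ) : Real.exp (-(3 * freq k / 8)) ≤ (1 / 20000) ^ k.natAbs := by
  have h_abs : (k.natAbs : ℝ) = |(k : ℝ)| := by rw [Nat.cast_natAbs, Int.cast_abs]
  calc Real.exp (-(3 * freq k / 8)) ≤ Real.exp (k.natAbs * -10) := by
        rw [Real.exp_le_exp, h_abs]
        linarith [le_freq k, abs_nonneg (k : ℝ)]
    _ = Real.exp (-10) ^ k.natAbs := Real.exp_nat_mul _ _
    _ ≤ (1 / 20000) ^ k.natAbs := by
        gcongr
        exact exp_neg_ten_le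

lemma norm_waveCoeff_le {k : ℤ} (hk : k ≠ 0) :
    ‖waveCoeff k‖ ≤ 61 * (1 / 20000) ^ k.natAbs := by
  have h_exp : Real.exp (-(7 * freq k / 16)) * Real.exp (freq k / 16) =
      Real.exp (-(3 * freq k / 8)) := by
    rw [← Real.exp_add]
    ring_nf
  have h_pow_pos : (0 : ℝ) < (1 / 20000) ^ k.natAbs := by positivity
  rw [norm_waveCoeff, div_le_iff₀ log_two_pos]
  calc ‖Complex.Gamma (1 - chi k)‖ * ‖fourierFactor (chi k)‖
      ≤ (6 * Real.exp (-(7 * freq k / 16))) * (7 * Real.exp (freq k / 16)) :=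
        mul_le_mul (norm_Gamma_one_sub_chi_le hk) (norm_fourierFactor_chi_le hk)
          (norm_nonneg _) (by positivity)
    _ = 42 * Real.exp (-(3 * freq k / 8)) := by rw [← h_exp]; ring
    _ ≤ 42 * (1 / 20000) ^ k.natAbs := mul_le_mul_of_nonneg_left (exp_neg_freq_le k) (by norm_num)
    _ ≤ 61 * (1 / 20000) ^ k.natAbs * Real.log 2 := by nlinarith [Real.log_two_gt_d9]

section NatAbsEqOne

variable {k : ℤ} (hk : k.natAbs = 1)

include hk

lemma abs_intCast_of_natAbs_eq_one : |(k : ℝ)| = 1 := by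
  rw [← Int.cast_abs, ← Nat.cast_natAbs, hk, Nat.cast_one]

lemma freq_bounds_of_natAbs_eq_one : 28.47 ≤ freq k ∧ freq k ≤ 28.48 := by
  rw [freq, abs_intCast_of_natAbs_eq_one hk, mul_one]
  exact two_pi_sq_div_log_two_bounds

lemma le_sinh_freq_of_natAbs_eq_one : 1.139 * 10 ^ 12 ≤ Real.sinh (freq k) := by
  have h_freq := (freq_bounds_of_natAbs_eq_one hk).1
  have h_one : (2.71828 : ℝ) ≤ Real.exp 1 := by linarith [Real.exp_one_gt_d9]
  have h_frac := Real.quadratic_le_exp_of_nonneg (x := 0.47) (by norm_num)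
  have h_exp : (2.28 : ℝ) * 10 ^ 12 ≤ Real.exp (freq k) := by
    calc (2.28 : ℝ) * 10 ^ 12 ≤ 2.71828 ^ 28 * (1 + 0.47 + 0.47 ^ 2 / 2) := by norm_num
      _ ≤ Real.exp 1 ^ 28 * Real.exp 0.47 := by gcongr
      _ = Real.exp 28.47 := by rw [← Real.exp_nat_mul, ← Real.exp_add]; norm_num
      _ ≤ Real.exp (freq k) := Real.exp_le_exp.mpr h_freq
  have h_neg : Real.exp (-freq k) ≤ 1 := Real.exp_le_one_iff.mpr (by linarith)
  rw [Real.sinh_eq]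
  linarith

lemma norm_Gamma_one_sub_chi_le_of_natAbs_eq_one :
    ‖Complex.Gamma (1 - chi k)‖ ≤ 5.05 / 10 ^ 6 := by
  have h_sinh := le_sinh_freq_of_natAbs_eq_one hk
  have h_ne : k ≠ 0 := Int.natAbs_ne_zero.mp (by omega)
  refine le_of_sq_le_sq ?_ (by positivity)
  rw [norm_Gamma_one_sub_chi_sq h_ne, div_le_iff₀ (by linarith)]
  linarith [(freq_bounds_of_natAbs_eq_one hk).2]

lemma chi_im_sq_bounds_of_natAbs_eq_one : 82 ≤ (chi k).im ^ 2 ∧ (chi k).im ^ 2 ≤ 82.3 := by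
  have h_abs : |(chi k).im| = 2 * Real.pi / Real.log 2 := by
    rw [chi_im, abs_div, abs_mul, abs_intCast_of_natAbs_eq_one hk, abs_of_pos log_two_pos,
      abs_of_pos Real.two_pi_pos, mul_one]
  have h_ge : 9.06 ≤ 2 * Real.pi / Real.log 2 := by
    rw [le_div_iff₀ log_two_pos]
    linarith [Real.pi_gt_d6, Real.log_two_lt_d9]
  have h_le : 2 * Real.pi / Real.log 2 ≤ 9.07 := by
    rw [div_le_iff₀ log_two_pos]
    linarith [Real.pi_lt_d6, Real.log_two_gt_d9]
  rw [← sq_abs, h_abs]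
  constructor <;> nlinarith

lemma norm_fourierFactor_chi_le_of_natAbs_eq_one : ‖fourierFactor (chi k)‖ ≤ 3.25 := by
  obtain ⟨hLin_ge, hLin_le⟩ := limLin_bounds
  obtain ⟨hQuad_ge, hQuad_le⟩ := limQuad_bounds
  obtain ⟨hCub_ge, hCub_le⟩ := limCub_bounds
  obtain ⟨h_sq_ge, h_sq_le⟩ := chi_im_sq_bounds_of_natAbs_eq_one hk
  rw [chi_eq_im_mul_I, fourierFactor_mul_I]
  refine le_of_sq_le_sq ?_ (by norm_num)
  rw [← Complex.normSq_eq_norm_sq, Complex.normSq_add_mul_I, mul_pow]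
  have h_frac_ge : 0.044 ≤ limLin / (1 + (chi k).im ^ 2) := by
    rw [le_div_iff₀ (by positivity)]
    linarith
  have h_frac_le : limLin / (1 + (chi k).im ^ 2) ≤ 0.045 := by
    rw [div_le_iff₀ (by positivity)]
    linarith
  generalize limLin / (1 + (chi k).im ^ 2) = p at *
  have h_re : (p + limQuad - limCub) ^ 2 ≤ 1.07 ^ 2 :=
    sq_le_sq' (by linarith) (by linarith)
  have h_im : (limCub - p) ^ 2 ≤ 0.3336 ^ 2 := sq_le_sq' (by linarith) (by linarith)
  calc (p + limQuad - limCub) ^ 2 + (limCub - p) ^ 2 * (chi k).im ^ 2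
      ≤ 1.07 ^ 2 + 0.3336 ^ 2 * 82.3 := by gcongr
    _ ≤ 3.25 ^ 2 := by norm_num

lemma norm_waveCoeff_le_of_natAbs_eq_one : ‖waveCoeff k‖ ≤ 2.4 / 10 ^ 5 := by
  rw [norm_waveCoeff, div_le_iff₀ log_two_pos]
  calc ‖Complex.Gamma (1 - chi k)‖ * ‖fourierFactor (chi k)‖ ≤ 5.05 / 10 ^ 6 * 3.25 :=
        mul_le_mul (norm_Gamma_one_sub_chi_le_of_natAbs_eq_one hk)
          (norm_fourierFactor_chi_le_of_natAbs_eq_one hk) (norm_nonneg _) (by norm_num)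
    _ ≤ 2.4 / 10 ^ 5 * 0.6931471803 := by norm_num
    _ ≤ 2.4 / 10 ^ 5 * Real.log 2 := by
      gcongr
      exact Real.log_two_gt_d9.le

end NatAbsEqOne

/-- A majorant of the Fourier coefficients of index `±n`. The pair `±1` needs a sharper estimate
than the others, since it accounts for almost all of the bound on the fluctuation. -/
def coeffBound (n : ℕ) : ℝ :=
  if n = 0 then 0 else if n = 1 then 2.4 / 10 ^ 5 else 61 * (1 / 20000) ^ n

/-- The Fourier coefficients `c_k` of the fluctuation, with `c_0 = 0`. -/
def periodicCoeff (k : ℤ) : ℂ := if k = 0 then 0 else waveCoeff k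

lemma norm_periodicCoeff_le (k : ℤ) : ‖periodicCoeff k‖ ≤ coeffBound k.natAbs := by
  unfold periodicCoeff coeffBound
  by_cases h_zero : k = 0
  · simp [h_zero]
  · rw [if_neg h_zero, if_neg (Int.natAbs_ne_zero.mpr h_zero)]
    split_ifs with h_one
    · exact norm_waveCoeff_le_of_natAbs_eq_one h_one
    · exact norm_waveCoeff_le h_zero

lemma hasSum_coeffBound_succ : HasSum (fun n => coeffBound (n + 1))
    (2.4 / 10 ^ 5 + 61 * (1 / 20000) ^ 2 * (20000 / 19999)) := by
  rw [← hasSum_nat_add_iff' 1]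
  have h_geom := (hasSum_geometric_of_lt_one (r := (1 / 20000 : ℝ)) (by norm_num)
    (by norm_num)).mul_left (61 * (1 / 20000) ^ 2)
  convert! h_geom using 1
  · funext n
    rw [coeffBound, if_neg (by omega), if_neg (by omega)]
    ring
  · norm_num [coeffBound]

lemma hasSum_coeffBound :
    HasSum coeffBound (2.4 / 10 ^ 5 + 61 * (1 / 20000) ^ 2 * (20000 / 19999)) := by
  rw [← hasSum_nat_add_iff' 1]
  simpa [coeffBound] using hasSum_coeffBound_succ

lemma hasSum_coeffBound_natAbs : HasSum (fun k : ℤ => coeffBound k.natAbs)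
    ((2.4 / 10 ^ 5 + 61 * (1 / 20000) ^ 2 * (20000 / 19999)) +
      (2.4 / 10 ^ 5 + 61 * (1 / 20000) ^ 2 * (20000 / 19999))) := by
  refine HasSum.of_nat_of_neg_add_one (f := fun k : ℤ => coeffBound k.natAbs) ?_ ?_
  · simpa using hasSum_coeffBound
  · exact hasSum_coeffBound_succ.congr_fun fun n => congrArg coeffBound (by omega)

lemma summable_norm_periodicCoeff : Summable fun k : ℤ => ‖periodicCoeff k‖ :=
  Summable.of_nonneg_of_le (fun _ => norm_nonneg _) norm_periodicCoeff_le
    hasSum_coeffBound_natAbs.summable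

lemma tsum_norm_periodicCoeff_lt : ∑' k : ℤ, ‖periodicCoeff k‖ < 5 / 10 ^ 5 := by
  refine (summable_norm_periodicCoeff.tsum_le_tsum norm_periodicCoeff_le
    hasSum_coeffBound_natAbs.summable).trans_lt ?_
  rw [hasSum_coeffBound_natAbs.tsum_eq]
  norm_num

lemma waveCoeff_eq (k : ℤ) :
    waveCoeff k = periodicCoeff k + if k = 0 then waveCoeff 0 else 0 := by
  unfold periodicCoeff
  split_ifs with hk
  · rw [hk, zero_add]
  · rw [add_zero]

lemma summable_waveCoeff : Summable waveCoeff :=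
  (summable_norm_periodicCoeff.of_norm.add (hasSum_ite_eq 0 (waveCoeff 0)).summable).congr
    fun k => (waveCoeff_eq k).symm

/-! ### The Fourier series of the fluctuation -/

lemma summable_half_pow_natAbs : Summable fun n : ℤ => (1 / 2 : ℝ) ^ n.natAbs := by
  rw [summable_int_iff_summable_nat_and_neg]
  constructor <;> simpa using summable_geometric_two

lemma exp_neg_natCast_mul_log_two (n : ℕ) : Real.exp (-(n * Real.log 2)) = (1 / 2) ^ n := by
  rw [Real.exp_neg, mul_comm, Real.exp_mul, Real.exp_log two_pos, Real.rpow_natCast,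
    one_div, inv_pow]

lemma summable_wave (x : ℝ) : Summable fun n : ℤ => wave (x + n) := by
  refine Summable.of_norm_bounded (summable_half_pow_natAbs.mul_left
    (profileBound * Real.exp (|x| * Real.log 2))) fun n => (abs_wave_le _).trans ?_
  rw [mul_assoc, ← exp_neg_natCast_mul_log_two, ← Real.exp_add, Nat.cast_natAbs, Int.cast_abs]
  refine mul_le_mul_of_nonneg_left (Real.exp_le_exp.mpr ?_) profileBound_nonneg
  have h_abs : |(n : ℝ)| ≤ |x + n| + |x| := by
    simpa only [add_sub_cancel_left] using abs_sub (x + n) x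
  nlinarith [log_two_pos]

/-- The mean of the periodized wave `waveSum`. -/
def waveMean : ℝ := (limLin + limQuad - limCub) / Real.log 2

lemma waveCoeff_zero : waveCoeff 0 = waveMean := by
  have h_chi : chi 0 = 0 := by simp [chi]
  rw [waveCoeff, h_chi, waveMean, fourierFactor, sub_zero, add_zero, Complex.Gamma_one]
  push_cast
  ring

/-- The periodization of `wave`, whose Fourier coefficients are `waveCoeff` by Poisson summation. -/
def waveSum (x : ℝ) : ℝ := ∑' n : ℤ, wave (x + n)

lemma norm_exp_two_pi_mul (k : ℤ) (x : ℝ) :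
    ‖Complex.exp (2 * Real.pi * Complex.I * k * x)‖ = 1 := by
  have h_arg : (2 * Real.pi * Complex.I * k * x : ℂ) =
      ((2 * Real.pi * k * x : ℝ) : ℂ) * Complex.I := by
    push_cast
    ring
  rw [h_arg, Complex.norm_exp_ofReal_mul_I]

lemma hasSum_waveSum (x : ℝ) :
    HasSum (fun k : ℤ => waveCoeff k * Complex.exp (2 * Real.pi * Complex.I * k * x))
      (waveSum x : ℂ) := by
  have h_summable :
      Summable fun k : ℤ => waveCoeff k * Complex.exp (2 * Real.pi * Complex.I * k * x) := by
    refine Summable.of_norm ?_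
    simp only [norm_mul, norm_exp_two_pi_mul, mul_one]
    exact summable_waveCoeff.norm
  have h_fourier : (fun n : ℤ => 𝓕 (Complex.ofReal ∘ wave) (n : ℝ)) = waveCoeff :=
    funext fourier_wave
  have h_poisson := Real.tsum_eq_tsum_fourier_of_rpow_decay_of_summable
    (Complex.continuous_ofReal.comp continuous_wave) one_lt_two wave_isBigO
    (h_fourier ▸ summable_waveCoeff) x
  have h_term (k : ℤ) : 𝓕 (Complex.ofReal ∘ wave) (k : ℝ) * fourier k (x : UnitAddCircle) =
      waveCoeff k * Complex.exp (2 * Real.pi * Complex.I * k * x) := by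
    rw [congrFun h_fourier k, fourier_coe_apply, Complex.ofReal_one, div_one]
  rw [tsum_congr h_term] at h_poisson
  rw [waveSum, Complex.ofReal_tsum]
  exact h_poisson ▸ h_summable.hasSum

/-- The periodic fluctuation `δ`. -/
def fluctuation (x : ℝ) : ℝ := waveSum x - waveMean

lemma fluctuation_periodic : Function.Periodic fluctuation 1 := by
  intro x
  unfold fluctuation waveSum
  congr 1
  rw [← (Equiv.addLeft (1 : ℤ)).tsum_eq fun n : ℤ => wave (x + n)]
  refine tsum_congr fun n => ?_
  rw [Equiv.coe_addLeft, Int.cast_add, Int.cast_one, add_assoc]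

lemma hasSum_fluctuation (x : ℝ) :
    HasSum (fun k : ℤ => periodicCoeff k * Complex.exp (2 * Real.pi * Complex.I * k * x))
      (fluctuation x : ℂ) := by
  rw [fluctuation, Complex.ofReal_sub]
  refine ((hasSum_waveSum x).sub (hasSum_ite_eq (0 : ℤ) (waveMean : ℂ))).congr_fun fun k => ?_
  unfold periodicCoeff
  split_ifs with hk
  · simp [hk, waveCoeff_zero]
  · rw [sub_zero]

lemma abs_fluctuation_lt (x : ℝ) : |fluctuation x| < 5 / 10 ^ 5 := by
  refine lt_of_le_of_lt ?_ tsum_norm_periodicCoeff_lt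
  rw [← Real.norm_eq_abs, ← Complex.norm_real, ← (hasSum_fluctuation x).tsum_eq]
  refine tsum_of_norm_bounded summable_norm_periodicCoeff.hasSum fun k => ?_
  rw [norm_mul, norm_exp_two_pi_mul, mul_one]

/-! ### The asymptotic expansion -/

section Scale

variable {N : ℕ} (hN : 0 < N)

include hN

lemma exp_logb_mul_log : Real.exp (Real.logb 2 N * Real.log 2) = N := by
  rw [Real.logb, div_mul_cancel₀ _ log_two_pos.ne', Real.exp_log (Nat.cast_pos.mpr hN)]

lemma natCast_mul_wave_sub (n : ℕ) :
    N * wave (Real.logb 2 N + -(n : ℝ)) = 2 ^ n * profile (N * (1 / 2) ^ n) := by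
  have h_ne : (N : ℝ) ≠ 0 := Nat.cast_ne_zero.mpr hN.ne'
  have h_exp : Real.exp ((Real.logb 2 N + -(n : ℝ)) * Real.log 2) = N * (1 / 2) ^ n := by
    rw [add_mul, Real.exp_add, exp_logb_mul_log hN, neg_mul, exp_neg_natCast_mul_log_two]
  rw [wave, Real.exp_neg, h_exp, ← mul_assoc, one_div, inv_pow]
  field_simp

lemma natCast_mul_abs_wave_add_le (n : ℕ) :
    N * |wave (Real.logb 2 N + n)| ≤ profileBound * (1 / 2) ^ n := by
  have : (0 : ℝ) < N := Nat.cast_pos.mpr hN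
  have h_exp : Real.exp (-((Real.logb 2 N + n) * Real.log 2)) = (1 / 2) ^ n / N := by
    rw [add_mul, neg_add, Real.exp_add, exp_neg_natCast_mul_log_two, Real.exp_neg,
      exp_logb_mul_log hN, mul_comm, ← div_eq_mul_inv]
  have h_profile := abs_profile_le (Real.exp_pos ((Real.logb 2 N + n) * Real.log 2)).le
  rw [wave, abs_mul, abs_of_pos (Real.exp_pos _), h_exp]
  calc N * ((1 / 2) ^ n / N * |profile (Real.exp ((Real.logb 2 N + n) * Real.log 2))|)
      = |profile (Real.exp ((Real.logb 2 N + n) * Real.log 2))| * (1 / 2) ^ n := by field_simp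
    _ ≤ profileBound * (1 / 2) ^ n := by gcongr

lemma natCast_mul_waveSum_sub_eq :
    N * waveSum (Real.logb 2 N) - ∑' n : ℕ, 2 ^ n * profile (N * (1 / 2) ^ n) =
      ∑' n : ℕ, N * wave (Real.logb 2 N + (n + 1 : ℕ)) := by
  set f : ℤ → ℝ := fun n => wave (Real.logb 2 N + ((-n : ℤ) : ℝ)) with hf
  have h_sum : HasSum f (waveSum (Real.logb 2 N)) :=
    (Equiv.neg ℤ).hasSum_iff.mpr (summable_wave _).hasSum
  have h_nonpos : Summable fun n : ℕ => f n := h_sum.summable.comp_injective Nat.cast_injective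
  have h_pos : Summable fun n : ℕ => f (-(n + 1)) :=
    h_sum.summable.comp_injective (i := fun n : ℕ => -((n : ℤ) + 1))
      fun a b hab => by simpa using hab
  have h_profile (n : ℕ) : 2 ^ n * profile (N * (1 / 2) ^ n) = N * f n := by
    simp only [hf, ← natCast_mul_wave_sub hN, Int.cast_neg, Int.cast_natCast]
  have h_wave (n : ℕ) : N * wave (Real.logb 2 N + (n + 1 : ℕ)) = N * f (-(n + 1)) := by
    simp only [hf, neg_neg]
    norm_cast
  rw [tsum_congr h_profile, tsum_congr h_wave, tsum_mul_left, tsum_mul_left, ← h_sum.tsum_eq,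
    tsum_of_nat_of_neg_add_one h_nonpos h_pos, mul_add, add_sub_cancel_left]

lemma abs_waveSum_sub_le :
    |N * waveSum (Real.logb 2 N) - ∑' n : ℕ, 2 ^ n * profile (N * (1 / 2) ^ n)| ≤
      profileBound := by
  have h_geom := (hasSum_geometric_two.mul_left profileBound).div_const 2
  rw [mul_div_cancel_right₀ _ two_ne_zero] at h_geom
  rw [natCast_mul_waveSum_sub_eq hN, ← Real.norm_eq_abs]
  refine tsum_of_norm_bounded h_geom fun n => ?_
  rw [norm_mul, Real.norm_eq_abs, Real.norm_eq_abs, Nat.abs_cast]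
  exact (natCast_mul_abs_wave_add_le hN (n + 1)).trans_eq (by ring)

end Scale

theorem averageProtected_isBigO :
    (fun N : ℕ => averageProtected N
        - ((N : ℝ) * leadingConstant + (N : ℝ) * fluctuation (Real.logb 2 N)))
      =O[atTop] (fun _ : ℕ => (1 : ℝ)) := by
  obtain ⟨C, hC⟩ := exists_abs_averageProtected_sub_le
  refine IsBigO.of_bound (C + profileBound) ?_
  filter_upwards [eventually_ge_atTop 3] with N hN
  have h_split : averageProtected N -
      ((N : ℝ) * leadingConstant + (N : ℝ) * fluctuation (Real.logb 2 N)) =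
      (averageProtected N - N * baseConst - ∑' n : ℕ, 2 ^ n * profile (N * (1 / 2) ^ n)) -
        (N * waveSum (Real.logb 2 N) - ∑' n : ℕ, 2 ^ n * profile (N * (1 / 2) ^ n)) := by
    rw [leadingConstant_eq, fluctuation, waveMean]
    ring
  rw [h_split, norm_one, mul_one]
  exact (norm_sub_le _ _).trans (add_le_add (hC N hN) (abs_waveSum_sub_le (by omega)))

/-! ### The limits defining `b_m` and the residues -/

lemma log_two_ofReal_ne_zero : (Real.log 2 : ℂ) ≠ 0 :=
  Complex.ofReal_ne_zero.mpr log_two_pos.ne'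

lemma QInf_ofReal_ne_zero : (QInf : ℂ) ≠ 0 :=
  Complex.ofReal_ne_zero.mpr QInf_pos.ne'

lemma two_cpow_eq_exp (w : ℂ) : (2 : ℂ) ^ w = Complex.exp (w * Real.log 2) := by
  rw [Complex.cpow_def_of_ne_zero two_ne_zero, mul_comm, Complex.ofReal_log zero_le_two,
    Complex.ofReal_ofNat]

lemma continuous_two_cpow_one_sub : Continuous fun z : ℂ => (2 : ℂ) ^ (1 - z) := by
  simp only [two_cpow_eq_exp]
  fun_prop

lemma hasDerivAt_two_cpow_neg (κ : ℂ) :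
    HasDerivAt (fun κ : ℂ => (2 : ℂ) ^ (-κ)) (-(Real.log 2 * 2 ^ (-κ))) κ := by
  simp only [two_cpow_eq_exp]
  have h_neg : HasDerivAt (fun κ : ℂ => -κ * (Real.log 2 : ℂ)) (-1 * (Real.log 2 : ℂ)) κ :=
    (hasDerivAt_neg κ).mul_const _
  convert! h_neg.cexp using 1
  ring

lemma hasDerivAt_one_sub_two_cpow {z : ℂ} (hz : (2 : ℂ) ^ (1 - z) = 1) :
    HasDerivAt (fun z : ℂ => 1 - (2 : ℂ) ^ (1 - z)) (Real.log 2) z := by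
  have h_cpow := (hasDerivAt_two_cpow_neg (z - 1)).comp_sub_const z 1
  simp only [neg_sub] at h_cpow
  rw [hz, mul_one] at h_cpow
  simpa only [neg_neg] using h_cpow.const_sub 1

lemma hasDerivAt_innerPoly (m : ℕ) :
    HasDerivAt (fun κ : ℂ => innerPoly m (2 ^ (-κ)) κ) ((Real.log 2 * b m : ℝ) : ℂ) 0 := by
  have h_id := hasDerivAt_id (0 : ℂ)
  have h_pow := (hasDerivAt_two_cpow_neg 0).pow m
  have h_pow_succ := (hasDerivAt_two_cpow_neg 0).pow (m + 1)
  have h_sum := (((((h_pow.sub_const 1).const_mul (constCoeff m : ℂ)).add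
    ((h_pow_succ.sub_const 1).const_mul (constCoeffSucc m : ℂ))).add
    (h_id.mul ((h_pow.const_mul (linCoeff m : ℂ)).add
      (h_pow_succ.const_mul (linCoeffSucc m : ℂ))))).add
    ((h_id.mul (h_id.add_const 1)).mul (h_pow.const_mul (quadCoeff m : ℂ)))).add
    (((h_id.pow 3).sub h_id).mul (h_pow.const_mul (cubCoeff m : ℂ)))
  have h_b : Real.log 2 * b m = -(Real.log 2 * (m * constCoeff m + (m + 1) * constCoeffSucc m)) +
      (linCoeff m + linCoeffSucc m + quadCoeff m - cubCoeff m) := by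
    have h_ne := log_two_pos.ne'
    rw [b_eq]
    field_simp
  convert! h_sum using 1
  rw [h_b]
  simp only [Complex.ofReal_add, Complex.ofReal_neg, Complex.ofReal_mul, Complex.ofNat_log,
    Complex.ofReal_natCast, Complex.ofReal_one, Complex.ofReal_sub, neg_zero, Complex.cpow_zero,
    one_pow, mul_one, mul_neg, Nat.cast_add, Nat.cast_one, add_tsub_cancel_right, Pi.pow_apply,
    Pi.add_apply, one_mul, id_eq, zero_mul, add_zero, zero_add, Pi.mul_apply, Nat.cast_ofNat,
    Nat.add_one_sub_one, ne_eq, OfNat.ofNat_ne_zero, not_false_eq_true, zero_pow, mul_zero,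
    zero_sub, neg_mul, Pi.sub_apply, sub_self]
  ring

lemma tendsto_div_of_hasDerivAt {𝕜 : Type*} [NontriviallyNormedField 𝕜] {f g : 𝕜 → 𝕜}
    {f' g' a : 𝕜} (hf : HasDerivAt f f' a) (hg : HasDerivAt g g' a) (hfa : f a = 0)
    (hga : g a = 0) (hg' : g' ≠ 0) :
    Tendsto (fun z => f z / g z) (𝓝[≠] a) (𝓝 (f' / g')) := by
  refine ((hasDerivAt_iff_tendsto_slope.mp hf).div
    (hasDerivAt_iff_tendsto_slope.mp hg) hg').congr' ?_
  filter_upwards [self_mem_nhdsWithin] with z hz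
  rw [Pi.div_apply, slope_def_field, slope_def_field, hfa, hga, sub_zero, sub_zero,
    div_div_div_cancel_right₀ (sub_ne_zero.mpr hz)]

lemma tendsto_QInf_div_QFun {z : ℂ} (hz : (2 : ℂ) ^ (1 - z) = 1) :
    Tendsto (fun z : ℂ => (QInf : ℂ) / QFun (2 ^ (1 - z))) (𝓝[≠] z) (𝓝 1) := by
  have h_den := ((isEntireCoeff_eulerCoeff.continuous_entireSum.comp
    continuous_two_cpow_one_sub).tendsto z).mono_left (nhdsWithin_le_nhds (s := {z}ᶜ))
  simp only [Function.comp_apply, hz, ← QInf_eq_entireSum] at h_den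
  simp only [QFun_eq_entireSum]
  have h_div := (tendsto_const_nhds (x := (QInf : ℂ))).div h_den QInf_ofReal_ne_zero
  rwa [div_self QInf_ofReal_ne_zero] at h_div

theorem tendsto_b (m : ℕ) : Tendsto
    (fun z : ℂ => (QInf : ℂ) / QFun (2 ^ (1 - z)) / (1 - 2 ^ (1 - z)) * innerSum m z)
    (𝓝[≠] 1) (𝓝 (b m : ℂ)) := by
  have h_one : (2 : ℂ) ^ (1 - (1 : ℂ)) = 1 := by rw [sub_self, Complex.cpow_zero]
  have h_eq (z : ℂ) : innerSum m z = innerPoly m (2 ^ (-(z - 1))) (z - 1) := by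
    rw [← innerSum_eq_innerPoly, add_sub_cancel]
  have h_deriv : HasDerivAt (innerSum m) ((Real.log 2 * b m : ℝ) : ℂ) 1 := by
    have h_poly := hasDerivAt_innerPoly m
    rw [← sub_self (1 : ℂ)] at h_poly
    simpa only [← h_eq] using h_poly.comp_sub_const 1 1
  have h_zero : innerSum m 1 = 0 := by simp [h_eq, innerPoly]
  have h_quot := tendsto_div_of_hasDerivAt h_deriv (hasDerivAt_one_sub_two_cpow h_one) h_zero
    (by rw [h_one, sub_self]) log_two_ofReal_ne_zero
  have h_lim := (tendsto_QInf_div_QFun h_one).mul h_quot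
  rw [Complex.ofReal_mul, mul_div_cancel_left₀ _ log_two_ofReal_ne_zero, one_mul] at h_lim
  exact h_lim.congr fun z => by ring

lemma psi_eq (z : ℂ) : psi z = QInf / QFun (2 ^ (1 - z)) / (1 - 2 ^ (1 - z)) *
    (1 / QInf * innerTotal (2 ^ (1 - z)) (z - 1)) := by
  have h_total : ∑' m, (eulerCoeff m : ℂ) * innerSum m z = innerTotal (2 ^ (1 - z)) (z - 1) := by
    simpa only [add_sub_cancel, neg_sub] using (hasSum_innerSum (z - 1)).tsum_eq
  have h_half : (2 : ℂ) ^ (2 - z) / 2 = 2 ^ (1 - z) := by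
    rw [show 2 - z = (1 - z) + 1 by ring, Complex.cpow_add _ _ two_ne_zero, Complex.cpow_one,
      mul_div_cancel_right₀ _ two_ne_zero]
  rw [psi, h_total, QFun_eq_entireSum, QFun_eq_entireSum,
    entireSum_eulerCoeff_eq_mul_half (2 ^ (2 - z)), h_half, mul_comm (1 - _), div_mul_eq_div_div]

lemma continuous_innerTotal :
    Continuous fun z : ℂ => innerTotal ((2 : ℂ) ^ (1 - z)) (z - 1) := by
  have h_const := isEntireCoeff_seriesConst.continuous_entireSum
  have h_lin := isEntireCoeff_seriesLin.continuous_entireSum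
  have h_quad := isEntireCoeff_seriesQuad.continuous_entireSum
  have h_cub := isEntireCoeff_seriesCub.continuous_entireSum
  have := continuous_two_cpow_one_sub
  unfold innerTotal
  fun_prop

lemma innerTotal_one (χ : ℂ) :
    innerTotal 1 χ = QInf * (χ * limLin + χ * (χ + 1) * limQuad + (χ ^ 3 - χ) * limCub) := by
  have h_ne := QInf_ofReal_ne_zero
  rw [innerTotal, entireSum_one, entireSum_one, entireSum_one, entireSum_one, tsum_seriesConst,
    limLin, limQuad, limCub]
  push_cast
  field_simp
  ring

lemma two_cpow_one_sub_one_add_chi (k : ℤ) : (2 : ℂ) ^ (1 - (1 + chi k)) = 1 := by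
  have h_ne := log_two_ofReal_ne_zero
  rw [two_cpow_eq_exp, Complex.exp_eq_one_iff]
  refine ⟨-k, ?_⟩
  rw [chi]
  push_cast
  field_simp
  ring

lemma waveCoeff_eq_Gamma_mul {k : ℤ} (hk : k ≠ 0) :
    waveCoeff k = 1 / Real.log 2 * Complex.Gamma (-(1 + chi k)) *
      (chi k * limLin + chi k * (chi k + 1) * limQuad + (chi k ^ 3 - chi k) * limCub) := by
  have h_chi : chi k ≠ 0 := fun h => chi_im_ne_zero hk (by rw [h, Complex.zero_im])
  have h_one_add : 1 + chi k ≠ 0 := fun h => by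
    simpa [chi_re] using congrArg Complex.re h
  have h_Gamma := Complex.Gamma_add_one (-(1 + chi k)) (neg_ne_zero.mpr h_one_add)
  rw [show -(1 + chi k) + 1 = -chi k by ring] at h_Gamma
  rw [waveCoeff, show 1 - chi k = -chi k + 1 by ring,
    Complex.Gamma_add_one _ (neg_ne_zero.mpr h_chi), h_Gamma, fourierFactor]
  field_simp
  ring

lemma continuousAt_Gamma_neg {z : ℂ} (hz : z.im ≠ 0) :
    ContinuousAt (fun z : ℂ => Complex.Gamma (-z)) z := by
  refine ContinuousAt.comp (g := Complex.Gamma) ?_ continuousAt_neg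
  refine (Complex.differentiableAt_Gamma _ fun m h => hz ?_).continuousAt
  simpa using congrArg Complex.im h

theorem tendsto_residue {k : ℤ} (hk : k ≠ 0) : Tendsto
    (fun z : ℂ => (z - (1 + chi k)) * (Complex.Gamma (-z) * psi z))
    (𝓝[≠] (1 + chi k)) (𝓝 (waveCoeff k)) := by
  have h_cpow := two_cpow_one_sub_one_add_chi k
  have h_quot := tendsto_div_of_hasDerivAt ((hasDerivAt_id (1 + chi k)).sub_const (1 + chi k))
    (hasDerivAt_one_sub_two_cpow h_cpow) (sub_self _) (by rw [h_cpow, sub_self])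
    log_two_ofReal_ne_zero
  have h_Gamma := (continuousAt_Gamma_neg (z := 1 + chi k)
    (by simpa using chi_im_ne_zero hk)).continuousWithinAt (s := {1 + chi k}ᶜ)
  have h_total := continuous_innerTotal.continuousWithinAt (s := {1 + chi k}ᶜ) (x := 1 + chi k)
  have h_lim := (((h_quot.mul h_Gamma).mul (tendsto_QInf_div_QFun h_cpow)).mul
    (h_total.const_mul (1 / (QInf : ℂ))))
  have h_value : 1 / (Real.log 2 : ℂ) * Complex.Gamma (-(1 + chi k)) * 1 *
      (1 / QInf * innerTotal (2 ^ (1 - (1 + chi k))) (1 + chi k - 1)) = waveCoeff k := by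
    have h_ne := QInf_ofReal_ne_zero
    rw [h_cpow, add_sub_cancel_left, innerTotal_one, waveCoeff_eq_Gamma_mul hk]
    field_simp
  rw [h_value] at h_lim
  refine h_lim.congr fun z => ?_
  rw [psi_eq, id]
  ring

end DST

end

theorem theorem2 :
    -- the constant: its series converges, its terms come from the stated limits, and its value
    Summable (fun m : ℕ => DST.eulerCoeff m * DST.b m) ∧
    (∀ m : ℕ, Tendsto
      (fun z : ℂ => (DST.QInf : ℂ) / DST.QFun (2 ^ (1 - z)) / (1 - 2 ^ (1 - z)) * DST.innerSum m z)
      (𝓝[≠] 1) (𝓝 (DST.b m : ℂ))) ∧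
    (0.30707981393605921828549 : ℝ) ≤ DST.leadingConstant ∧
    DST.leadingConstant < (0.30707981393605921828550 : ℝ) ∧
    -- the periodic function, its Fourier expansion from the poles at `1 + χ_k`, its size, and
    -- the asymptotic expansion
    ∃ (δ : ℝ → ℝ) (c : ℤ → ℂ),
      Function.Periodic δ 1 ∧
      c 0 = 0 ∧
      (∀ k : ℤ, k ≠ 0 → Tendsto
        (fun z : ℂ => (z - (1 + DST.chi k)) * (Complex.Gamma (-z) * DST.psi z))
        (𝓝[≠] (1 + DST.chi k)) (𝓝 (c k))) ∧
      Summable (fun k : ℤ => ‖c k‖) ∧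
      (∀ x : ℝ, HasSum (fun k : ℤ => c k * Complex.exp (2 * Real.pi * Complex.I * k * x))
        (δ x : ℂ)) ∧
      (∀ x : ℝ, |δ x| < 5 / 10 ^ 5) ∧
      (fun N : ℕ => DST.averageProtected N
          - ((N : ℝ) * DST.leadingConstant + (N : ℝ) * δ (Real.logb 2 N)))
        =O[atTop] (fun _ : ℕ => (1 : ℝ)) := by
  refine ⟨DST.hasSum_eulerCoeff_mul_b.summable, DST.tendsto_b, DST.leadingConstant_bounds.1,
    DST.leadingConstant_bounds.2, DST.fluctuation, DST.periodicCoeff, DST.fluctuation_periodic,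
    if_pos rfl, fun k hk => ?_, DST.summable_norm_periodicCoeff, DST.hasSum_fluctuation,
    DST.abs_fluctuation_lt, DST.averageProtected_isBigO⟩
  rw [DST.periodicCoeff, if_neg hk]
  exact DST.tendsto_residue hk
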